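/- **Transducers.** A two-way transducer has finitely many states, initial states, final states, and finitely many rules $(q,a,v,q',d)$ (in state $q$, reading the symbol $a$, output the word $v$, go to state $q'$, move in direction $d\in\{\mathsf{left},\mathsf{right}\}$). It works nondeterministically on $\vdash w\dashv$, and left rules on $\vdash$ are not allowed. A successful run starts at the left end in an initial state and ends beyond $\dashv$ in a final state. The transducer defines the relation of all pairs $(w,v)$ such that some successful run on $w$ has output $v$. It is *functional* if every input has at most one output, and *sweeping* if, in all runs, the head changes direction only when it reads $\vdash$ or $\dashv$. It is *one-way definable* if the same relation is defined by a one-way transducer, i.e. one that never moves left; one-way transducers may use $\varepsilon$-transitions (which produce output without reading input). **PCP.** An instance $\tau=(\Sigma,\Delta,f,g)$ of the Post Correspondence Problem consists of two disjoint finite alphabets and two morphisms $f,g:\Sigma^*\to\Delta^*$; a solution is a word $w\in\Sigma^+$ with $f(w)=g(w)$. Let $\#\notin\Sigma\cup\Delta$. An *encoding* is a pair $(w\cdot u,\ w\cdot\#^m)$ with $w\in\Sigma^+$, $u\in\Delta^*$, $m\in\mathbb N$. It is *good* if $m=|u|$ and $u=f(w)=g(w)$, and *bad* otherwise. Let $B_\tau$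 be the set of bad encodings. **Proposition 9.3.** 1. There is a computable map $\tau\mapsto S_\tau$ such that, for every PCP instance $\tau$, $S_\tau$ is a sweeping transducer (without $\varepsilon$-transitions) that defines the relation $B_\tau$. If moreover no letter of $\Sigma$ is mapped to the empty word by both $f$ and $g$, then $S_\tau$ is one-way definable if and only if $\tau$ has no solution. 2. The one-way definability problem for non-functional sweeping transducers is undecidable: there is no algorithm that, for every non-functional sweeping transducer, correctly decides whether it is one-way definable. 3. Statement 2 also holds if the one-way transducers in the definition of one-way definability are not allowed to use $\varepsilon$-transitions. -/

import Mathlib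

/-- Tape symbols: the left delimiter, the right delimiter, and ordinary input letters.
Letters (input and output) and states are named by natural numbers; a transducer is a finite
object, so that only finitely many of these names occur in it, and these form its finite
state space and its finite alphabets. -/
inductive TapeSym : Type where
  | leftEnd : TapeSym
  | rightEnd : TapeSym
  | letter : ℕ → TapeSym

/-- Head directions. -/
inductive Dir : Type where
  | left : Dir
  | right : Dir

/-- The obvious coding of tape symbols, used only to speak of computability. -/
def TapeSym.equiv : TapeSym ≃ Option (Option ℕ) where
  toFun
    | .leftEnd => none
    | .rightEnd => some none
    | .letter n => some (some n)
  invFun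
    | none => .leftEnd
    | some none => .rightEnd
    | some (some n) => .letter n
  left_inv := by rintro (_ | _ | _) <;> rfl
  right_inv := by rintro (_ | _ | _) <;> rfl

/-- The obvious coding of directions. -/
def Dir.equiv : Dir ≃ Bool where
  toFun
    | .left => false
    | .right => true
  invFun
    | false => .left
    | true => .right
  left_inv := by rintro (_ | _) <;> rfl
  right_inv := by rintro (_ | _) <;> rfl

instance TapeSym.instPrimcodable : Primcodable TapeSym := Primcodable.ofEquiv _ TapeSym.equiv

instance Dir.instPrimcodable : Primcodable Dir := Primcodable.ofEquiv _ Dir.equiv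

/-- The word on the tape for the input `w`: the letters of `w` between the two delimiters. -/
def tape (w : List ℕ) : List TapeSym := TapeSym.leftEnd :: (w.map TapeSym.letter ++ [TapeSym.rightEnd])

/-- A transition rule `(q, a, v, q', d)`: in state `q`, reading the symbol `a`, output the word `v`,
go to state `q'` and move the head in direction `d`. -/
abbrev Rule : Type := ℕ × TapeSym × List ℕ × ℕ × Dir

/-- A (nondeterministic) two-way transducer, given by its finitely many transition rules, its
initial states and its final states. -/
structure TwoWayTransducer : Type where
  rules : List Rule
  initial : List ℕ
  final : List ℕ

/-- A configuration: the current state `q` and the number `i` of tape cells to the left of the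
head. On the tape `x ++ y` with `x` of length `i`, this is the configuration written `x q y`:
the head reads the first symbol of `y`. -/
abbrev Config : Type := ℕ × ℕ

namespace TwoWayTransducer

/-- The obvious coding of transducers by tuples. -/
def equiv : TwoWayTransducer ≃ List Rule × List ℕ × List ℕ where
  toFun T := (T.rules, T.initial, T.final)
  invFun t := ⟨t.1, t.2.1, t.2.2⟩
  left_inv _ := rfl
  right_inv _ := rfl

instance instPrimcodable : Primcodable TwoWayTransducer := Primcodable.ofEquiv _ equiv

/-- `T.Step w c v d c'`: on the input `w`, there is a transition in direction `d` from the
configuration `c` to the configuration `c'` that outputs `v`. A left transition is impossible on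
the leftmost cell; a right transition on the rightmost cell leads to a configuration that has no
further transition. -/
inductive Step (T : TwoWayTransducer) (w : List ℕ) : Config → List ℕ → Dir → Config → Prop where
  | right {q q' i : ℕ} {a : TapeSym} {v : List ℕ} :
      (tape w)[i]? = some a → (q, a, v, q', Dir.right) ∈ T.rules →
      Step T w (q, i) v Dir.right (q', i + 1)
  | left {q q' i : ℕ} {a : TapeSym} {v : List ℕ} :
      (tape w)[i + 1]? = some a → (q, a, v, q', Dir.left) ∈ T.rules →
      Step T w (q, i + 1) v Dir.left (q', i)

/-- `T.Run w c v c'`: on the input `w`, there is a run (a finite sequence of transitions) from `c`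
to `c'` whose output, the concatenation of the outputs of its transitions, is `v`. -/
inductive Run (T : TwoWayTransducer) (w : List ℕ) : Config → List ℕ → Config → Prop where
  | nil (c : Config) : Run T w c [] c
  | cons {c c' c'' : Config} {v v' : List ℕ} {d : Dir} :
      T.Step w c v d c' → Run T w c' v' c'' → Run T w c (v ++ v') c''

/-- The relation defined by `T`: all pairs `(w, v)` such that `v` is the output of a successful run
on `w`, i.e. one that starts at the left end of the tape in an initial state and ends beyond the
last tape cell in a final state. -/
def rel (T : TwoWayTransducer) : Set (List ℕ × List ℕ) :=
  {p | ∃ q ∈ T.initial, ∃ q' ∈ T.final, T.Run p.1 (q, 0) p.2 (q', (tape p.1).length)}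

/-- Left transitions on the left delimiter are not allowed. -/
def WellFormed (T : TwoWayTransducer) : Prop :=
  ∀ q v q' d, (q, TapeSym.leftEnd, v, q', d) ∈ T.rules → d = Dir.right

/-- Reversals happen only at the borders of the input: in all runs, whenever two consecutive
transitions have different directions, the head is on the first or on the last tape cell in the
configuration between them. -/
def IsSweeping (T : TwoWayTransducer) : Prop :=
  ∀ (w : List ℕ) (c c' c'' : Config) (v v' : List ℕ) (d d' : Dir),
    T.Step w c v d c' → T.Step w c' v' d' c'' → d ≠ d' →
      c'.2 = 0 ∨ c'.2 + 1 = (tape w).length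

/-- No left transition rules. -/
def IsOneWay (T : TwoWayTransducer) : Prop :=
  ∀ q a v q' d, (q, a, v, q', d) ∈ T.rules → d = Dir.right

/-- At most one output per input. -/
def IsFunctional (T : TwoWayTransducer) : Prop :=
  ∀ w v v', (w, v) ∈ T.rel → (w, v') ∈ T.rel → v = v'

end TwoWayTransducer

/-- A one-way transducer with `ε`-transitions: in a rule `(q, x, v, q')` the label `x` is either
`some a` (read the symbol `a` and move right) or `none` (an `ε`-transition, which reads nothing and
leaves the head in place). -/
structure OneWayTransducer : Type where
  rules : List (ℕ × Option TapeSym × List ℕ × ℕ)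
  initial : List ℕ
  final : List ℕ

namespace OneWayTransducer

/-- `T.Run q x v q'`: from state `q`, the transducer can consume the tape word `x`, output `v`, and
end in state `q'`. -/
inductive Run (T : OneWayTransducer) : ℕ → List TapeSym → List ℕ → ℕ → Prop where
  | nil (q : ℕ) : Run T q [] [] q
  | read {q q' q'' : ℕ} {a : TapeSym} {x : List TapeSym} {v v' : List ℕ} :
      (q, some a, v, q') ∈ T.rules → Run T q' x v' q'' → Run T q (a :: x) (v ++ v') q''
  | eps {q q' q'' : ℕ} {x : List TapeSym} {v v' : List ℕ} :
      (q, none, v, q') ∈ T.rules → Run T q' x v' q'' → Run T q x (v ++ v') q''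

/-- The relation defined by a one-way transducer with `ε`-transitions. -/
def rel (T : OneWayTransducer) : Set (List ℕ × List ℕ) :=
  {p | ∃ q ∈ T.initial, ∃ q' ∈ T.final, T.Run q (tape p.1) p.2 q'}

end OneWayTransducer

namespace TwoWayTransducer

/-- `T` is equivalent to a one-way transducer, where one-way transducers may use `ε`-transitions. -/
def OneWayDefinable (T : TwoWayTransducer) : Prop :=
  ∃ T' : OneWayTransducer, T'.rel = T.rel

/-- `T` is equivalent to a one-way transducer without `ε`-transitions, i.e. to a transducer of
the two-way model that has no left transition rules. -/
def EpsFreeOneWayDefinable (T : TwoWayTransducer) : Prop :=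
  ∃ T' : TwoWayTransducer, T'.IsOneWay ∧ T'.rel = T.rel

end TwoWayTransducer

/-- An instance of the Post Correspondence Problem: the alphabets are `Σ = {0, …, k - 1}` with `k`
the length of `images`, and `Δ = {0, …, deltaSize - 1}`; the `i`-th entry of `images` is the pair
`(f i, g i)` of images of the letter `i` under the two morphisms. -/
structure PCPInstance : Type where
  deltaSize : ℕ
  images : List (List ℕ × List ℕ)

namespace PCPInstance

/-- The obvious coding of instances by pairs. -/
def equiv : PCPInstance ≃ ℕ × List (List ℕ × List ℕ) where
  toFun τ := (τ.deltaSize, τ.images)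
  invFun t := ⟨t.1, t.2⟩
  left_inv _ := rfl
  right_inv _ := rfl

instance instPrimcodable : Primcodable PCPInstance := Primcodable.ofEquiv _ equiv

/-- Words over the alphabet `Σ`. -/
def SourceWord (τ : PCPInstance) (w : List ℕ) : Prop := ∀ i ∈ w, i < τ.images.length

/-- Words over the alphabet `Δ`. -/
def TargetWord (τ : PCPInstance) (u : List ℕ) : Prop := ∀ j ∈ u, j < τ.deltaSize

/-- The images of the letters are words over `Δ`, so that the data describe two morphisms from
`Σ*` to `Δ*`. -/
def Valid (τ : PCPInstance) : Prop :=
  ∀ p ∈ τ.images, τ.TargetWord p.1 ∧ τ.TargetWord p.2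

/-- The first morphism. -/
def f (τ : PCPInstance) (w : List ℕ) : List ℕ := w.flatMap fun i => (τ.images.getD i ([], [])).1

/-- The second morphism. -/
def g (τ : PCPInstance) (w : List ℕ) : List ℕ := w.flatMap fun i => (τ.images.getD i ([], [])).2

/-- A solution is a non-empty word over `Σ` on which the two morphisms agree. -/
def HasSolution (τ : PCPInstance) : Prop :=
  ∃ w, w ≠ [] ∧ τ.SourceWord w ∧ τ.f w = τ.g w

/-- No letter is mapped to the empty word by both morphisms. -/
def NoLetterErased (τ : PCPInstance) : Prop := ([], []) ∉ τ.images

/-- The fresh symbol `#`. The alphabet `Σ ∪ Δ ∪ {#}` (a disjoint union) is embedded in `ℕ`. -/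
def sharp : ℕ := 0

/-- The copy in `ℕ` of the letter `i` of `Σ`. -/
def src (i : ℕ) : ℕ := 2 * i + 1

/-- The copy in `ℕ` of the letter `j` of `Δ`. -/
def tgt (j : ℕ) : ℕ := 2 * j + 2

/-- The pair `(w · u, w · #^m)`. -/
def encode (w u : List ℕ) (m : ℕ) : List ℕ × List ℕ :=
  (w.map src ++ u.map tgt, w.map src ++ List.replicate m sharp)

/-- All encodings: the pairs `(w · u, w · #^m)` with `w ∈ Σ⁺`, `u ∈ Δ*` and `m ∈ ℕ`. -/
def encodings (τ : PCPInstance) : Set (List ℕ × List ℕ) :=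
  {p | ∃ w u m, w ≠ [] ∧ τ.SourceWord w ∧ τ.TargetWord u ∧ p = encode w u m}

/-- Good encodings: the encodings `(w · u, w · #^|u|)` with `u = f w = g w`. -/
def goodEncodings (τ : PCPInstance) : Set (List ℕ × List ℕ) :=
  {p | p ∈ τ.encodings ∧ ∃ w u, p = encode w u u.length ∧ u = τ.f w ∧ u = τ.g w}

/-- Bad encodings: all other encodings. -/
def badEncodings (τ : PCPInstance) : Set (List ℕ × List ℕ) := τ.encodings \ τ.goodEncodings

end PCPInstance

/-! The transducer for `B_τ` copies the source word `w` in a first sweep and then guesses why the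
pair is bad. For outputs of the wrong length it writes fewer or more symbols `#` than `|u|`. For a
wrong image it guesses a position `i` in `f w` (or `g w`) and a position `k` in `u` carrying
different letters, the end of a word counting as a letter, and writes `i + (|u| - k)` symbols. This
number equals `|u|` only if `i = k`, and then the image differs from `u`; so only bad pairs arise,
and all of them do (`rel_transducer`).

If `τ` has no solution, all encodings are bad, and the relation of all encodings is one-way
definable by means of an ε-loop that writes `#`. If `w` is a solution and no letter is erased, the
pair with input `w^n · f(w)^m` and output `w^n · #^(m·|f w|)`, for positive `n` and `m`, is bad
exactly when `n ≠ m`. No one-way transducer can do this (`OneWayTransducer.not_rel_of_ne`):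
colouring the pairs `n < m` by the situation in which a run completes the prefix of the input or of
the output yields `k < n < m` of which the runs for `(n, m)` and `(k, n)` can be spliced into a run
for the forbidden pair `(n, n)`.

The undecidability statements are reduced from the halting problem directly, since the ε-loop makes
the first construction unsuitable for ε-free transducers. For fixed morphisms `f`, `g` and a fixed
word `y`, a word `x` gives a sweeping transducer that reads `w · 0 · z`. It outputs `u · 0 · v` with
`u ≠ g w · y` and `|v| = 2|z|`, by right moves alone, or `x · f w · 0 · z · z`, in two sweeps. If `x
· f w = g w · y` has no solution, the second kind of output is always of the first kind, and the
right rules suffice, without ε. If `w` is a solution, the outputs that begin with `x · f w · 0` on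
inputs `w · 0 · z` give the map from `z` to `z · z`, which is not one-way definable even with ε
(`OneWayTransducer.not_squaring`). One dichotomy therefore serves both models.

Solvability of the equation expresses a derivation from `x` to `y` in a string rewriting system, by
Post's tiles (`Rewrites.exists_tiles_iff`). The system simulates a Turing machine with an
undecidable halting problem (`TM0Rewriting.reaches_iff_halts`, `HaltingProblem.exists_tm0`), and `x`
encodes its input. -/

/-! ### Right passes and sweeping runs -/

namespace TwoWayTransducer

variable {T : TwoWayTransducer}

/-- `T.Pass q x v q'`: from state `q`, the right rules of `T` can read the tape word `x`, output
`v` and end in state `q'`. -/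
inductive Pass (T : TwoWayTransducer) : ℕ → List TapeSym → List ℕ → ℕ → Prop where
  | nil (q : ℕ) : Pass T q [] [] q
  | cons {q q' q'' : ℕ} {a : TapeSym} {x : List TapeSym} {v v' : List ℕ} :
      (q, a, v, q', Dir.right) ∈ T.rules → Pass T q' x v' q'' → Pass T q (a :: x) (v ++ v') q''

theorem pass_nil_iff {q q' : ℕ} {v : List ℕ} : T.Pass q [] v q' ↔ q' = q ∧ v = [] := by
  constructor
  · rintro ⟨⟩
    exact ⟨rfl, rfl⟩
  · rintro ⟨rfl, rfl⟩
    exact .nil _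

theorem pass_cons_iff {q q'' : ℕ} {a : TapeSym} {x : List TapeSym} {v : List ℕ} :
    T.Pass q (a :: x) v q'' ↔ ∃ v₁ v₂ q', v = v₁ ++ v₂ ∧ (q, a, v₁, q', Dir.right) ∈ T.rules ∧
      T.Pass q' x v₂ q'' := by
  constructor
  · intro h
    cases h with
    | cons h₁ h₂ => exact ⟨_, _, _, rfl, h₁, h₂⟩
  · rintro ⟨v₁, v₂, q', rfl, h₁, h₂⟩
    exact .cons h₁ h₂

/-- The tape word of `y` without the right delimiter. -/
abbrev openTape (y : List ℕ) : List TapeSym := TapeSym.leftEnd :: y.map TapeSym.letter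

/-- `T.Sweeps y q x v p`: on the input `y`, with the rest `x` of `openTape y` to be read before the
right delimiter, there is a run from state `q` with output `v` that leaves the tape in state `p`,
and that consists of right passes and of silent returns to the left delimiter. -/
inductive Sweeps (T : TwoWayTransducer) (y : List ℕ) :
    ℕ → List TapeSym → List ℕ → ℕ → Prop where
  | exit {q p : ℕ} {v : List ℕ} :
      (q, TapeSym.rightEnd, v, p, Dir.right) ∈ T.rules → Sweeps T y q [] v p
  | read {q q' p : ℕ} {a : TapeSym} {x : List TapeSym} {v v' : List ℕ} :
      (q, a, v, q', Dir.right) ∈ T.rules → Sweeps T y q' x v' p → Sweeps T y q (a :: x) (v ++ v') p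
  | bounce {q l p : ℕ} {v v' : List ℕ} :
      (q, TapeSym.rightEnd, v, l, Dir.left) ∈ T.rules →
      (∀ a ∈ y, (l, TapeSym.letter a, [], l, Dir.left) ∈ T.rules) →
      Sweeps T y l (openTape y) v' p → Sweeps T y q [] (v ++ v') p

theorem sweeps_cons_iff {y : List ℕ} {q p : ℕ} {a : TapeSym} {x : List TapeSym} {v : List ℕ} :
    T.Sweeps y q (a :: x) v p ↔ ∃ v₁ v₂ q', v = v₁ ++ v₂ ∧ (q, a, v₁, q', Dir.right) ∈ T.rules ∧
      T.Sweeps y q' x v₂ p := by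
  constructor
  · intro h
    cases h with
    | read h₁ h₂ => exact ⟨_, _, _, rfl, h₁, h₂⟩
  · rintro ⟨v₁, v₂, q', rfl, h₁, h₂⟩
    exact .read h₁ h₂

theorem sweeps_nil_iff {y : List ℕ} {q p : ℕ} {v : List ℕ} :
    T.Sweeps y q [] v p ↔ (q, TapeSym.rightEnd, v, p, Dir.right) ∈ T.rules ∨
      ∃ v₁ v₂ l, v = v₁ ++ v₂ ∧ (q, TapeSym.rightEnd, v₁, l, Dir.left) ∈ T.rules ∧
        (∀ a ∈ y, (l, TapeSym.letter a, [], l, Dir.left) ∈ T.rules) ∧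
        T.Sweeps y l (openTape y) v₂ p := by
  constructor
  · intro h
    cases h with
    | exit h => exact .inl h
    | bounce h₁ h₂ h₃ => exact .inr ⟨_, _, _, rfl, h₁, h₂, h₃⟩
  · rintro (h | ⟨v₁, v₂, l, rfl, h₁, h₂, h₃⟩)
    · exact .exit h
    · exact .bounce h₁ h₂ h₃

theorem sweeps_append_iff {y : List ℕ} {q p : ℕ} {x₁ x₂ : List TapeSym} {v : List ℕ} :
    T.Sweeps y q (x₁ ++ x₂) v p ↔ ∃ v₁ v₂ q', v = v₁ ++ v₂ ∧ T.Pass q x₁ v₁ q' ∧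
      T.Sweeps y q' x₂ v₂ p := by
  induction x₁ generalizing q v with
  | nil => simp [pass_nil_iff]
  | cons a x₁ ih =>
    simp only [List.cons_append, sweeps_cons_iff, ih, pass_cons_iff]
    constructor
    · rintro ⟨v₁, _, q', rfl, h, v₂, v₃, q'', rfl, h₂, h₃⟩
      exact ⟨v₁ ++ v₂, v₃, q'', by simp, ⟨v₁, v₂, q', rfl, h, h₂⟩, h₃⟩
    · rintro ⟨_, v₃, q'', rfl, ⟨v₁, v₂, q', rfl, h, h₂⟩, h₃⟩
      exact ⟨v₁, v₂ ++ v₃, q', by simp, h, v₂, v₃, q'', rfl, h₂, h₃⟩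

/-- The states in `L` return silently to the left delimiter, all the other states only move to the
right, except on the right delimiter, where they may change to a state in `L`. -/
structure Structured (T : TwoWayTransducer) (L : ℕ → Prop) : Prop where
  leftEnd : ∀ {q v q' d}, (q, TapeSym.leftEnd, v, q', d) ∈ T.rules → d = Dir.right ∧ ¬ L q'
  letter : ∀ {q a v q' d}, (q, TapeSym.letter a, v, q', d) ∈ T.rules →
    (d = Dir.right ∧ ¬ L q ∧ ¬ L q') ∨ (d = Dir.left ∧ L q ∧ q' = q ∧ v = [])
  rightEnd : ∀ {q v q'}, (q, TapeSym.rightEnd, v, q', Dir.left) ∈ T.rules → L q'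

theorem tape_eq (y : List ℕ) : tape y = openTape y ++ [TapeSym.rightEnd] := rfl

theorem length_tape (y : List ℕ) : (tape y).length = y.length + 2 := by simp [tape]

theorem tape_getElem?_zero (y : List ℕ) : (tape y)[0]? = some TapeSym.leftEnd := rfl

theorem tape_getElem?_succ {y : List ℕ} {i : ℕ} (h : i < y.length) :
    (tape y)[i + 1]? = some (TapeSym.letter y[i]) := by
  simp [tape, h, List.getElem?_append]

theorem tape_getElem?_last (y : List ℕ) :
    (tape y)[y.length + 1]? = some TapeSym.rightEnd := by
  simp [tape]

theorem tape_getElem?_eq_none {y : List ℕ} {i : ℕ} (h : y.length + 2 ≤ i) :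
    (tape y)[i]? = none := by
  simp [tape]; omega

namespace Structured

variable {L : ℕ → Prop}

theorem wellFormed (hT : T.Structured L) : T.WellFormed :=
  fun _ _ _ _ h => (hT.leftEnd h).1

/-- On a letter, membership of the state in `L` determines the direction of the move, and every move
that ends on a letter enters `L` exactly when it goes left. So the direction persists between the
delimiters. -/
theorem isSweeping (hT : T.Structured L) : T.IsSweeping := by
  rintro y ⟨q, i⟩ ⟨q', i'⟩ ⟨q'', i''⟩ v v' d d' h₁ h₂ hd
  by_contra! hb
  obtain ⟨hb₁, hb₂⟩ := hb
  simp only [length_tape] at hb₁ hb₂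
  obtain ⟨j, rfl⟩ : ∃ j, i' = j + 1 := ⟨i' - 1, by omega⟩
  by_cases hj : y.length + 2 ≤ j + 1
  · cases h₂ with
    | right h _ => simp [tape_getElem?_eq_none hj] at h
    | left h _ => simp [tape_getElem?_eq_none hj] at h
  have hj' : j < y.length := by omega
  have hL : d' = Dir.left ↔ L q' := by
    cases h₂ with
    | right h hr =>
      rw [tape_getElem?_succ hj'] at h
      cases h
      have := hT.letter hr
      simp_all
    | left h hr =>
      rw [tape_getElem?_succ hj'] at h
      cases h
      have := hT.letter hr
      simp_all
  have hL' : d = Dir.left ↔ L q' := by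
    cases h₁ with
    | @right _ _ i _ _ h hr =>
      rcases Nat.eq_zero_or_pos i with rfl | h0
      · rw [tape_getElem?_zero] at h
        cases h
        have := hT.leftEnd hr
        simp_all
      · obtain ⟨k, rfl⟩ : ∃ k, i = k + 1 := ⟨i - 1, by omega⟩
        rw [tape_getElem?_succ (by omega)] at h
        cases h
        have := hT.letter hr
        simp_all
    | left h hr =>
      by_cases h0 : j + 1 < y.length
      · rw [tape_getElem?_succ h0] at h
        cases h
        have := hT.letter hr
        simp_all
      · have h0' : j + 1 = y.length := by omega
        rw [h0', tape_getElem?_last] at h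
        cases h
        have := hT.rightEnd hr
        simp_all
  cases d <;> cases d' <;> simp_all

/-- Induction along the run. A returning state inside the tape accumulates the return rules for all
letters to its left; at the right delimiter these are the rules for the whole input that `bounce`
asks for. At the left delimiter both descriptions apply. -/
theorem sweeps_of_run (hT : T.Structured L) {y : List ℕ} {c c' : Config} {v : List ℕ}
    (h : T.Run y c v c') (hc' : c'.2 = y.length + 2) :
    c.2 < y.length + 2 →
    ((¬ L c.1 ∨ c.2 = 0 ∨ c.2 = y.length + 1) → T.Sweeps y c.1 ((openTape y).drop c.2) v c'.1) ∧
    ((L c.1 ∧ c.2 ≤ y.length) → (∀ i (hi : i < y.length), i < c.2 →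
      (c.1, TapeSym.letter y[i], [], c.1, Dir.left) ∈ T.rules) ∧
        T.Sweeps y c.1 (openTape y) v c'.1) := by
  induction h with
  | nil c => omega
  | @cons c₀ c₁ c₂ v v' d hs hr ih =>
    intro hc
    specialize ih hc'
    cases hs with
    | @right q q' i a v h hrule =>
      simp only at hc ih ⊢
      rcases Nat.eq_zero_or_pos i with rfl | hi
      · rw [tape_getElem?_zero] at h
        cases h
        have hL := (hT.leftEnd hrule).2
        have := (ih (by omega)).1 (.inl hL)
        have key : T.Sweeps y q (openTape y) (v ++ v') c₂.1 := .read hrule this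
        exact ⟨fun _ => key, fun _ => ⟨by simp, key⟩⟩
      · obtain ⟨k, rfl⟩ : ∃ k, i = k + 1 := ⟨i - 1, by omega⟩
        by_cases hk : k < y.length
        · rw [tape_getElem?_succ hk] at h
          cases h
          have hL := hT.letter hrule
          simp only [reduceCtorEq, false_and, or_false, true_and] at hL
          refine ⟨fun _ => ?_, fun h => absurd h.1 hL.1⟩
          have := (ih (by omega)).1 (.inl hL.2)
          have hd : (openTape y).drop (k + 1) = TapeSym.letter y[k] :: (openTape y).drop (k + 1 + 1) := by
            rw [List.drop_eq_getElem_cons (by simp [hk])]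
            simp
          rw [hd]
          exact .read hrule this
        · obtain rfl : k = y.length := by omega
          rw [tape_getElem?_last] at h
          cases h
          refine ⟨fun _ => ?_, fun h => by omega⟩
          have hd : (openTape y).drop (y.length + 1) = [] := by simp
          rw [hd]
          cases hr with
          | nil => simpa using Sweeps.exit hrule
          | cons hs' _ =>
            cases hs' with
            | right h _ => rw [tape_getElem?_eq_none (by omega)] at h; cases h
            | left h _ => rw [tape_getElem?_eq_none (by omega)] at h; cases h
    | @left q q' k a v h hrule =>
      simp only at hc ih ⊢
      by_cases hk : k < y.length
      · rw [tape_getElem?_succ hk] at h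
        cases h
        have hL := hT.letter hrule
        simp only [reduceCtorEq, false_and, false_or, true_and] at hL
        obtain ⟨hL, rfl, rfl⟩ := hL
        obtain ⟨h₁, h₂⟩ := (ih (by omega)).2 ⟨hL, by omega⟩
        refine ⟨fun h => by rcases h with h | h | h <;> [exact absurd hL h; omega; omega],
          fun _ => ⟨fun i hi hik => ?_, h₂⟩⟩
        rcases Nat.lt_or_ge i k with h | h
        · exact h₁ i hi h
        · obtain rfl : i = k := by omega
          exact hrule
      · obtain rfl : k = y.length := by omega
        rw [tape_getElem?_last] at h
        cases h
        refine ⟨fun _ => ?_, fun h => by omega⟩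
        obtain ⟨h₁, h₂⟩ := (ih (by omega)).2 ⟨hT.rightEnd hrule, le_refl _⟩
        have hd : (openTape y).drop (y.length + 1) = [] := by simp
        rw [hd]
        refine .bounce hrule (fun a ha => ?_) h₂
        obtain ⟨i, hi, rfl⟩ := List.mem_iff_getElem.1 ha
        exact h₁ i hi hi

end Structured

theorem run_left_of_loops {y : List ℕ} {l : ℕ}
    (hl : ∀ a ∈ y, (l, TapeSym.letter a, [], l, Dir.left) ∈ T.rules) {c : Config} {v : List ℕ}
    (h : T.Run y (l, 0) v c) : ∀ i ≤ y.length, T.Run y (l, i) v c := by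
  intro i
  induction i with
  | zero => exact fun _ => h
  | succ i ih =>
    intro hi
    have := Run.cons (Step.left (tape_getElem?_succ (by omega)) (hl y[i] (by simp))) (ih (by omega))
    simpa using this

theorem Sweeps.run {y : List ℕ} {q p : ℕ} {x : List TapeSym} {v : List ℕ}
    (h : T.Sweeps y q x v p) : ∀ i, i ≤ y.length + 1 → x = (openTape y).drop i →
      T.Run y (q, i) v (p, y.length + 2) := by
  have hnil : ∀ i, i ≤ y.length + 1 → [] = (openTape y).drop i → i = y.length + 1 := by
    intro i hi h
    have := congrArg List.length h
    simp at this
    omega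
  induction h with
  | exit hr =>
    intro i hi hx
    obtain rfl := hnil i hi hx
    simpa using Run.cons (Step.right (tape_getElem?_last y) hr) (.nil _)
  | read hr _ ih =>
    intro i hi hx
    have hlt : i < (openTape y).length := by
      by_contra hcon
      rw [List.drop_eq_nil_of_le (by omega)] at hx
      cases hx
    rw [List.drop_eq_getElem_cons hlt] at hx
    injection hx with h₁ h₂
    have hlt' : i < y.length + 1 := by simpa using hlt
    refine Run.cons (Step.right (a := (openTape y)[i]) ?_ (h₁ ▸ hr)) (ih (i + 1) (by omega) h₂)
    rw [tape_eq, List.getElem?_append_left hlt, List.getElem?_eq_getElem hlt]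
  | bounce hr hl _ ih =>
    intro i hi hx
    obtain rfl := hnil i hi hx
    exact Run.cons (Step.left (tape_getElem?_last y) hr)
      (run_left_of_loops hl (ih 0 (by omega) rfl) _ (le_refl _))

theorem Structured.mem_rel_iff {L : ℕ → Prop} (hT : T.Structured L) {y v : List ℕ} :
    (y, v) ∈ T.rel ↔ ∃ q ∈ T.initial, ∃ p ∈ T.final, T.Sweeps y q (openTape y) v p := by
  simp only [rel, Set.mem_ofPred_eq, length_tape]
  constructor
  · rintro ⟨q, hq, p, hp, h⟩
    exact ⟨q, hq, p, hp, (hT.sweeps_of_run h rfl (by simp)).1 (.inr (.inl rfl))⟩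
  · rintro ⟨q, hq, p, hp, h⟩
    exact ⟨q, hq, p, hp, h.run 0 (by omega) rfl⟩

end TwoWayTransducer

/-! ### One-way transducers -/

namespace OneWayTransducer

variable {T : OneWayTransducer}

theorem Run.append {q q' q'' : ℕ} {x x' : List TapeSym} {v v' : List ℕ} (h : T.Run q x v q')
    (h' : T.Run q' x' v' q'') : T.Run q (x ++ x') (v ++ v') q'' := by
  induction h with
  | nil => exact h'
  | read hr _ ih => simpa using Run.read hr (ih h')
  | eps hr _ ih => simpa using Run.eps hr (ih h')

/-- The states of `T` that are initial or the target of a rule. -/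
def targets (T : OneWayTransducer) : List ℕ := T.initial ++ T.rules.map fun r => r.2.2.2

/-- The suffixes of the outputs of the rules of `T`. -/
def pending (T : OneWayTransducer) : List (List ℕ) := [] :: T.rules.flatMap fun r => r.2.2.1.tails

theorem target_mem {q : ℕ} {x : Option TapeSym} {v : List ℕ} {q' : ℕ}
    (h : (q, x, v, q') ∈ T.rules) : q' ∈ T.targets :=
  List.mem_append_right _ (List.mem_map.2 ⟨_, h, rfl⟩)

theorem Run.mem_targets {q q' : ℕ} {x : List TapeSym} {v : List ℕ} (h : T.Run q x v q')
    (hq : q ∈ T.targets) : q' ∈ T.targets := by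
  induction h with
  | nil => exact hq
  | read hr _ ih => exact ih (target_mem hr)
  | eps hr _ ih => exact ih (target_mem hr)

theorem Run.split_input {q q' : ℕ} {x : List TapeSym} {v : List ℕ} (h : T.Run q x v q') :
    ∀ x₁ x₂, x = x₁ ++ x₂ →
      ∃ v₁ v₂ q₁, v = v₁ ++ v₂ ∧ T.Run q x₁ v₁ q₁ ∧ T.Run q₁ x₂ v₂ q' := by
  induction h with
  | nil q =>
    intro x₁ x₂ h
    obtain ⟨rfl, rfl⟩ := List.nil_eq_append_iff.1 h
    exact ⟨[], [], q, rfl, .nil q, .nil q⟩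
  | @read q q' q'' a x v v' hr h' ih =>
    intro x₁ x₂ h
    rcases List.cons_eq_append_iff.1 h with ⟨rfl, rfl⟩ | ⟨x₃, rfl, rfl⟩
    · exact ⟨[], _, _, rfl, .nil _, .read hr h'⟩
    · obtain ⟨v₁, v₂, q₁, rfl, h₁, h₂⟩ := ih _ _ rfl
      exact ⟨_, _, _, (List.append_assoc ..).symm, .read hr h₁, h₂⟩
  | eps hr _ ih =>
    intro x₁ x₂ h
    obtain ⟨v₁, v₂, q₁, rfl, h₁, h₂⟩ := ih _ _ h
    exact ⟨_, _, _, (List.append_assoc ..).symm, .eps hr h₁, h₂⟩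

/-- A run can be cut only between two rules, so the rule that completes `v₁` may already have
written a further word `b`. This overshoot is a suffix of a single rule output, which leaves
finitely many possibilities. -/
theorem Run.split_output {q q' : ℕ} {x : List TapeSym} {v : List ℕ} (h : T.Run q x v q') :
    ∀ v₁ v₂, v = v₁ ++ v₂ → ∃ x₁ x₂ b v₃ q₁, x = x₁ ++ x₂ ∧ v₂ = b ++ v₃ ∧ b ∈ T.pending ∧
      T.Run q x₁ (v₁ ++ b) q₁ ∧ T.Run q₁ x₂ v₃ q' := by
  induction h with
  | nil q =>
    intro v₁ v₂ h
    obtain ⟨rfl, rfl⟩ := List.nil_eq_append_iff.1 h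
    exact ⟨[], [], [], [], q, rfl, rfl, by simp [pending], .nil q, .nil q⟩
  | @read q q' q'' a x v v' hr h' ih =>
    intro v₁ v₂ h
    rcases List.append_eq_append_iff.1 h with ⟨c, rfl, rfl⟩ | ⟨c, rfl, rfl⟩
    · obtain ⟨x₁, x₂, b, v₃, q₁, rfl, rfl, hb, h₁, h₂⟩ := ih _ _ rfl
      exact ⟨a :: x₁, x₂, b, v₃, q₁, rfl, rfl, hb, by simpa using Run.read hr h₁, h₂⟩
    · refine ⟨[a], x, c, v', q', rfl, rfl, ?_, by simpa using Run.read hr (.nil _), h'⟩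
      exact List.mem_cons_of_mem _ (List.mem_flatMap.2 ⟨_, hr, by simp⟩)
  | @eps q q' q'' x v v' hr h' ih =>
    intro v₁ v₂ h
    rcases List.append_eq_append_iff.1 h with ⟨c, rfl, rfl⟩ | ⟨c, rfl, rfl⟩
    · obtain ⟨x₁, x₂, b, v₃, q₁, rfl, rfl, hb, h₁, h₂⟩ := ih _ _ rfl
      exact ⟨x₁, x₂, b, v₃, q₁, rfl, rfl, hb, by simpa using Run.eps hr h₁, h₂⟩
    · refine ⟨[], x, c, v', q', rfl, rfl, ?_, by simpa using Run.eps hr (.nil _), h'⟩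
      exact List.mem_cons_of_mem _ (List.mem_flatMap.2 ⟨_, hr, by simp⟩)

end OneWayTransducer

/-! ### Two-way transducers without left rules as one-way transducers -/

namespace TwoWayTransducer

variable {T : TwoWayTransducer}

theorem IsOneWay.structured (h : T.IsOneWay) : T.Structured fun _ => False where
  leftEnd hr := ⟨h _ _ _ _ _ hr, id⟩
  letter hr := .inl ⟨h _ _ _ _ _ hr, id, id⟩
  rightEnd hr := by cases h _ _ _ _ _ hr

/-- The right rules of a two-way transducer as a one-way transducer. -/
def toOneWay (T : TwoWayTransducer) : OneWayTransducer where
  rules := T.rules.map fun r => (r.1, some r.2.1, r.2.2.1, r.2.2.2.1)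
  initial := T.initial
  final := T.final

theorem IsOneWay.mem_toOneWay_rules_iff (h : T.IsOneWay) {q q' : ℕ} {x : Option TapeSym}
    {v : List ℕ} : (q, x, v, q') ∈ T.toOneWay.rules ↔
      ∃ a, x = some a ∧ (q, a, v, q', Dir.right) ∈ T.rules := by
  simp only [toOneWay, List.mem_map, Prod.mk.injEq, Prod.exists]
  constructor
  · rintro ⟨_, a, _, _, d, hr, rfl, rfl, rfl, rfl⟩
    cases h _ _ _ _ _ hr
    exact ⟨a, rfl, hr⟩
  · rintro ⟨a, rfl, hr⟩
    exact ⟨_, _, _, _, _, hr, rfl, rfl, rfl, rfl⟩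

theorem IsOneWay.sweeps_iff (h : T.IsOneWay) {y : List ℕ} {x : List TapeSym} {v : List ℕ}
    {q p : ℕ} : T.Sweeps y q x v p ↔ T.toOneWay.Run q (x ++ [TapeSym.rightEnd]) v p := by
  constructor
  · intro hs
    induction hs with
    | exit hr =>
      have := OneWayTransducer.Run.read (h.mem_toOneWay_rules_iff.2 ⟨_, rfl, hr⟩) (.nil _)
      simpa using this
    | read hr _ ih => exact OneWayTransducer.Run.read (h.mem_toOneWay_rules_iff.2 ⟨_, rfl, hr⟩) ih
    | bounce hr => cases h _ _ _ _ _ hr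
  · intro hr
    generalize hx : x ++ [TapeSym.rightEnd] = x' at hr
    induction hr generalizing x with
    | nil => simp at hx
    | @read q q' q'' a x' v v' hr h' ih =>
      obtain ⟨b, hb, hr⟩ := h.mem_toOneWay_rules_iff.1 hr
      cases hb
      cases x with
      | nil =>
        injection hx with h₁ h₂
        subst h₁ h₂
        cases h' with
        | nil => simpa using Sweeps.exit hr
        | eps hr =>
          obtain ⟨b, hb, -⟩ := h.mem_toOneWay_rules_iff.1 hr
          cases hb
      | cons c x =>
        injection hx with h₁ h₂
        subst h₁
        exact .read hr (ih h₂)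
    | eps hr =>
      obtain ⟨b, hb, -⟩ := h.mem_toOneWay_rules_iff.1 hr
      cases hb

theorem IsOneWay.rel_toOneWay (h : T.IsOneWay) : T.toOneWay.rel = T.rel := by
  ext ⟨y, v⟩
  rw [h.structured.mem_rel_iff]
  simp only [h.sweeps_iff]
  rfl

theorem EpsFreeOneWayDefinable.oneWayDefinable (h : T.EpsFreeOneWayDefinable) :
    T.OneWayDefinable := by
  obtain ⟨T', h₁, h₂⟩ := h
  exact ⟨T'.toOneWay, h₁.rel_toOneWay.trans h₂⟩

end TwoWayTransducer

/-! ### Two relations that are not defined by one-way transducers -/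

/-- A colouring of the pairs `i < j` with finitely many colours has a monochromatic path of
length two. -/
theorem exists_lt_lt_color_eq {α : Type*} {S : Set α} (hS : S.Finite) (C : ℕ → ℕ → α)
    (hC : ∀ i j, i < j → C i j ∈ S) : ∃ i j k, i < j ∧ j < k ∧ C i j = C j k := by
  by_contra! hcon
  have hfin : {A | A ⊆ S}.Finite := hS.finite_subsets
  -- Without such a path, the colour of `(i, j)` leaves `i` but not `j`, so the sets of colours
  -- leaving the vertices would be infinitely many distinct subsets of `S`.
  have hinj : Function.Injective fun i => {a | ∃ j, i < j ∧ C i j = a} := by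
    intro i j hij
    simp only at hij
    by_contra hne
    wlog hlt : i < j generalizing i j
    · exact this hij.symm (Ne.symm hne) (by omega)
    have : C i j ∈ {a | ∃ k, i < k ∧ C i k = a} := ⟨j, hlt, rfl⟩
    rw [hij] at this
    obtain ⟨k, hk, h⟩ := this
    exact hcon i j k hlt hk h.symm
  refine Set.infinite_of_injective_forall_mem hinj (fun i => ?_) hfin
  rintro _ ⟨j, hj, rfl⟩
  exact hC i j hj

-- This splices two runs on inputs with the common prefix `p`. The bound `p.length + 1` counts the
-- left delimiter. If the cuts lie within the prefix, they lie at the same place; beyond it, each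
-- piece consists of letters and the proper delimiter, and the last condition ensures that the right
-- delimiter occurs exactly once.
open TwoWayTransducer in
theorem exists_tape_swap {p y y' : List ℕ} {x₁ x₂ x₁' x₂' : List TapeSym}
    (h : tape (p ++ y) = x₁ ++ x₂) (h' : tape (p ++ y') = x₁' ++ x₂')
    (hlen : min x₁.length (p.length + 1) = min x₁'.length (p.length + 1))
    (hnil : x₂ = [] ↔ x₂' = []) : ∃ z, x₁ ++ x₂' = tape (p ++ z) := by
  have key : ∀ {y : List ℕ} {x₁ x₂ : List TapeSym}, tape (p ++ y) = x₁ ++ x₂ →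
      p.length + 1 ≤ x₁.length → x₂ ≠ [] → ∃ y₁ y₂ : List ℕ, x₁ = openTape (p ++ y₁) ∧
        x₂ = y₂.map TapeSym.letter ++ [TapeSym.rightEnd] := by
    intro y x₁ x₂ h hl hx
    obtain ⟨x₃, rfl⟩ : ∃ x₃, x₁ = openTape p ++ x₃ := by
      have : openTape p <+: x₁ := by
        refine List.prefix_of_prefix_length_le (l₃ := tape (p ++ y)) ?_ ?_ (by simpa using hl)
        · exact ⟨y.map TapeSym.letter ++ [TapeSym.rightEnd], by simp [tape]⟩
        · exact ⟨x₂, h.symm⟩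
      exact ⟨_, this.choose_spec.symm⟩
    have h₂ : y.map TapeSym.letter ++ [TapeSym.rightEnd] = x₃ ++ x₂ := by simpa [tape] using h
    obtain ⟨x₄, a, rfl⟩ : ∃ x₄ a, x₂ = x₄ ++ [a] := ⟨_, _, (List.dropLast_append_getLast hx).symm⟩
    rw [← List.append_assoc] at h₂
    obtain ⟨h₃, h₄⟩ := List.append_inj' h₂ rfl
    cases h₄
    obtain ⟨y₁, y₂, rfl, rfl, rfl⟩ := List.map_eq_append_iff.1 h₃
    exact ⟨y₁, y₂, by simp, rfl⟩
  rcases Nat.lt_or_ge x₁.length (p.length + 1) with hl | hl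
  · have hpre : ∀ {y : List ℕ} {x₁ x₂ : List TapeSym}, tape (p ++ y) = x₁ ++ x₂ →
        x₁.length < p.length + 1 → x₁ = (openTape p).take x₁.length := by
      intro y x₁ x₂ h hl
      have : tape (p ++ y) = openTape p ++ (y.map TapeSym.letter ++ [TapeSym.rightEnd]) := by
        simp [tape]
      rw [this] at h
      have := congrArg (List.take x₁.length) h
      rw [List.take_left, List.take_append_of_le_length (by simp; omega)] at this
      exact this.symm
    have hl' : x₁'.length = x₁.length := by omega
    have : x₁ = x₁' := by
      rw [hpre h hl, hpre h' (by omega), hl']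
    exact ⟨y', by rw [this, h']⟩
  · by_cases hx : x₂ = []
    · exact ⟨y, by rw [hnil.1 hx, h, hx]⟩
    · obtain ⟨y₁, -, rfl, -⟩ := key h hl hx
      obtain ⟨-, y₂, -, rfl⟩ := key h' (by omega) (fun h => hx (hnil.2 h))
      exact ⟨y₁ ++ y₂, by simp [tape]⟩

namespace OneWayTransducer

/-- The relation of all pairs `(y, y · y)` is not a quotient of a relation that is defined by a
one-way transducer. -/
theorem not_squaring (T : OneWayTransducer) (p o : List ℕ)
    (h₁ : ∀ y : List ℕ, (∀ a ∈ y, a < 2) → (p ++ y, o ++ (y ++ y)) ∈ T.rel)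
    (h₂ : ∀ y v : List ℕ, (p ++ y, o ++ v) ∈ T.rel → v = y ++ y) : False := by
  classical
  -- The run on `p · y` is cut when the first copy of `y` has been written. The colour records the
  -- overshoot, the state, the position of the cut truncated at the end of `p`, and whether the
  -- whole tape has been read.
  have hcut : ∀ y : List ℕ, (∀ a ∈ y, a < 2) → ∃ c : List ℕ × ℕ × ℕ × Prop,
      c.1 ∈ T.pending ∧ c.2.1 ∈ T.targets ∧ c.2.2.1 ≤ p.length + 1 ∧
      ∃ i ∈ T.initial, ∃ f ∈ T.final, ∃ x₁ x₂ v,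
        tape (p ++ y) = x₁ ++ x₂ ∧ y = c.1 ++ v ∧ T.Run i x₁ (o ++ y ++ c.1) c.2.1 ∧
        T.Run c.2.1 x₂ v f ∧ min x₁.length (p.length + 1) = c.2.2.1 ∧ (x₂ = [] ↔ c.2.2.2) := by
    intro y hy
    obtain ⟨i, hi, f, hf, h⟩ := h₁ y hy
    obtain ⟨x₁, x₂, b, v, q, hx, hv, hb, hr₁, hr₂⟩ :=
      h.split_output (o ++ y) y (List.append_assoc ..).symm
    exact ⟨(b, q, _, _), hb, hr₁.mem_targets (List.mem_append_left _ hi), min_le_right _ _,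
      i, hi, f, hf, x₁, x₂, v, hx, hv, hr₁, hr₂, rfl, Iff.rfl⟩
  choose! C hC₁ hC₂ hC₃ hC using hcut
  let S : Set (List ℕ × ℕ × ℕ × Prop) :=
    {b | b ∈ T.pending} ×ˢ ({q | q ∈ T.targets} ×ˢ (Set.Iic (p.length + 1) ×ˢ Set.univ))
  have hS : S.Finite := (List.finite_toSet _).prod ((List.finite_toSet _).prod
    ((Set.finite_Iic _).prod Set.finite_univ))
  obtain ⟨N, hN⟩ : ∃ N, N = hS.toFinset.card := ⟨_, rfl⟩
  -- There are `N + 1` such words and only `N` colours, so two of them share a colour. All have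
  -- length `N`, so a square `z · z` equal to `Y i · Y j` forces `Y i = Y j`.
  let Y : ℕ → List ℕ := fun i => List.replicate i 0 ++ List.replicate (N - i) 1
  have hYb : ∀ i, ∀ a ∈ Y i, a < 2 := by
    intro i a ha
    simp only [Y, List.mem_append, List.mem_replicate] at ha
    omega
  obtain ⟨i, hi, j, hj, hij, hc⟩ := Finset.exists_ne_map_eq_of_card_lt_of_maps_to
    (s := Finset.range (N + 1)) (t := hS.toFinset) (f := fun i => C (Y i)) (by simp [hN])
    (by
      intro i _
      simp only [Set.Finite.coe_toFinset]
      exact ⟨hC₁ _ (hYb i), hC₂ _ (hYb i), hC₃ _ (hYb i), trivial⟩)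
  simp only [Finset.mem_range] at hi hj hc
  obtain ⟨s, hs, -, -, x₁, x₂, v, hx, hv, hr, -, hm, hn⟩ := hC (Y i) (hYb i)
  obtain ⟨-, -, f, hf, x₁', x₂', v', hx', hv', -, hr', hm', hn'⟩ := hC (Y j) (hYb j)
  rw [← hc] at hr' hm' hn' hv'
  obtain ⟨z, hz⟩ := exists_tape_swap hx hx' (hm.trans hm'.symm) (hn.trans hn'.symm)
  have hrun := hr.append hr'
  rw [hz, List.append_assoc, ← hv', List.append_assoc] at hrun
  have hsq := h₂ z (Y i ++ Y j) ⟨s, hs, f, hf, hrun⟩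
  have hli : (Y i).length = N := by simp [Y]; omega
  have hlj : (Y j).length = N := by simp [Y]; omega
  have hlz : (Y i).length = z.length := by
    have := congrArg List.length hsq
    simp only [List.length_append] at this
    omega
  obtain ⟨e₁, e₂⟩ := List.append_inj hsq hlz
  have := congrArg (List.count 0) (e₁.trans e₂.symm)
  simp [Y, List.count_append, List.count_replicate] at this
  exact hij this

end OneWayTransducer

/-! ### The sweeping transducer of an instance of the Post Correspondence Problem -/

namespace PCPInstance

/-- Rules for the symbol `a`, given by their states, outputs and directions. -/
def rulesOn (a : TapeSym) (t : List (ℕ × List ℕ × ℕ × Dir)) : List Rule :=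
  t.map fun r => (r.1, a, r.2)

theorem mem_rulesOn {a b : TapeSym} {t : List (ℕ × List ℕ × ℕ × Dir)} {q q' : ℕ} {v : List ℕ}
    {d : Dir} : (q, b, v, q', d) ∈ rulesOn a t ↔ b = a ∧ (q, v, q', d) ∈ t := by
  simp only [rulesOn, List.mem_map, Prod.mk.injEq, Prod.exists]
  constructor
  · rintro ⟨_, _, _, _, h, rfl, rfl, rfl, rfl, rfl⟩
    exact ⟨rfl, h⟩
  · rintro ⟨rfl, h⟩
    exact ⟨_, _, _, _, h, rfl, rfl, rfl, rfl, rfl⟩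

/-- Silent returns in the states `4`, …, `8`. -/
def returnTable : List (ℕ × List ℕ × ℕ × Dir) :=
  [(4, [], 4, .left), (5, [], 5, .left), (6, [], 6, .left), (7, [], 7, .left), (8, [], 8, .left)]

/-- The states: `0` is initial and `16` final. In the first sweep, `1`, `2`, `3` mean that no
letter, only source letters, or also target letters have been read. The returning states `4`, …, `8`
lead to `9`, `11`, `12`, `13`, `14`. Too few symbols are written in `9` and, after a target letter
was skipped, in `10`; too many in `11` and then in extra rounds through `6` and `12`. The images
under `f` and `g` are read in `13` and `14`, the state `17 + d` looks for a letter other than `d`,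
and `17 + deltaSize` stands for the end of the image. After the mismatch, `15` writes one symbol per
target letter. -/
def leftEndTable : List (ℕ × List ℕ × ℕ × Dir) :=
  [(0, [], 1, .right), (4, [], 9, .right), (5, [], 11, .right), (6, [], 12, .right),
    (7, [], 13, .right), (8, [], 14, .right)]

def rightEndTable (τ : PCPInstance) : List (ℕ × List ℕ × ℕ × Dir) :=
  [(2, [], 4, .left), (2, [], 5, .left), (2, [], 7, .left), (2, [], 8, .left),
    (3, [], 4, .left), (3, [], 5, .left), (3, [], 7, .left), (3, [], 8, .left),
    (10, [], 16, .right), (11, [sharp], 6, .left), (12, [], 16, .right), (12, [sharp], 6, .left),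
    (15, [], 16, .right)] ++
  (List.range τ.deltaSize).map fun d => (17 + d, [], 16, .right)

/-- Guess a position in the image `v` of a letter and store the letter `d` of `v` at this position
in the state `17 + d`, or skip the whole image. -/
def imageTable (s : ℕ) (v : List ℕ) : List (ℕ × List ℕ × ℕ × Dir) :=
  (s, List.replicate v.length sharp, s, .right) ::
    (List.range v.length).map fun o => (s, List.replicate o sharp, 17 + v.getD o 0, .right)

def srcTable (τ : PCPInstance) (i : ℕ) : List (ℕ × List ℕ × ℕ × Dir) :=
  [(1, [src i], 2, .right), (2, [src i], 2, .right)] ++ returnTable ++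
  [(9, [], 9, .right), (11, [], 11, .right), (12, [], 12, .right)] ++
  imageTable 13 (τ.images.getD i ([], [])).1 ++ imageTable 14 (τ.images.getD i ([], [])).2 ++
  (List.range τ.deltaSize).map fun d => (17 + d, [], 17 + d, .right)

def tgtTable (τ : PCPInstance) (j : ℕ) : List (ℕ × List ℕ × ℕ × Dir) :=
  [(2, [], 3, .right), (3, [], 3, .right)] ++ returnTable ++
  [(9, [sharp], 9, .right), (9, [], 10, .right), (10, [sharp], 10, .right), (10, [], 10, .right),
    (11, [sharp], 11, .right), (12, [], 12, .right), (15, [sharp], 15, .right),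
    (13, [sharp], 15, .right), (14, [sharp], 15, .right),
    (13, [], 17 + τ.deltaSize, .right), (14, [], 17 + τ.deltaSize, .right)] ++
  (List.range (τ.deltaSize + 1)).flatMap fun d =>
    (17 + d, [], 17 + d, .right) :: if d = j then [] else [(17 + d, [sharp], 15, .right)]

/-- The sweeping transducer that defines the bad encodings. A first sweep copies the source word.
The following sweeps output the symbols `sharp`, either fewer or more than there are letters in the
target word, or as many as there are letters in an image of the source word before a position and
in the target word after a position, such that the letters at the two positions differ. -/
def transducer (τ : PCPInstance) : TwoWayTransducer where
  rules := rulesOn .leftEnd leftEndTable ++ rulesOn .rightEnd τ.rightEndTable ++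
    (List.range τ.images.length).flatMap (fun i => rulesOn (.letter (src i)) (τ.srcTable i)) ++
    (List.range τ.deltaSize).flatMap (fun j => rulesOn (.letter (tgt j)) (τ.tgtTable j))
  initial := [0]
  final := [16]

variable {τ : PCPInstance} {q q' : ℕ} {v : List ℕ} {d : Dir}

theorem src_ne_tgt (i j : ℕ) : src i ≠ tgt j := by unfold src tgt; omega

theorem tgt_ne_src (i j : ℕ) : tgt i ≠ src j := by unfold src tgt; omega

theorem src_injective : Function.Injective src := fun i j h => by unfold src at h; omega

theorem tgt_injective : Function.Injective tgt := fun i j h => by unfold tgt at h; omega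

theorem mem_rules_leftEnd : (q, .leftEnd, v, q', d) ∈ τ.transducer.rules ↔
    (q, v, q', d) ∈ leftEndTable := by
  simp [transducer, mem_rulesOn]

theorem mem_rules_rightEnd : (q, .rightEnd, v, q', d) ∈ τ.transducer.rules ↔
    (q, v, q', d) ∈ τ.rightEndTable := by
  simp [transducer, mem_rulesOn]

theorem mem_rules_letter {a : ℕ} : (q, .letter a, v, q', d) ∈ τ.transducer.rules ↔
    (∃ i < τ.images.length, a = src i ∧ (q, v, q', d) ∈ τ.srcTable i) ∨
      ∃ j < τ.deltaSize, a = tgt j ∧ (q, v, q', d) ∈ τ.tgtTable j := by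
  simp [transducer, mem_rulesOn]

theorem mem_rules_src {i : ℕ} : (q, .letter (src i), v, q', d) ∈ τ.transducer.rules ↔
    i < τ.images.length ∧ (q, v, q', d) ∈ τ.srcTable i := by
  simp only [mem_rules_letter, src_ne_tgt, false_and, and_false, exists_false, or_false]
  constructor
  · rintro ⟨j, hj, h, hr⟩
    cases src_injective h
    exact ⟨hj, hr⟩
  · rintro ⟨h, hr⟩
    exact ⟨i, h, rfl, hr⟩

theorem mem_rules_tgt {j : ℕ} : (q, .letter (tgt j), v, q', d) ∈ τ.transducer.rules ↔
    j < τ.deltaSize ∧ (q, v, q', d) ∈ τ.tgtTable j := by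
  simp only [mem_rules_letter, tgt_ne_src, false_and, and_false, exists_false, false_or]
  constructor
  · rintro ⟨i, hi, h, hr⟩
    cases tgt_injective h
    exact ⟨hi, hr⟩
  · rintro ⟨h, hr⟩
    exact ⟨j, h, rfl, hr⟩

theorem mem_returnTable : (q, v, q', d) ∈ returnTable ↔
    (4 ≤ q ∧ q ≤ 8) ∧ v = [] ∧ q' = q ∧ d = .left := by
  simp only [returnTable, List.mem_cons, Prod.mk.injEq, List.not_mem_nil, or_false]
  constructor
  · rintro (h | h | h | h | h) <;> obtain ⟨rfl, rfl, rfl, rfl⟩ := h <;> simp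
  · rintro ⟨⟨h₁, h₂⟩, rfl, rfl, rfl⟩
    interval_cases q' <;> simp

theorem mem_imageTable {s : ℕ} {z : List ℕ} : (q, v, q', d) ∈ imageTable s z ↔
    q = s ∧ d = .right ∧ ((v = List.replicate z.length sharp ∧ q' = s) ∨
      ∃ o, ∃ h : o < z.length, v = List.replicate o sharp ∧ q' = 17 + z[o]) := by
  simp only [imageTable, List.mem_cons, Prod.mk.injEq, List.mem_map, List.mem_range]
  constructor
  · rintro (⟨rfl, rfl, rfl, rfl⟩ | ⟨o, h, rfl, rfl, rfl, rfl⟩)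
    · simp
    · exact ⟨rfl, rfl, .inr ⟨o, h, rfl, by simp [h]⟩⟩
  · rintro ⟨rfl, rfl, ⟨rfl, rfl⟩ | ⟨o, h, rfl, rfl⟩⟩
    · simp
    · exact .inr ⟨o, h, by simp [h]⟩

theorem structured_transducer (τ : PCPInstance) :
    τ.transducer.Structured fun q => 4 ≤ q ∧ q ≤ 8 where
  leftEnd h := by
    rw [mem_rules_leftEnd] at h
    simp only [leftEndTable, List.mem_cons, Prod.mk.injEq, List.not_mem_nil, or_false] at h
    rcases h with h | h | h | h | h | h <;> obtain ⟨rfl, rfl, rfl, rfl⟩ := h <;> simp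
  letter h := by
    rw [mem_rules_letter] at h
    rcases h with ⟨i, -, -, h⟩ | ⟨j, -, -, h⟩
    · simp only [srcTable, List.mem_append, mem_returnTable, mem_imageTable, List.mem_cons,
        Prod.mk.injEq, List.not_mem_nil, or_false, List.mem_map] at h
      obtain ((((h | h) | h) | h) | h) | h := h
      · rcases h with h | h <;> obtain ⟨rfl, rfl, rfl, rfl⟩ := h <;> simp
      · exact .inr ⟨h.2.2.2, h.1, h.2.2.1, h.2.1⟩
      · rcases h with h | h | h <;> obtain ⟨rfl, rfl, rfl, rfl⟩ := h <;> simp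
      · obtain ⟨rfl, rfl, ⟨rfl, rfl⟩ | ⟨o, ho, rfl, rfl⟩⟩ := h <;> simp; omega
      · obtain ⟨rfl, rfl, ⟨rfl, rfl⟩ | ⟨o, ho, rfl, rfl⟩⟩ := h <;> simp; omega
      · obtain ⟨d, -, rfl, rfl, rfl, rfl⟩ := h
        simp
        omega
    · simp only [tgtTable, List.mem_append, mem_returnTable, List.mem_cons,
        Prod.mk.injEq, List.not_mem_nil, or_false, List.mem_flatMap] at h
      obtain ((h | h) | h) | h := h
      · rcases h with h | h <;> obtain ⟨rfl, rfl, rfl, rfl⟩ := h <;> simp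
      · exact .inr ⟨h.2.2.2, h.1, h.2.2.1, h.2.1⟩
      · rcases h with h | h | h | h | h | h | h | h | h | h | h <;>
          obtain ⟨rfl, rfl, rfl, rfl⟩ := h <;> simp <;> omega
      · obtain ⟨d, -, h | h⟩ := h
        · obtain ⟨rfl, rfl, rfl, rfl⟩ := h
          simp
          omega
        · split_ifs at h
          · simp at h
          · simp only [List.mem_singleton, Prod.mk.injEq] at h
            obtain ⟨rfl, rfl, rfl, rfl⟩ := h
            simp
            omega
  rightEnd h := by
    rw [mem_rules_rightEnd] at h
    simp only [rightEndTable, List.mem_append, List.mem_cons, Prod.mk.injEq, List.not_mem_nil,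
      or_false, false_or, List.mem_map, reduceCtorEq, and_false, exists_false] at h
    rcases h with h | h | h | h | h | h | h | h | h | h <;>
      obtain ⟨rfl, rfl, rfl, -⟩ := h <;> simp

/-! ### Primitive recursiveness of the construction -/

theorem primrec_rule {α : Type*} [Primcodable α] {q : α → ℕ} {v : α → List ℕ} {q' : α → ℕ}
    {d : α → Dir} (hq : Primrec q) (hv : Primrec v) (hq' : Primrec q') (hd : Primrec d) :
    Primrec fun x => (q x, v x, q' x, d x) :=
  hq.pair (hv.pair (hq'.pair hd))

theorem primrec_replicate {α : Type*} [Primcodable α] {n : α → ℕ} (hn : Primrec n) (a : ℕ) :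
    Primrec fun x => List.replicate (n x) a := by
  have : Primrec fun x => (List.range (n x)).map fun _ => a :=
    Primrec.list_map (Primrec.list_range.comp hn) (Primrec₂.const a)
  exact this.of_eq fun x => by simp

theorem primrec_rulesOn {α : Type*} [Primcodable α] {a : α → TapeSym}
    {t : α → List (ℕ × List ℕ × ℕ × Dir)} (ha : Primrec a) (ht : Primrec t) :
    Primrec fun x => rulesOn (a x) (t x) := by
  have h : Primrec₂ fun (x : α) (r : ℕ × List ℕ × ℕ × Dir) => ((r.1, a x, r.2) : Rule) :=
    (Primrec.fst.comp Primrec.snd).pair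
      ((ha.comp Primrec.fst).pair (Primrec.snd.comp Primrec.snd))
  exact Primrec.list_map ht h

theorem primrec_letter : Primrec TapeSym.letter :=
  (Primrec.of_equiv_symm (e := TapeSym.equiv)).comp (Primrec.option_some.comp Primrec.option_some)

theorem primrec_imageTable {α : Type*} [Primcodable α] (s : ℕ) {z : α → List ℕ} (hz : Primrec z) :
    Primrec fun x => imageTable s (z x) := by
  have hl : Primrec fun x => (z x).length := Primrec.list_length.comp hz
  refine Primrec.list_cons.comp (primrec_rule (Primrec.const _) (primrec_replicate hl _)
    (Primrec.const _) (Primrec.const _)) (Primrec.list_map (Primrec.list_range.comp hl) ?_)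
  exact primrec_rule (Primrec.const _) (primrec_replicate Primrec.snd _)
    (Primrec.nat_add.comp (Primrec.const _)
      ((Primrec.list_getD 0).comp (hz.comp Primrec.fst) Primrec.snd)) (Primrec.const _)

theorem primrec_deltaSize : Primrec PCPInstance.deltaSize :=
  Primrec.fst.comp (Primrec.of_equiv (e := PCPInstance.equiv))

theorem primrec_images : Primrec PCPInstance.images :=
  Primrec.snd.comp (Primrec.of_equiv (e := PCPInstance.equiv))

theorem primrec_rightEndTable : Primrec rightEndTable := by
  refine Primrec.list_append.comp (Primrec.const _)
    (Primrec.list_map (Primrec.list_range.comp primrec_deltaSize) ?_)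
  exact primrec_rule (Primrec.nat_add.comp (Primrec.const _) Primrec.snd) (Primrec.const _)
    (Primrec.const _) (Primrec.const _)

theorem primrec_srcTable : Primrec₂ srcTable := by
  have hi : Primrec fun p : PCPInstance × ℕ => p.1.images.getD p.2 ([], []) :=
    (Primrec.list_getD _).comp (primrec_images.comp Primrec.fst) Primrec.snd
  have hs : Primrec fun p : PCPInstance × ℕ => [src p.2] :=
    Primrec.list_cons.comp (Primrec.nat_double_succ.comp Primrec.snd) (Primrec.const _)
  refine Primrec.list_append.comp (Primrec.list_append.comp (Primrec.list_append.comp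
    (Primrec.list_append.comp (Primrec.list_append.comp (Primrec.list_cons.comp
      (primrec_rule (Primrec.const _) hs (Primrec.const _) (Primrec.const _))
      (Primrec.list_cons.comp
        (primrec_rule (Primrec.const _) hs (Primrec.const _) (Primrec.const _))
        (Primrec.const _))) (Primrec.const _)) (Primrec.const _))
    (primrec_imageTable _ (Primrec.fst.comp hi))) (primrec_imageTable _ (Primrec.snd.comp hi)))
    (Primrec.list_map (Primrec.list_range.comp (primrec_deltaSize.comp Primrec.fst)) ?_)
  exact primrec_rule (Primrec.nat_add.comp (Primrec.const _) Primrec.snd) (Primrec.const _)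
    (Primrec.nat_add.comp (Primrec.const _) Primrec.snd) (Primrec.const _)

theorem primrec_tgtTable : Primrec₂ tgtTable := by
  have hD : Primrec fun p : PCPInstance × ℕ => p.1.deltaSize := primrec_deltaSize.comp Primrec.fst
  have hD' : Primrec fun p : PCPInstance × ℕ => 17 + p.1.deltaSize :=
    Primrec.nat_add.comp (Primrec.const _) hD
  have hd : Primrec fun p : (PCPInstance × ℕ) × ℕ => 17 + p.2 :=
    Primrec.nat_add.comp (Primrec.const _) Primrec.snd
  refine Primrec.list_append.comp (Primrec.list_append.comp (Primrec.const _) ?_)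
    (Primrec.list_flatMap (Primrec.list_range.comp (Primrec.succ.comp hD)) ?_)
  · iterate 9 refine Primrec.list_cons.comp (Primrec.const _) ?_
    exact Primrec.list_cons.comp
      (primrec_rule (Primrec.const _) (Primrec.const _) hD' (Primrec.const _))
      (Primrec.list_cons.comp
        (primrec_rule (Primrec.const _) (Primrec.const _) hD' (Primrec.const _))
        (Primrec.const _))
  · refine Primrec.list_cons.comp (primrec_rule hd (Primrec.const _) hd (Primrec.const _))
      (Primrec.ite ?_ (Primrec.const _) (Primrec.list_cons.comp
        (primrec_rule hd (Primrec.const _) (Primrec.const _) (Primrec.const _)) (Primrec.const _)))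
    exact Primrec.eq.comp Primrec.snd (Primrec.snd.comp Primrec.fst)

theorem computable_transducer : Computable transducer := by
  refine Primrec.to_comp ((Primrec.of_equiv_symm (e := TwoWayTransducer.equiv)).comp
    (g := fun τ : PCPInstance => (τ.transducer.rules, [0], [16]))
    (Primrec.pair ?_ (Primrec.const _)))
  refine Primrec.list_append.comp (Primrec.list_append.comp (Primrec.list_append.comp
    (Primrec.const _) (primrec_rulesOn (Primrec.const _) primrec_rightEndTable))
    (Primrec.list_flatMap (Primrec.list_range.comp (Primrec.list_length.comp primrec_images)) ?_))
    (Primrec.list_flatMap (Primrec.list_range.comp primrec_deltaSize) ?_)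
  · exact primrec_rulesOn (primrec_letter.comp (Primrec.nat_double_succ.comp Primrec.snd))
      primrec_srcTable
  · exact primrec_rulesOn (primrec_letter.comp (Primrec.succ.comp
      (Primrec.nat_double_succ.comp Primrec.snd))) primrec_tgtTable

end PCPInstance

/-! ### Right and left rules of the tables, and source words that are skipped -/

namespace PCPInstance

open TwoWayTransducer

variable {τ : PCPInstance} {q q' p : ℕ} {v w u : List ℕ} {d : Dir} {y : List ℕ}

theorem right_mem_srcTable {i : ℕ} : (q, v, q', Dir.right) ∈ τ.srcTable i ↔
    ((q = 1 ∨ q = 2) ∧ v = [src i] ∧ q' = 2) ∨ ((q = 9 ∨ q = 11 ∨ q = 12) ∧ v = [] ∧ q' = q) ∨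
      (q, v, q', Dir.right) ∈ imageTable 13 (τ.images.getD i ([], [])).1 ∨
      (q, v, q', Dir.right) ∈ imageTable 14 (τ.images.getD i ([], [])).2 ∨
      ∃ d < τ.deltaSize, q = 17 + d ∧ v = [] ∧ q' = q := by
  simp only [srcTable, List.mem_append, mem_returnTable, List.mem_cons, Prod.mk.injEq,
    List.not_mem_nil, or_false, List.mem_map, List.mem_range]
  constructor
  · rintro (((((h | h) | h) | h) | h) | ⟨d, h, rfl, rfl, rfl, -⟩)
    · rcases h with h | h <;> obtain ⟨rfl, rfl, rfl, -⟩ := h <;> simp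
    · simp at h
    · rcases h with h | h | h <;> obtain ⟨rfl, rfl, rfl, -⟩ := h <;> simp
    · exact .inr (.inr (.inl h))
    · exact .inr (.inr (.inr (.inl h)))
    · exact .inr (.inr (.inr (.inr ⟨d, h, rfl, rfl, rfl⟩)))
  · rintro (⟨rfl | rfl, rfl, rfl⟩ | ⟨rfl | rfl | rfl, rfl, rfl⟩ | h | h | ⟨d, h, rfl, rfl, rfl⟩)
    iterate 5 simp
    · exact .inl (.inl (.inr h))
    · exact .inl (.inr h)
    · exact .inr ⟨d, h, rfl, rfl, rfl, trivial⟩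

theorem right_mem_tgtTable {j : ℕ} : (q, v, q', Dir.right) ∈ τ.tgtTable j ↔
    ((q = 2 ∨ q = 3) ∧ v = [] ∧ q' = 3) ∨ (q = 9 ∧ v = [sharp] ∧ q' = 9) ∨
      ((q = 9 ∨ q = 10) ∧ v = [] ∧ q' = 10) ∨ (q = 10 ∧ v = [sharp] ∧ q' = 10) ∨
      (q = 11 ∧ v = [sharp] ∧ q' = 11) ∨ (q = 12 ∧ v = [] ∧ q' = 12) ∨
      ((q = 13 ∨ q = 14 ∨ q = 15) ∧ v = [sharp] ∧ q' = 15) ∨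
      ((q = 13 ∨ q = 14) ∧ v = [] ∧ q' = 17 + τ.deltaSize) ∨
      ∃ d ≤ τ.deltaSize, q = 17 + d ∧
        ((v = [] ∧ q' = q) ∨ (d ≠ j ∧ v = [sharp] ∧ q' = 15)) := by
  simp only [tgtTable, List.mem_append, mem_returnTable, List.mem_cons, Prod.mk.injEq,
    List.not_mem_nil, or_false, List.mem_flatMap, List.mem_range, Nat.lt_succ_iff]
  constructor
  · rintro (((h | h) | h) | ⟨d, h, h' | h'⟩)
    · rcases h with h | h <;> obtain ⟨rfl, rfl, rfl, -⟩ := h <;> simp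
    · simp at h
    · rcases h with h | h | h | h | h | h | h | h | h | h | h <;>
        obtain ⟨rfl, rfl, rfl, -⟩ := h <;> simp
    · obtain ⟨rfl, rfl, rfl, -⟩ := h'
      iterate 8 right
      exact ⟨d, h, rfl, .inl ⟨rfl, rfl⟩⟩
    · split_ifs at h' with hd
      · simp at h'
      · simp only [List.mem_singleton, Prod.mk.injEq] at h'
        obtain ⟨rfl, rfl, rfl, -⟩ := h'
        iterate 8 right
        exact ⟨d, h, rfl, .inr ⟨hd, rfl, rfl⟩⟩
  · rintro (⟨rfl | rfl, rfl, rfl⟩ | ⟨rfl, rfl, rfl⟩ | ⟨rfl | rfl, rfl, rfl⟩ | ⟨rfl, rfl, rfl⟩ |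
      ⟨rfl, rfl, rfl⟩ | ⟨rfl, rfl, rfl⟩ | ⟨rfl | rfl | rfl, rfl, rfl⟩ | ⟨rfl | rfl, rfl, rfl⟩ |
      ⟨d, h, rfl, ⟨rfl, rfl⟩ | ⟨hd, rfl, rfl⟩⟩)
    iterate 13 simp
    · exact .inr ⟨d, h, .inl ⟨rfl, rfl, rfl, trivial⟩⟩
    · exact .inr ⟨d, h, .inr (by simp [hd])⟩

theorem right_mem_rightEndTable : (q, v, q', Dir.right) ∈ τ.rightEndTable ↔
    v = [] ∧ q' = 16 ∧ (q = 10 ∨ q = 12 ∨ q = 15 ∨ ∃ d < τ.deltaSize, q = 17 + d) := by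
  simp only [rightEndTable, List.mem_append, List.mem_cons, Prod.mk.injEq, List.not_mem_nil,
    or_false, false_or, List.mem_map, reduceCtorEq, and_false, and_true, List.mem_range]
  constructor
  · rintro ((⟨rfl, rfl, rfl⟩ | ⟨rfl, rfl, rfl⟩ | ⟨rfl, rfl, rfl⟩) | ⟨d, h, rfl, rfl, rfl⟩) <;> simp
    exact .inr (.inr (.inr h))
  · rintro ⟨rfl, rfl, rfl | rfl | rfl | ⟨d, h, rfl⟩⟩
    iterate 3 simp
    exact .inr ⟨d, h, rfl, rfl, rfl⟩

theorem left_mem_rightEndTable : (q, v, q', Dir.left) ∈ τ.rightEndTable ↔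
    ((q = 2 ∨ q = 3) ∧ v = [] ∧ (q' = 4 ∨ q' = 5 ∨ q' = 7 ∨ q' = 8)) ∨
      ((q = 11 ∨ q = 12) ∧ v = [sharp] ∧ q' = 6) := by
  simp only [rightEndTable, List.mem_append, List.mem_cons, Prod.mk.injEq, List.not_mem_nil,
    or_false, false_or, List.mem_map, reduceCtorEq, and_false, and_true, exists_false]
  constructor
  · rintro (h | h | h | h | h | h | h | h | h | h) <;> obtain ⟨rfl, rfl, rfl⟩ := h <;> simp
  · rintro (⟨rfl | rfl, rfl, rfl | rfl | rfl | rfl⟩ | ⟨rfl | rfl, rfl, rfl⟩) <;> simp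

/-- The tape word of a source word. -/
abbrev srcTape (w : List ℕ) : List TapeSym := w.map fun i => .letter (src i)

/-- The tape word of a target word. -/
abbrev tgtTape (u : List ℕ) : List TapeSym := u.map fun j => .letter (tgt j)

theorem openTape_encode (w u : List ℕ) :
    openTape (w.map src ++ u.map tgt) = .leftEnd :: (srcTape w ++ tgtTape u) := by
  simp [Function.comp_def]

theorem sourceWord_cons {i : ℕ} :
    τ.SourceWord (i :: w) ↔ i < τ.images.length ∧ τ.SourceWord w := by
  simp [SourceWord]

theorem targetWord_cons {j : ℕ} :
    τ.TargetWord (j :: u) ↔ j < τ.deltaSize ∧ τ.TargetWord u := by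
  simp [TargetWord]

theorem sweeps_src_iff {i : ℕ} {x : List TapeSym} : τ.transducer.Sweeps y q
    (.letter (src i) :: x) v p ↔ ∃ v₁ v₂ q', v = v₁ ++ v₂ ∧ (i < τ.images.length ∧
      (q, v₁, q', Dir.right) ∈ τ.srcTable i) ∧ τ.transducer.Sweeps y q' x v₂ p := by
  simp only [sweeps_cons_iff, mem_rules_src]

theorem sweeps_tgt_iff {j : ℕ} {x : List TapeSym} : τ.transducer.Sweeps y q
    (.letter (tgt j) :: x) v p ↔ ∃ v₁ v₂ q', v = v₁ ++ v₂ ∧ (j < τ.deltaSize ∧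
      (q, v₁, q', Dir.right) ∈ τ.tgtTable j) ∧ τ.transducer.Sweeps y q' x v₂ p := by
  simp only [sweeps_cons_iff, mem_rules_tgt]

theorem sweeps_silent_src (hq : q = 9 ∨ q = 11 ∨ q = 12 ∨ ∃ d < τ.deltaSize, q = 17 + d)
    (hw : τ.SourceWord w) {x : List TapeSym} : τ.transducer.Sweeps y q (srcTape w ++ x) v p ↔
      τ.transducer.Sweeps y q x v p := by
  induction w generalizing v with
  | nil => simp
  | cons i w ih =>
    rw [sourceWord_cons] at hw
    have key : ∀ v₁ q', (q, v₁, q', Dir.right) ∈ τ.srcTable i ↔ v₁ = [] ∧ q' = q := by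
      intro v₁ q'
      rw [right_mem_srcTable, mem_imageTable, mem_imageTable]
      have hq' : q ≠ 1 ∧ q ≠ 2 ∧ q ≠ 13 ∧ q ≠ 14 := by
        rcases hq with h | h | h | ⟨d, -, h⟩ <;> omega
      constructor
      · rintro (h | h | h | h | ⟨d, -, -, h⟩)
        · omega
        · exact h.2
        · omega
        · omega
        · exact h
      · rintro ⟨rfl, rfl⟩
        rcases hq with h | h | h | ⟨d, h, h'⟩
        iterate 3 exact .inr (.inl ⟨by omega, rfl, rfl⟩)
        exact .inr (.inr (.inr (.inr ⟨d, h, h', rfl, rfl⟩)))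
    simp only [List.map_cons, List.cons_append, sweeps_src_iff, key]
    constructor
    · rintro ⟨_, v₂, _, rfl, ⟨-, rfl, rfl⟩, h⟩
      exact (ih hw.2).1 h
    · intro h
      exact ⟨[], v, q, rfl, ⟨hw.1, rfl, rfl⟩, (ih hw.2).2 h⟩

end PCPInstance

namespace PCPInstance

open TwoWayTransducer

variable {τ : PCPInstance} {q q' p : ℕ} {v w u : List ℕ} {d : Dir} {y : List ℕ}

/-! #### The first sweep -/

theorem sweeps_three_tgt (hu : τ.TargetWord u) :
    τ.transducer.Sweeps y 3 (tgtTape u) v p ↔ τ.transducer.Sweeps y 3 [] v p := by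
  induction u generalizing v with
  | nil => rfl
  | cons j u ih =>
    rw [targetWord_cons] at hu
    have key : ∀ v₁ q', (3, v₁, q', Dir.right) ∈ τ.tgtTable j ↔ v₁ = [] ∧ q' = 3 := by
      intro v₁ q'
      rw [right_mem_tgtTable]
      simp
      omega
    simp only [List.map_cons, sweeps_tgt_iff, key]
    constructor
    · rintro ⟨_, v₂, _, rfl, ⟨-, rfl, rfl⟩, h⟩
      exact (ih hu.2).1 h
    · intro h
      exact ⟨[], v, 3, rfl, ⟨hu.1, rfl, rfl⟩, (ih hu.2).2 h⟩

theorem sweeps_two_three : τ.transducer.Sweeps y 2 [] v p ↔ τ.transducer.Sweeps y 3 [] v p := by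
  rw [sweeps_nil_iff, sweeps_nil_iff]
  simp only [mem_rules_rightEnd, right_mem_rightEndTable, left_mem_rightEndTable]
  have h : ∀ d, ¬ 2 = 17 + d ∧ ¬ 3 = 17 + d := by omega
  simp [h]

theorem sweeps_three_nil : τ.transducer.Sweeps y 3 [] v p ↔
    ∃ l, (l = 4 ∨ l = 5 ∨ l = 7 ∨ l = 8) ∧
      (∀ a ∈ y, (l, .letter a, [], l, Dir.left) ∈ τ.transducer.rules) ∧
        τ.transducer.Sweeps y l (openTape y) v p := by
  rw [sweeps_nil_iff]
  simp only [mem_rules_rightEnd, right_mem_rightEndTable, left_mem_rightEndTable]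
  have h : ∀ d, ¬ 3 = 17 + d := by omega
  simp only [h]
  constructor
  · rintro (h | ⟨v₁, v₂, l, rfl, h, h₁, h₂⟩)
    · simp at h
    · rcases h with ⟨-, rfl, h⟩ | ⟨h, -⟩
      · exact ⟨l, h, h₁, h₂⟩
      · omega
  · rintro ⟨l, h, h₁, h₂⟩
    exact .inr ⟨[], v, l, rfl, by simpa using h, h₁, h₂⟩

theorem exists_of_sweeps_three {z : List ℕ}
    (h : τ.transducer.Sweeps y 3 (z.map .letter) v p) : ∃ u, τ.TargetWord u ∧ z = u.map tgt := by
  induction z generalizing v with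
  | nil => exact ⟨[], by simp [TargetWord], rfl⟩
  | cons a z ih =>
    rw [List.map_cons, sweeps_cons_iff] at h
    obtain ⟨v₁, v₂, q', rfl, h, h'⟩ := h
    rw [mem_rules_letter] at h
    rcases h with ⟨i, hi, rfl, h⟩ | ⟨j, hj, rfl, h⟩
    · simp [right_mem_srcTable, mem_imageTable] at h
      omega
    · simp only [right_mem_tgtTable] at h
      obtain rfl : q' = 3 := by
        rcases h with h | h | h | h | h | h | h | h | ⟨d, hd⟩ <;> omega
      obtain ⟨u, hu, rfl⟩ := ih h'
      exact ⟨j :: u, targetWord_cons.2 ⟨hj, hu⟩, rfl⟩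

theorem exists_of_sweeps_two {z : List ℕ} (h : τ.transducer.Sweeps y 2 (z.map .letter) v p) :
    ∃ w u v', τ.SourceWord w ∧ τ.TargetWord u ∧ z = w.map src ++ u.map tgt ∧
      v = w.map src ++ v' ∧ τ.transducer.Sweeps y 3 [] v' p := by
  induction z generalizing v with
  | nil =>
    exact ⟨[], [], v, by simp [SourceWord], by simp [TargetWord], rfl, rfl, sweeps_two_three.1 h⟩
  | cons a z ih =>
    rw [List.map_cons, sweeps_cons_iff] at h
    obtain ⟨v₁, v₂, q', rfl, h, h'⟩ := h
    rw [mem_rules_letter] at h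
    rcases h with ⟨i, hi, rfl, h⟩ | ⟨j, hj, rfl, h⟩
    · simp only [right_mem_srcTable, mem_imageTable] at h
      obtain ⟨rfl, rfl⟩ : v₁ = [src i] ∧ q' = 2 := by
        rcases h with h | h | h | h | ⟨d, -, h, -⟩ <;> first | exact h.2 | omega
      obtain ⟨w, u, v', hw, hu, rfl, rfl, h⟩ := ih h'
      exact ⟨i :: w, u, v', sourceWord_cons.2 ⟨hi, hw⟩, hu, rfl, rfl, h⟩
    · simp only [right_mem_tgtTable] at h
      obtain ⟨rfl, rfl⟩ : v₁ = [] ∧ q' = 3 := by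
        rcases h with h | h | h | h | h | h | h | h | ⟨d, -, h, -⟩ <;> first | exact h.2 | omega
      obtain ⟨u, hu, rfl⟩ := exists_of_sweeps_three h'
      have hu' := targetWord_cons.2 ⟨hj, hu⟩
      refine ⟨[], j :: u, v₂, by simp [SourceWord], hu', rfl, rfl, ?_⟩
      exact (sweeps_three_tgt hu).1 (by simpa [Function.comp_def] using h')

/-- State `1` has rules for source letters only, and none on the right delimiter; this is what
excludes an empty source word. -/
theorem exists_of_sweeps_one {z : List ℕ} (h : τ.transducer.Sweeps y 1 (z.map .letter) v p) :
    ∃ w u v', w ≠ [] ∧ τ.SourceWord w ∧ τ.TargetWord u ∧ z = w.map src ++ u.map tgt ∧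
      v = w.map src ++ v' ∧ τ.transducer.Sweeps y 3 [] v' p := by
  cases z with
  | nil =>
    rw [List.map_nil, sweeps_nil_iff] at h
    simp only [mem_rules_rightEnd, right_mem_rightEndTable, left_mem_rightEndTable] at h
    rcases h with ⟨-, -, h | h | h | ⟨d, -, h⟩⟩ | ⟨v₁, v₂, l, -, h | h, -⟩ <;> omega
  | cons a z =>
    rw [List.map_cons, sweeps_cons_iff] at h
    obtain ⟨v₁, v₂, q', rfl, h, h'⟩ := h
    rw [mem_rules_letter] at h
    rcases h with ⟨i, hi, rfl, h⟩ | ⟨j, hj, rfl, h⟩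
    · simp only [right_mem_srcTable, mem_imageTable] at h
      obtain ⟨rfl, rfl⟩ : v₁ = [src i] ∧ q' = 2 := by
        rcases h with h | h | h | h | ⟨d, -, h, -⟩ <;> first | exact h.2 | omega
      obtain ⟨w, u, v', hw, hu, rfl, rfl, h⟩ := exists_of_sweeps_two h'
      exact ⟨i :: w, u, v', by simp, sourceWord_cons.2 ⟨hi, hw⟩, hu, rfl, rfl, h⟩
    · simp only [right_mem_tgtTable] at h
      rcases h with h | h | h | h | h | h | h | h | ⟨d, -, h, -⟩ <;> omega

theorem sweeps_two_of (hw : τ.SourceWord w) (hu : τ.TargetWord u)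
    (h : τ.transducer.Sweeps y 3 [] v p) :
    τ.transducer.Sweeps y 2 (srcTape w ++ tgtTape u) (w.map src ++ v) p := by
  induction w with
  | nil =>
    cases u with
    | nil => exact sweeps_two_three.2 h
    | cons j u =>
      rw [targetWord_cons] at hu
      exact sweeps_tgt_iff.2 ⟨[], v, 3, rfl, ⟨hu.1, by simp [right_mem_tgtTable]⟩,
        (sweeps_three_tgt hu.2).2 h⟩
  | cons i w ih =>
    rw [sourceWord_cons] at hw
    exact sweeps_src_iff.2 ⟨[src i], _, 2, rfl, ⟨hw.1, by simp [right_mem_srcTable]⟩, ih hw.2⟩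

theorem sweeps_one_of (hw₀ : w ≠ []) (hw : τ.SourceWord w) (hu : τ.TargetWord u)
    (h : τ.transducer.Sweeps y 3 [] v p) :
    τ.transducer.Sweeps y 1 (srcTape w ++ tgtTape u) (w.map src ++ v) p := by
  cases w with
  | nil => exact absurd rfl hw₀
  | cons i w =>
    rw [sourceWord_cons] at hw
    exact sweeps_src_iff.2 ⟨[src i], _, 2, rfl, ⟨hw.1, by simp [right_mem_srcTable]⟩,
      sweeps_two_of hw.2 hu h⟩

theorem return_mem_rules (hw : τ.SourceWord w) (hu : τ.TargetWord u) {l : ℕ} (hl : 4 ≤ l ∧ l ≤ 8) :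
    ∀ a ∈ w.map src ++ u.map tgt, (l, .letter a, [], l, Dir.left) ∈ τ.transducer.rules := by
  intro a ha
  have hr : (l, [], l, Dir.left) ∈ returnTable := mem_returnTable.2 ⟨hl, rfl, rfl, rfl⟩
  rcases List.mem_append.1 ha with ha | ha
  · obtain ⟨i, hi, rfl⟩ := List.mem_map.1 ha
    exact mem_rules_src.2 ⟨hw i hi, by simp [srcTable, hr]⟩
  · obtain ⟨j, hj, rfl⟩ := List.mem_map.1 ha
    exact mem_rules_tgt.2 ⟨hu j hj, by simp [tgtTable, hr]⟩

/-- The first sweep checks the input and copies the source word. -/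
theorem mem_rel_transducer_iff {o : List ℕ} : (y, o) ∈ τ.transducer.rel ↔
    ∃ w u v, w ≠ [] ∧ τ.SourceWord w ∧ τ.TargetWord u ∧ y = w.map src ++ u.map tgt ∧
      o = w.map src ++ v ∧ ∃ l, (l = 4 ∨ l = 5 ∨ l = 7 ∨ l = 8) ∧
        τ.transducer.Sweeps y l (openTape y) v 16 := by
  rw [(structured_transducer τ).mem_rel_iff]
  simp only [transducer, List.mem_singleton, exists_eq_left]
  change τ.transducer.Sweeps _ _ _ _ _ ↔ ∃ w u v, _ ∧ _ ∧ _ ∧ _ ∧ _ ∧ ∃ l, _ ∧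
    τ.transducer.Sweeps _ _ _ _ _
  have hstart : ∀ {z o}, τ.transducer.Sweeps y 0 (.leftEnd :: z) o 16 ↔
      τ.transducer.Sweeps y 1 z o 16 := by
    intro z o
    rw [sweeps_cons_iff]
    simp [mem_rules_leftEnd, leftEndTable]
  rw [hstart]
  constructor
  · intro h
    obtain ⟨w, u, v, hw₀, hw, hu, hy, ho, h⟩ := exists_of_sweeps_one h
    obtain ⟨l, hl, -, h⟩ := sweeps_three_nil.1 h
    exact ⟨w, u, v, hw₀, hw, hu, hy, ho, l, hl, h⟩
  · rintro ⟨w, u, v, hw₀, hw, hu, hy, rfl, l, hl, h⟩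
    have h' := sweeps_three_nil.2 ⟨l, hl, hy ▸ return_mem_rules hw hu (by omega), h⟩
    have := sweeps_one_of hw₀ hw hu h'
    rw [hy] at this ⊢
    simpa [Function.comp_def] using this

end PCPInstance

namespace PCPInstance

open TwoWayTransducer

variable {τ : PCPInstance} {q q' p : ℕ} {v w u : List ℕ} {d : Dir} {y : List ℕ}

/-! #### The following sweeps -/

theorem sweeps_nil_of_lt (hq : q ≠ 2 ∧ q ≠ 3 ∧ q ≠ 11 ∧ q ≠ 12) :
    τ.transducer.Sweeps y q [] v p ↔
      v = [] ∧ p = 16 ∧ (q = 10 ∨ q = 15 ∨ ∃ d < τ.deltaSize, q = 17 + d) := by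
  rw [sweeps_nil_iff]
  simp only [mem_rules_rightEnd, right_mem_rightEndTable, left_mem_rightEndTable]
  constructor
  · rintro (⟨rfl, rfl, h⟩ | ⟨v₁, v₂, l, -, h | h, -⟩)
    · rcases h with h | h | h | h
      · exact ⟨rfl, rfl, .inl h⟩
      · omega
      · exact ⟨rfl, rfl, .inr (.inl h)⟩
      · exact ⟨rfl, rfl, .inr (.inr h)⟩
    · omega
    · omega
  · rintro ⟨rfl, rfl, h | h | h⟩
    · exact .inl ⟨rfl, rfl, .inl h⟩
    · exact .inl ⟨rfl, rfl, .inr (.inr (.inl h))⟩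
    · exact .inl ⟨rfl, rfl, .inr (.inr (.inr h))⟩

theorem sweeps_ten_iff (hu : τ.TargetWord u) : τ.transducer.Sweeps y 10 (tgtTape u) v 16 ↔
    ∃ m ≤ u.length, v = List.replicate m sharp := by
  induction u generalizing v with
  | nil => simp [sweeps_nil_of_lt]
  | cons j u ih =>
    rw [targetWord_cons] at hu
    have key : ∀ v₁ q', (10, v₁, q', Dir.right) ∈ τ.tgtTable j ↔
        (v₁ = [] ∨ v₁ = [sharp]) ∧ q' = 10 := by
      intro v₁ q'
      rw [right_mem_tgtTable]
      constructor
      · rintro (h | h | h | h | h | h | h | h | ⟨d, -, h, -⟩) <;> first | omega | simp [h.2]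
      · rintro ⟨rfl | rfl, rfl⟩ <;> simp
    simp only [List.map_cons, sweeps_tgt_iff, key, List.length_cons]
    constructor
    · rintro ⟨_, v₂, _, rfl, ⟨-, h, rfl⟩, h'⟩
      obtain ⟨m, hm, rfl⟩ := (ih hu.2).1 h'
      rcases h with rfl | rfl
      · exact ⟨m, by omega, rfl⟩
      · exact ⟨m + 1, by omega, rfl⟩
    · rintro ⟨m, hm, rfl⟩
      rcases m with - | m
      · exact ⟨[], [], 10, rfl, ⟨hu.1, .inl rfl, rfl⟩, (ih hu.2).2 ⟨0, by omega, rfl⟩⟩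
      · exact ⟨[sharp], _, 10, rfl, ⟨hu.1, .inr rfl, rfl⟩, (ih hu.2).2 ⟨m, by omega, rfl⟩⟩

/-- The silent letter that leads from `9` to `10` makes the inequality strict, since the tape cannot
be left in state `9`. -/
theorem sweeps_nine_iff (hu : τ.TargetWord u) : τ.transducer.Sweeps y 9 (tgtTape u) v 16 ↔
    ∃ m < u.length, v = List.replicate m sharp := by
  induction u generalizing v with
  | nil => simp [sweeps_nil_of_lt]; omega
  | cons j u ih =>
    rw [targetWord_cons] at hu
    have key : ∀ v₁ q', (9, v₁, q', Dir.right) ∈ τ.tgtTable j ↔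
        (v₁ = [sharp] ∧ q' = 9) ∨ (v₁ = [] ∧ q' = 10) := by
      intro v₁ q'
      rw [right_mem_tgtTable]
      constructor
      · rintro (h | h | h | h | h | h | h | h | ⟨d, -, h, -⟩) <;> first | omega | simp [h.2]
      · rintro (⟨rfl, rfl⟩ | ⟨rfl, rfl⟩) <;> simp
    simp only [List.map_cons, sweeps_tgt_iff, key, List.length_cons]
    constructor
    · rintro ⟨_, v₂, _, rfl, ⟨-, ⟨rfl, rfl⟩ | ⟨rfl, rfl⟩⟩, h'⟩
      · obtain ⟨m, hm, rfl⟩ := (ih hu.2).1 h'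
        exact ⟨m + 1, by omega, rfl⟩
      · obtain ⟨m, hm, rfl⟩ := (sweeps_ten_iff hu.2).1 h'
        exact ⟨m, by omega, rfl⟩
    · rintro ⟨m, hm, rfl⟩
      rcases m with - | m
      · exact ⟨[], [], 10, rfl, ⟨hu.1, .inr ⟨rfl, rfl⟩⟩,
          (sweeps_ten_iff hu.2).2 ⟨0, by omega, rfl⟩⟩
      · exact ⟨[sharp], _, 9, rfl, ⟨hu.1, .inl ⟨rfl, rfl⟩⟩, (ih hu.2).2 ⟨m, by omega, rfl⟩⟩

theorem sweeps_fifteen_iff (hu : τ.TargetWord u) :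
    τ.transducer.Sweeps y 15 (tgtTape u) v 16 ↔ v = List.replicate u.length sharp := by
  induction u generalizing v with
  | nil => simp [sweeps_nil_of_lt]
  | cons j u ih =>
    rw [targetWord_cons] at hu
    have key : ∀ v₁ q', (15, v₁, q', Dir.right) ∈ τ.tgtTable j ↔ v₁ = [sharp] ∧ q' = 15 := by
      intro v₁ q'
      rw [right_mem_tgtTable]
      constructor
      · rintro (h | h | h | h | h | h | h | h | ⟨d, -, h, -⟩) <;> first | omega | simp [h.2]
      · rintro ⟨rfl, rfl⟩
        simp
    simp only [List.map_cons, sweeps_tgt_iff, key, List.length_cons]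
    constructor
    · rintro ⟨_, v₂, _, rfl, ⟨-, rfl, rfl⟩, h'⟩
      rw [(ih hu.2).1 h']
      rfl
    · rintro rfl
      exact ⟨[sharp], _, 15, rfl, ⟨hu.1, rfl, rfl⟩, (ih hu.2).2 rfl⟩

theorem sweeps_eleven_iff (hu : τ.TargetWord u) : τ.transducer.Sweeps y 11 (tgtTape u) v p ↔
    ∃ v', v = List.replicate u.length sharp ++ v' ∧ τ.transducer.Sweeps y 11 [] v' p := by
  induction u generalizing v with
  | nil => simp
  | cons j u ih =>
    rw [targetWord_cons] at hu
    have key : ∀ v₁ q', (11, v₁, q', Dir.right) ∈ τ.tgtTable j ↔ v₁ = [sharp] ∧ q' = 11 := by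
      intro v₁ q'
      rw [right_mem_tgtTable]
      constructor
      · rintro (h | h | h | h | h | h | h | h | ⟨d, -, h, -⟩) <;> first | omega | simp [h.2]
      · rintro ⟨rfl, rfl⟩
        simp
    simp only [List.map_cons, sweeps_tgt_iff, key, List.length_cons]
    constructor
    · rintro ⟨_, v₂, _, rfl, ⟨-, rfl, rfl⟩, h'⟩
      obtain ⟨v', rfl, h⟩ := (ih hu.2).1 h'
      exact ⟨v', rfl, h⟩
    · rintro ⟨v', rfl, h⟩
      exact ⟨[sharp], _, 11, rfl, ⟨hu.1, rfl, rfl⟩, (ih hu.2).2 ⟨v', rfl, h⟩⟩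

theorem sweeps_twelve_iff (hu : τ.TargetWord u) : τ.transducer.Sweeps y 12 (tgtTape u) v p ↔
    τ.transducer.Sweeps y 12 [] v p := by
  induction u generalizing v with
  | nil => simp
  | cons j u ih =>
    rw [targetWord_cons] at hu
    have key : ∀ v₁ q', (12, v₁, q', Dir.right) ∈ τ.tgtTable j ↔ v₁ = [] ∧ q' = 12 := by
      intro v₁ q'
      rw [right_mem_tgtTable]
      constructor
      · rintro (h | h | h | h | h | h | h | h | ⟨d, -, h, -⟩) <;> first | omega | simp [h.2]
      · rintro ⟨rfl, rfl⟩
        simp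
    simp only [List.map_cons, sweeps_tgt_iff, key]
    constructor
    · rintro ⟨_, v₂, _, rfl, ⟨-, rfl, rfl⟩, h'⟩
      exact (ih hu.2).1 h'
    · intro h
      exact ⟨[], v, 12, rfl, ⟨hu.1, rfl, rfl⟩, (ih hu.2).2 h⟩

/-- The number of further sweeps is arbitrary, and each of them outputs one symbol. -/
theorem sweeps_six_iff (hw : τ.SourceWord w) (hu : τ.TargetWord u)
    (hy : y = w.map src ++ u.map tgt) : τ.transducer.Sweeps y 6 (openTape y) v 16 ↔
      ∃ m, v = List.replicate m sharp := by
  have h6 : ∀ v, τ.transducer.Sweeps y 6 (openTape y) v 16 ↔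
      τ.transducer.Sweeps y 12 [] v 16 := by
    intro v
    rw [hy, openTape_encode, sweeps_cons_iff]
    simp only [mem_rules_leftEnd]
    rw [← sweeps_twelve_iff hu, ← sweeps_silent_src (.inr (.inr (.inl rfl))) hw]
    simp [leftEndTable]
  have h12 : ∀ v, τ.transducer.Sweeps y 12 [] v 16 ↔
      v = [] ∨ ∃ v', v = sharp :: v' ∧ τ.transducer.Sweeps y 6 (openTape y) v' 16 := by
    intro v
    rw [sweeps_nil_iff]
    simp only [mem_rules_rightEnd, right_mem_rightEndTable, left_mem_rightEndTable]
    constructor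
    · rintro (⟨rfl, -⟩ | ⟨v₁, v₂, l, rfl, ⟨h, -⟩ | ⟨-, rfl, rfl⟩, -, h⟩)
      · exact .inl rfl
      · omega
      · exact .inr ⟨_, rfl, h⟩
    · rintro (rfl | ⟨v', rfl, h⟩)
      · simp
      · exact .inr ⟨[sharp], v', 6, rfl, by simp, hy ▸ return_mem_rules hw hu (by omega), h⟩
  constructor
  · intro h
    -- Each round returns to the state `6` with the output shortened by one symbol.
    induction hn : v.length generalizing v with
    | zero => exact ⟨0, List.length_eq_zero_iff.1 hn⟩
    | succ n ih =>
      rcases (h12 v).1 ((h6 v).1 h) with rfl | ⟨v', rfl, h'⟩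
      · simp at hn
      · obtain ⟨m, rfl⟩ := ih h' (by simpa using hn)
        exact ⟨m + 1, rfl⟩
  · rintro ⟨m, rfl⟩
    induction m with
    | zero => exact (h6 _).2 ((h12 _).2 (.inl rfl))
    | succ m ih => exact (h6 _).2 ((h12 _).2 (.inr ⟨_, rfl, ih⟩))

/-- In the state `17 + d`, a letter different from `d` is to be found in the target word, where the
number of letters stands for the end of the word. -/
theorem sweeps_stored_iff (hu : τ.TargetWord u) {o : Option ℕ} (ho : ∀ d ∈ o, d < τ.deltaSize) :
    τ.transducer.Sweeps y (17 + o.getD τ.deltaSize) (tgtTape u) v 16 ↔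
      ∃ i ≤ u.length, u[i]? ≠ o ∧ v = List.replicate (u.length - i) sharp := by
  induction u generalizing v with
  | nil =>
    simp only [List.map_nil]
    rw [sweeps_nil_of_lt (by omega)]
    cases o with
    | none => simp; omega
    | some d =>
      have := ho d rfl
      simp [this]
  | cons j u ih =>
    rw [targetWord_cons] at hu
    have hne : ∀ d, o.getD τ.deltaSize = d → d ≤ τ.deltaSize ∧ (d ≠ j ↔ some j ≠ o) := by
      rintro d rfl
      cases o with
      | none => simp; omega
      | some d =>
        have := ho d rfl
        simp
        omega
    have key : ∀ v₁ q', (17 + o.getD τ.deltaSize, v₁, q', Dir.right) ∈ τ.tgtTable j ↔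
        (v₁ = [] ∧ q' = 17 + o.getD τ.deltaSize) ∨ (some j ≠ o ∧ v₁ = [sharp] ∧ q' = 15) := by
      intro v₁ q'
      rw [right_mem_tgtTable]
      constructor
      · rintro (h | h | h | h | h | h | h | h | ⟨d, -, h, h'⟩)
        iterate 8 omega
        have hd : o.getD τ.deltaSize = d := by omega
        rw [(hne d hd).2] at h'
        exact h'
      · intro h
        iterate 8 right
        exact ⟨_, (hne _ rfl).1, rfl, by rwa [(hne _ rfl).2]⟩
    simp only [List.map_cons, sweeps_tgt_iff, key, List.length_cons]
    constructor
    · rintro ⟨_, v₂, _, rfl, ⟨-, ⟨rfl, rfl⟩ | ⟨hj, rfl, rfl⟩⟩, h'⟩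
      · obtain ⟨i, hi, hne, rfl⟩ := (ih hu.2).1 h'
        exact ⟨i + 1, by omega, by simpa using hne, by simp⟩
      · rw [(sweeps_fifteen_iff hu.2).1 h']
        exact ⟨0, by omega, by simpa using hj, rfl⟩
    · rintro ⟨i, hi, hne, rfl⟩
      rcases i with - | i
      · exact ⟨[sharp], _, 15, rfl, ⟨hu.1, .inr ⟨by simpa using hne, rfl, rfl⟩⟩,
          (sweeps_fifteen_iff hu.2).2 rfl⟩
      · exact ⟨[], _, _, rfl, ⟨hu.1, .inl ⟨rfl, rfl⟩⟩, (ih hu.2).2 ⟨i, by omega, by simpa using hne,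
          by simp⟩⟩

/-- The transducer reads the image of the source word up to a position. -/
theorem sweeps_image_iff (hu : τ.TargetWord u) (hw : τ.SourceWord w) {s : ℕ}
    (hs : s = 13 ∨ s = 14) {z : ℕ → List ℕ}
    (hz : ∀ i < τ.images.length, τ.TargetWord (z i) ∧ ∀ v q', (s, v, q', Dir.right) ∈ τ.srcTable i ↔
      (s, v, q', Dir.right) ∈ imageTable s (z i)) :
    τ.transducer.Sweeps y s (srcTape w ++ tgtTape u) v 16 ↔ ∃ i ≤ (w.flatMap z).length,
      ∃ k ≤ u.length, u[k]? ≠ (w.flatMap z)[i]? ∧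
        v = List.replicate (i + (u.length - k)) sharp := by
  induction w generalizing v with
  | nil =>
    -- Once the whole image has been read, `s` acts on the target word like the state `17 +
    -- deltaSize`, which stands for the end of the image: neither accepts at the right delimiter,
    -- and both treat the first target letter alike.
    have := sweeps_stored_iff (v := v) (y := y) hu (o := none) (by simp)
    simp only [List.map_nil, List.nil_append, List.flatMap_nil, List.length_nil,
      Nat.le_zero, exists_eq_left, zero_add, List.getElem?_nil]
    rw [← this]
    clear this
    cases u with
    | nil =>
      simp only [List.map_nil]
      rw [sweeps_nil_of_lt (by omega), sweeps_nil_of_lt (by omega)]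
      simp
      omega
    | cons j u =>
      simp only [List.map_cons, sweeps_tgt_iff]
      have key : ∀ v₁ q', (s, v₁, q', Dir.right) ∈ τ.tgtTable j ↔
          (17 + (none : Option ℕ).getD τ.deltaSize, v₁, q', Dir.right) ∈ τ.tgtTable j := by
        intro v₁ q'
        have hj := hu j (by simp)
        rw [right_mem_tgtTable, right_mem_tgtTable]
        simp only [Option.getD_none]
        constructor
        · rintro (h | h | h | h | h | h | h | h | ⟨d, -, h, -⟩)
          iterate 6 omega
          · iterate 8 right
            exact ⟨_, le_refl _, rfl, .inr ⟨by omega, h.2⟩⟩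
          · iterate 8 right
            exact ⟨_, le_refl _, rfl, .inl h.2⟩
          · omega
        · rintro (h | h | h | h | h | h | h | h | ⟨d, -, h, h' | h'⟩)
          iterate 8 omega
          · iterate 7 right
            exact .inl ⟨hs, h'⟩
          · iterate 6 right
            exact .inl ⟨by omega, h'.2⟩
      simp only [key]
  | cons a w ih =>
    rw [sourceWord_cons] at hw
    obtain ⟨hza, hkey⟩ := hz a hw.1
    simp only [List.map_cons, List.cons_append, sweeps_src_iff, hkey, mem_imageTable,
      List.flatMap_cons, List.length_append]
    constructor
    · rintro ⟨_, v₂, _, rfl, ⟨-, -, -, ⟨rfl, rfl⟩ | ⟨o, ho, rfl, rfl⟩⟩, h⟩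
      · obtain ⟨i, hi, k, hk, hne, rfl⟩ := (ih hw.2).1 h
        refine ⟨(z a).length + i, by omega, k, hk, ?_, by rw [List.replicate_append_replicate, add_assoc]⟩
        rwa [List.getElem?_append_right (by omega), Nat.add_sub_cancel_left]
      · have hd : (z a)[o] < τ.deltaSize := hza _ (by simp)
        rw [sweeps_silent_src (.inr (.inr (.inr ⟨_, hd, rfl⟩))) hw.2] at h
        obtain ⟨k, hk, hne, rfl⟩ := (sweeps_stored_iff hu (o := some (z a)[o]) (by simpa)).1 h
        refine ⟨o, by omega, k, hk, ?_, List.replicate_append_replicate ..⟩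
        rwa [List.getElem?_append_left ho, List.getElem?_eq_getElem ho]
    · rintro ⟨i, hi, k, hk, hne, rfl⟩
      -- A position in the image of the first letter is guessed at once; for a later one this image
      -- is skipped at the cost of its length.
      rcases Nat.lt_or_ge i (z a).length with h | h
      · have hd : (z a)[i] < τ.deltaSize := hza _ (by simp)
        refine ⟨_, _, _, List.replicate_add .., ⟨hw.1, trivial, trivial, .inr ⟨i, h, rfl, rfl⟩⟩, ?_⟩
        rw [sweeps_silent_src (.inr (.inr (.inr ⟨_, hd, rfl⟩))) hw.2]
        refine (sweeps_stored_iff hu (o := some (z a)[i]) (by simpa)).2 ⟨k, hk, ?_, rfl⟩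
        rwa [List.getElem?_append_left h, List.getElem?_eq_getElem h] at hne
      · obtain ⟨i, rfl⟩ := Nat.exists_eq_add_of_le h
        rw [List.getElem?_append_right (by omega), Nat.add_sub_cancel_left] at hne
        exact ⟨_, List.replicate (i + (u.length - k)) sharp, s,
          by rw [← List.replicate_add, add_assoc], ⟨hw.1, trivial, trivial, .inl ⟨rfl, rfl⟩⟩,
          (ih hw.2).2 ⟨i, by omega, k, hk, hne, rfl⟩⟩

end PCPInstance

/-- The first factor is recovered as the longest prefix of letters that satisfy `P`. With `Odd` for
`P` this separates the copies of source letters from those of target letters and from `sharp`. -/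
theorem List.append_inj_of_forall {α : Type*} {P : α → Prop} {a a' b b' : List α}
    (h : a ++ b = a' ++ b') (ha : ∀ x ∈ a, P x) (ha' : ∀ x ∈ a', P x) (hb : ∀ x ∈ b, ¬ P x)
    (hb' : ∀ x ∈ b', ¬ P x) : a = a' ∧ b = b' := by
  rcases List.append_eq_append_iff.1 h with ⟨c, rfl, rfl⟩ | ⟨c, rfl, rfl⟩
  · have : c = [] := List.eq_nil_iff_forall_not_mem.2 fun x hx =>
      hb x (by simp [hx]) (ha' x (by simp [hx]))
    simp [this]
  · have : c = [] := List.eq_nil_iff_forall_not_mem.2 fun x hx =>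
      hb' x (by simp [hx]) (ha x (by simp [hx]))
    simp [this]

namespace PCPInstance

open TwoWayTransducer

variable {τ : PCPInstance} {q q' p : ℕ} {v w u : List ℕ} {d : Dir} {y : List ℕ}

theorem odd_of_mem_src {w : List ℕ} : ∀ x ∈ w.map src, Odd x := by
  intro x hx
  obtain ⟨i, -, rfl⟩ := List.mem_map.1 hx
  exact ⟨i, rfl⟩

theorem not_odd_of_mem_tgt {u : List ℕ} : ∀ x ∈ u.map tgt, ¬ Odd x := by
  intro x hx
  obtain ⟨i, -, rfl⟩ := List.mem_map.1 hx
  rw [Nat.not_odd_iff_even]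
  exact ⟨i + 1, by unfold tgt; omega⟩

theorem not_odd_of_mem_sharp {m : ℕ} : ∀ x ∈ List.replicate m sharp, ¬ Odd x := by
  intro x hx
  rw [List.eq_of_mem_replicate hx]
  decide

theorem encode_injective {w u w' u' : List ℕ} {m m' : ℕ} (h : encode w u m = encode w' u' m') :
    w = w' ∧ u = u' ∧ m = m' := by
  simp only [encode, Prod.mk.injEq] at h
  obtain ⟨h₁, h₂⟩ := List.append_inj_of_forall h.1 odd_of_mem_src odd_of_mem_src
    not_odd_of_mem_tgt not_odd_of_mem_tgt
  obtain ⟨-, h₃⟩ := List.append_inj_of_forall h.2 odd_of_mem_src odd_of_mem_src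
    not_odd_of_mem_sharp not_odd_of_mem_sharp
  exact ⟨List.map_injective_iff.2 src_injective h₁, List.map_injective_iff.2 tgt_injective h₂,
    by simpa using congrArg List.length h₃⟩

theorem encode_mem_encodings_iff {m : ℕ} : encode w u m ∈ τ.encodings ↔
    w ≠ [] ∧ τ.SourceWord w ∧ τ.TargetWord u := by
  constructor
  · rintro ⟨w', u', m', h₁, h₂, h₃, h⟩
    obtain ⟨rfl, rfl, -⟩ := encode_injective h
    exact ⟨h₁, h₂, h₃⟩
  · rintro ⟨h₁, h₂, h₃⟩
    exact ⟨w, u, m, h₁, h₂, h₃, rfl⟩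

theorem encode_mem_badEncodings_iff {m : ℕ} : encode w u m ∈ τ.badEncodings ↔
    (w ≠ [] ∧ τ.SourceWord w ∧ τ.TargetWord u) ∧ ¬ (m = u.length ∧ u = τ.f w ∧ u = τ.g w) := by
  rw [badEncodings, Set.mem_sdiff, encode_mem_encodings_iff]
  refine and_congr_right fun h => not_congr ?_
  constructor
  · rintro ⟨-, w', u', h', h₁, h₂⟩
    obtain ⟨rfl, rfl, rfl⟩ := encode_injective h'
    exact ⟨rfl, h₁, h₂⟩
  · rintro ⟨rfl, h₁, h₂⟩
    exact ⟨encode_mem_encodings_iff.2 h, w, u, rfl, h₁, h₂⟩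

theorem sweeps_four_iff (hw : τ.SourceWord w) (hu : τ.TargetWord u) :
    τ.transducer.Sweeps y 4 (openTape (w.map src ++ u.map tgt)) v 16 ↔
      ∃ m < u.length, v = List.replicate m sharp := by
  rw [openTape_encode, sweeps_cons_iff, ← sweeps_nine_iff (τ := τ) (y := y) hu,
    ← sweeps_silent_src (.inl rfl) hw]
  simp [mem_rules_leftEnd, leftEndTable]

theorem sweeps_five_iff (hw : τ.SourceWord w) (hu : τ.TargetWord u)
    (hy : y = w.map src ++ u.map tgt) : τ.transducer.Sweeps y 5 (openTape y) v 16 ↔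
      ∃ m > u.length, v = List.replicate m sharp := by
  have h11 : ∀ v, τ.transducer.Sweeps y 11 [] v 16 ↔ ∃ m, v = sharp :: List.replicate m sharp := by
    intro v
    rw [sweeps_nil_iff]
    simp only [mem_rules_rightEnd, right_mem_rightEndTable, left_mem_rightEndTable]
    constructor
    · rintro (⟨-, -, h | h | h | ⟨d, -, h⟩⟩ | ⟨v₁, v₂, l, rfl, ⟨h, -⟩ | ⟨-, rfl, rfl⟩, -, h⟩)
      iterate 5 omega
      obtain ⟨m, rfl⟩ := (sweeps_six_iff hw hu hy).1 h
      exact ⟨m, rfl⟩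
    · rintro ⟨m, rfl⟩
      exact .inr ⟨[sharp], _, 6, rfl, by simp, hy ▸ return_mem_rules hw hu (by omega),
        (sweeps_six_iff hw hu hy).2 ⟨m, rfl⟩⟩
  have : τ.transducer.Sweeps y 5 (openTape y) v 16 ↔
      τ.transducer.Sweeps y 11 (tgtTape u) v 16 := by
    rw [← sweeps_silent_src (.inr (.inl rfl)) hw, hy, openTape_encode, sweeps_cons_iff]
    simp [mem_rules_leftEnd, leftEndTable]
  rw [this, sweeps_eleven_iff hu]
  simp only [h11]
  constructor
  · rintro ⟨_, rfl, m, rfl⟩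
    exact ⟨u.length + (m + 1), by omega, by rw [List.replicate_add, List.replicate_succ]⟩
  · rintro ⟨m, hm, rfl⟩
    obtain ⟨k, rfl⟩ := Nat.exists_eq_add_of_le hm
    exact ⟨_, by rw [Nat.succ_add, ← Nat.add_succ, List.replicate_add], k, List.replicate_succ⟩

theorem sweeps_compare_iff (hτ : τ.Valid) (hw : τ.SourceWord w) (hu : τ.TargetWord u) {l : ℕ}
    {h : List ℕ → List ℕ} (hl : (l = 7 ∧ h = τ.f) ∨ (l = 8 ∧ h = τ.g)) :
    τ.transducer.Sweeps y l (openTape (w.map src ++ u.map tgt)) v 16 ↔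
      ∃ i ≤ (h w).length, ∃ k ≤ u.length, u[k]? ≠ (h w)[i]? ∧
        v = List.replicate (i + (u.length - k)) sharp := by
  have hmem : ∀ i < τ.images.length, τ.images.getD i ([], []) ∈ τ.images := by
    intro i hi
    rw [List.getD_eq_getElem _ _ hi]
    exact List.getElem_mem hi
  rcases hl with ⟨rfl, rfl⟩ | ⟨rfl, rfl⟩
  · have hz := sweeps_image_iff (τ := τ) (y := y) (v := v) hu hw (.inl rfl)
      (z := fun i => (τ.images.getD i ([], [])).1) (fun i hi => ⟨(hτ _ (hmem i hi)).1, fun v q' => by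
        have : ∀ d, ¬ 13 = 17 + d := by omega
        simp [right_mem_srcTable, mem_imageTable, this]⟩)
    refine Iff.trans ?_ hz
    rw [openTape_encode, sweeps_cons_iff]
    simp [mem_rules_leftEnd, leftEndTable]
  · have hz := sweeps_image_iff (τ := τ) (y := y) (v := v) hu hw (.inr rfl)
      (z := fun i => (τ.images.getD i ([], [])).2) (fun i hi => ⟨(hτ _ (hmem i hi)).2, fun v q' => by
        have : ∀ d, ¬ 14 = 17 + d := by omega
        simp [right_mem_srcTable, mem_imageTable, this]⟩)
    refine Iff.trans ?_ hz
    rw [openTape_encode, sweeps_cons_iff]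
    simp [mem_rules_leftEnd, leftEndTable]

/-- The end of a word acts as a letter `none`, so that a proper prefix differs from the longer word
at its own end. Both bounds allow the position to be guessed in either word. -/
theorem exists_getElem?_ne {α : Type*} {a b : List α} (h : a ≠ b) :
    ∃ i, i ≤ a.length ∧ i ≤ b.length ∧ a[i]? ≠ b[i]? := by
  by_contra! hcon
  refine h (List.ext_getElem? fun i => ?_)
  induction i using Nat.strong_induction_on with
  | _ i ih =>
    by_cases ha : i ≤ a.length
    · by_cases hb : i ≤ b.length
      · exact hcon i ha hb
      · have := ih b.length (by omega)
        rw [List.getElem?_eq_none (le_refl b.length), List.getElem?_eq_none_iff] at this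
        rw [List.getElem?_eq_none (by omega), List.getElem?_eq_none (by omega)]
    · by_cases hb : i ≤ b.length
      · have := ih a.length (by omega)
        rw [List.getElem?_eq_none (le_refl a.length), eq_comm, List.getElem?_eq_none_iff] at this
        rw [List.getElem?_eq_none (by omega), List.getElem?_eq_none (by omega)]
      · rw [List.getElem?_eq_none (by omega), List.getElem?_eq_none (by omega)]

/-- A comparison run that writes exactly `|u|` symbols has `i = k` and thus exhibits a true
difference between `u` and the image; any other count is bad anyway. Conversely a bad pair with the
right count has such a difference at one common position. -/
theorem rel_transducer (hτ : τ.Valid) : τ.transducer.rel = τ.badEncodings := by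
  ext ⟨y, o⟩
  rw [mem_rel_transducer_iff]
  constructor
  · rintro ⟨w, u, v, hw₀, hw, hu, rfl, rfl, l, hl, h⟩
    have key : ∃ m, v = List.replicate m sharp ∧ ¬ (m = u.length ∧ u = τ.f w ∧ u = τ.g w) := by
      rcases hl with rfl | rfl | rfl | rfl
      · obtain ⟨m, hm, rfl⟩ := (sweeps_four_iff hw hu).1 h
        exact ⟨m, rfl, by omega⟩
      · obtain ⟨m, hm, rfl⟩ := (sweeps_five_iff hw hu rfl).1 h
        exact ⟨m, rfl, by omega⟩
      · obtain ⟨i, hi, k, hk, hne, rfl⟩ := (sweeps_compare_iff hτ hw hu (.inl ⟨rfl, rfl⟩)).1 h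
        refine ⟨_, rfl, fun ⟨h₁, h₂, _⟩ => hne ?_⟩
        obtain rfl : i = k := by omega
        rw [← h₂]
      · obtain ⟨i, hi, k, hk, hne, rfl⟩ := (sweeps_compare_iff hτ hw hu (.inr ⟨rfl, rfl⟩)).1 h
        refine ⟨_, rfl, fun ⟨h₁, _, h₂⟩ => hne ?_⟩
        obtain rfl : i = k := by omega
        rw [← h₂]
    obtain ⟨m, rfl, hm⟩ := key
    exact encode_mem_badEncodings_iff.2 ⟨⟨hw₀, hw, hu⟩, hm⟩
  · intro h
    obtain ⟨w, u, m, -, -, -, he⟩ := h.1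
    rw [he, encode_mem_badEncodings_iff] at h
    obtain ⟨⟨hw₀, hw, hu⟩, hbad⟩ := h
    simp only [encode, Prod.mk.injEq] at he
    obtain ⟨rfl, rfl⟩ := he
    refine ⟨w, u, _, hw₀, hw, hu, rfl, rfl, ?_⟩
    have hcmp : ∀ {z : List ℕ}, m = u.length → u ≠ z → ∃ i ≤ z.length, ∃ k ≤ u.length,
        u[k]? ≠ z[i]? ∧ List.replicate m sharp = List.replicate (i + (u.length - k)) sharp := by
      intro z hm hne
      obtain ⟨i, h₁, h₂, h₃⟩ := exists_getElem?_ne hne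
      exact ⟨i, h₂, i, h₁, h₃, by rw [hm, Nat.add_sub_cancel' h₁]⟩
    rcases lt_trichotomy m u.length with hm | hm | hm
    · exact ⟨4, by simp, (sweeps_four_iff hw hu).2 ⟨m, hm, rfl⟩⟩
    · by_cases hf : u = τ.f w
      · exact ⟨8, by simp, (sweeps_compare_iff hτ hw hu (.inr ⟨rfl, rfl⟩)).2
          (hcmp hm fun hg => hbad ⟨hm, hf, hg⟩)⟩
      · exact ⟨7, by simp, (sweeps_compare_iff hτ hw hu (.inl ⟨rfl, rfl⟩)).2 (hcmp hm hf)⟩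
    · exact ⟨5, by simp, (sweeps_five_iff hw hu rfl).2 ⟨m, hm, rfl⟩⟩

end PCPInstance

/-! ### A one-way transducer for all encodings -/

namespace OneWayTransducer

variable {T : OneWayTransducer}

theorem run_cons_iff {q p : ℕ} {a : TapeSym} {x : List TapeSym} {v : List ℕ}
    (hq : ∀ v q', (q, none, v, q') ∉ T.rules) : T.Run q (a :: x) v p ↔
      ∃ v₁ v₂ q', v = v₁ ++ v₂ ∧ (q, some a, v₁, q') ∈ T.rules ∧ T.Run q' x v₂ p := by
  constructor
  · intro h
    cases h with
    | read h h' => exact ⟨_, _, _, rfl, h, h'⟩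
    | eps h => exact absurd h (hq _ _)
  · rintro ⟨v₁, v₂, q', rfl, h, h'⟩
    exact .read h h'

end OneWayTransducer

namespace PCPInstance

open OneWayTransducer

variable {τ : PCPInstance} {q q' p : ℕ} {v w u : List ℕ} {d : Dir} {y : List ℕ}

/-- The one-way transducer that defines the relation of all encodings. -/
def encodingTransducer (τ : PCPInstance) : OneWayTransducer where
  rules := [(0, some .leftEnd, [], 1), (2, some .rightEnd, [], 4), (3, some .rightEnd, [], 4),
      -- The number of symbols is not bounded in terms of the input, hence the ε-loop.
      (4, none, [sharp], 4)] ++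
    (List.range τ.images.length).flatMap (fun i => [(1, some (.letter (src i)), [src i], 2),
      (2, some (.letter (src i)), [src i], 2)]) ++
    (List.range τ.deltaSize).flatMap (fun j => [(2, some (.letter (tgt j)), [], 3),
      (3, some (.letter (tgt j)), [], 3)])
  initial := [0]
  final := [4]

theorem eps_mem_encodingTransducer : (q, none, v, q') ∈ τ.encodingTransducer.rules ↔
    q = 4 ∧ v = [sharp] ∧ q' = 4 := by
  simp [encodingTransducer]

theorem leftEnd_mem_encodingTransducer : (q, some .leftEnd, v, q') ∈ τ.encodingTransducer.rules ↔
    q = 0 ∧ v = [] ∧ q' = 1 := by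
  simp [encodingTransducer]

theorem rightEnd_mem_encodingTransducer :
    (q, some .rightEnd, v, q') ∈ τ.encodingTransducer.rules ↔
      (q = 2 ∨ q = 3) ∧ v = [] ∧ q' = 4 := by
  simp only [encodingTransducer, List.mem_append, List.mem_cons, Prod.mk.injEq, reduceCtorEq,
    Option.some.injEq, List.not_mem_nil, List.mem_flatMap, List.mem_range, false_and, and_false,
    or_false, false_or, exists_false, true_and, or_and_right]

theorem letter_mem_encodingTransducer {a : ℕ} :
    (q, some (.letter a), v, q') ∈ τ.encodingTransducer.rules ↔
      (∃ i < τ.images.length, a = src i ∧ (q = 1 ∨ q = 2) ∧ v = [src i] ∧ q' = 2) ∨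
      ∃ j < τ.deltaSize, a = tgt j ∧ (q = 2 ∨ q = 3) ∧ v = [] ∧ q' = 3 := by
  simp only [encodingTransducer, List.mem_append, List.mem_cons, Prod.mk.injEq, reduceCtorEq,
    Option.some.injEq, List.not_mem_nil, List.mem_flatMap, List.mem_range, TapeSym.letter.injEq,
    false_and, and_false, or_false, false_or]
  constructor
  · rintro (⟨i, hi, ⟨rfl, rfl, rfl, rfl⟩ | ⟨rfl, rfl, rfl, rfl⟩⟩ |
      ⟨j, hj, ⟨rfl, rfl, rfl, rfl⟩ | ⟨rfl, rfl, rfl, rfl⟩⟩)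
    · exact .inl ⟨i, hi, by simp⟩
    · exact .inl ⟨i, hi, by simp⟩
    · exact .inr ⟨j, hj, by simp⟩
    · exact .inr ⟨j, hj, by simp⟩
  · rintro (⟨i, hi, rfl, rfl | rfl, rfl, rfl⟩ | ⟨j, hj, rfl, rfl | rfl, rfl, rfl⟩)
    · exact .inl ⟨i, hi, by simp⟩
    · exact .inl ⟨i, hi, by simp⟩
    · exact .inr ⟨j, hj, by simp⟩
    · exact .inr ⟨j, hj, by simp⟩

theorem run_four_iff {x : List TapeSym} : τ.encodingTransducer.Run 4 x v 4 ↔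
    x = [] ∧ ∃ m, v = List.replicate m sharp := by
  constructor
  · intro h
    suffices H : ∀ q p, τ.encodingTransducer.Run q x v p → q = 4 →
        x = [] ∧ ∃ m, v = List.replicate m sharp from H 4 4 h rfl
    clear h
    intro q p h
    induction h with
    | nil => exact fun _ => ⟨rfl, 0, rfl⟩
    | @read _ _ _ a _ _ _ h =>
      rintro rfl
      cases a with
      | leftEnd => rw [leftEnd_mem_encodingTransducer] at h; omega
      | rightEnd => rw [rightEnd_mem_encodingTransducer] at h; omega
      | letter a =>
        rw [letter_mem_encodingTransducer] at h
        rcases h with ⟨i, -, -, h, -⟩ | ⟨j, -, -, h, -⟩ <;> omega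
    | eps h _ ih =>
      rintro rfl
      obtain ⟨-, rfl, rfl⟩ := eps_mem_encodingTransducer.1 h
      obtain ⟨rfl, m, rfl⟩ := ih rfl
      exact ⟨rfl, m + 1, rfl⟩
  · rintro ⟨rfl, m, rfl⟩
    induction m with
    | zero => exact .nil _
    | succ m ih => exact .eps (eps_mem_encodingTransducer.2 ⟨rfl, rfl, rfl⟩) ih

theorem not_eps_of_ne (hq : q ≠ 4) : ∀ v q', (q, none, v, q') ∉ τ.encodingTransducer.rules :=
  fun _ _ h => hq (eps_mem_encodingTransducer.1 h).1

theorem run_three_iff : τ.encodingTransducer.Run 3 (y.map .letter ++ [.rightEnd]) v 4 ↔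
    ∃ u m, τ.TargetWord u ∧ y = u.map tgt ∧ v = List.replicate m sharp := by
  induction y generalizing v with
  | nil =>
    rw [List.map_nil, List.nil_append, run_cons_iff (not_eps_of_ne (by omega))]
    simp only [rightEnd_mem_encodingTransducer]
    constructor
    · rintro ⟨v₁, v₂, q', rfl, ⟨-, rfl, rfl⟩, h⟩
      obtain ⟨-, m, rfl⟩ := run_four_iff.1 h
      exact ⟨[], m, by simp [TargetWord], rfl, rfl⟩
    · rintro ⟨u, m, -, -, rfl⟩
      exact ⟨[], _, 4, rfl, ⟨by simp, rfl, rfl⟩, run_four_iff.2 ⟨rfl, m, rfl⟩⟩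
  | cons a y ih =>
    rw [List.map_cons, List.cons_append, run_cons_iff (not_eps_of_ne (by omega))]
    simp only [letter_mem_encodingTransducer]
    constructor
    · rintro ⟨v₁, v₂, q', rfl, ⟨i, -, -, h, -⟩ | ⟨j, hj, rfl, -, rfl, rfl⟩, h⟩
      · omega
      · obtain ⟨u, m, hu, rfl, rfl⟩ := ih.1 h
        exact ⟨j :: u, m, targetWord_cons.2 ⟨hj, hu⟩, rfl, rfl⟩
    · rintro ⟨u, m, hu, h, rfl⟩
      obtain ⟨j, u, rfl, rfl, rfl⟩ := List.map_eq_cons_iff.1 h.symm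
      rw [targetWord_cons] at hu
      exact ⟨[], _, 3, rfl, .inr ⟨j, hu.1, rfl, by simp, rfl, rfl⟩, ih.2 ⟨u, m, hu.2, rfl, rfl⟩⟩

theorem run_two_iff : τ.encodingTransducer.Run 2 (y.map .letter ++ [.rightEnd]) v 4 ↔
    ∃ w u m, τ.SourceWord w ∧ τ.TargetWord u ∧ (y, v) = encode w u m := by
  simp only [encode, Prod.mk.injEq]
  induction y generalizing v with
  | nil =>
    rw [List.map_nil, List.nil_append, run_cons_iff (not_eps_of_ne (by omega))]
    simp only [rightEnd_mem_encodingTransducer]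
    constructor
    · rintro ⟨v₁, v₂, q', rfl, ⟨-, rfl, rfl⟩, h⟩
      obtain ⟨-, m, rfl⟩ := run_four_iff.1 h
      exact ⟨[], [], m, by simp [SourceWord], by simp [TargetWord], rfl, rfl⟩
    · rintro ⟨w, u, m, -, -, h, rfl⟩
      obtain ⟨h, -⟩ := List.nil_eq_append_iff.1 h
      exact ⟨[], _, 4, rfl, ⟨by simp, rfl, rfl⟩, run_four_iff.2 ⟨rfl, m, by simp [h]⟩⟩
  | cons a y ih =>
    rw [List.map_cons, List.cons_append, run_cons_iff (not_eps_of_ne (by omega))]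
    simp only [letter_mem_encodingTransducer]
    constructor
    · rintro ⟨v₁, v₂, q', rfl, ⟨i, hi, rfl, -, rfl, rfl⟩ | ⟨j, hj, rfl, -, rfl, rfl⟩, h⟩
      · obtain ⟨w, u, m, hw, hu, rfl, rfl⟩ := ih.1 h
        exact ⟨i :: w, u, m, sourceWord_cons.2 ⟨hi, hw⟩, hu, rfl, rfl⟩
      · obtain ⟨u, m, hu, rfl, rfl⟩ := run_three_iff.1 h
        exact ⟨[], j :: u, m, by simp [SourceWord], targetWord_cons.2 ⟨hj, hu⟩, rfl, rfl⟩
    · rintro ⟨w, u, m, hw, hu, h, rfl⟩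
      cases w with
      | nil =>
        obtain ⟨j, u, rfl, rfl, rfl⟩ := List.map_eq_cons_iff.1 h.symm
        rw [targetWord_cons] at hu
        exact ⟨[], _, 3, rfl, .inr ⟨j, hu.1, rfl, by simp, rfl, rfl⟩,
          run_three_iff.2 ⟨u, m, hu.2, rfl, rfl⟩⟩
      | cons i w =>
        injection h with h₁ h₂
        rw [sourceWord_cons] at hw
        exact ⟨[src i], _, 2, rfl, .inl ⟨i, hw.1, h₁, by simp, rfl, rfl⟩,
          ih.2 ⟨w, u, m, hw.2, hu, h₂, rfl⟩⟩

theorem rel_encodingTransducer : τ.encodingTransducer.rel = τ.encodings := by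
  ext ⟨y, v⟩
  have h0 : (y, v) ∈ τ.encodingTransducer.rel ↔
      τ.encodingTransducer.Run 1 (y.map .letter ++ [.rightEnd]) v 4 := by
    change (∃ q ∈ _, ∃ p ∈ _, τ.encodingTransducer.Run q (.leftEnd :: _) v p) ↔ _
    have hi : τ.encodingTransducer.initial = [0] := rfl
    have hf : τ.encodingTransducer.final = [4] := rfl
    simp only [hi, hf, List.mem_singleton, exists_eq_left]
    rw [run_cons_iff (not_eps_of_ne (by omega))]
    simp only [leftEnd_mem_encodingTransducer]
    constructor
    · rintro ⟨v₁, v₂, q', rfl, ⟨-, rfl, rfl⟩, h⟩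
      exact h
    · intro h
      exact ⟨[], v, 1, rfl, ⟨trivial, rfl, rfl⟩, h⟩
  rw [h0]
  constructor
  · intro h
    cases y with
    | nil =>
      rw [List.map_nil, List.nil_append, run_cons_iff (not_eps_of_ne (by omega))] at h
      obtain ⟨v₁, v₂, q', -, h, -⟩ := h
      rw [rightEnd_mem_encodingTransducer] at h
      omega
    | cons a y =>
      rw [List.map_cons, List.cons_append, run_cons_iff (not_eps_of_ne (by omega))] at h
      simp only [letter_mem_encodingTransducer] at h
      obtain ⟨v₁, v₂, q', rfl, ⟨i, hi, rfl, -, rfl, rfl⟩ | ⟨j, hj, rfl, h, -⟩, h'⟩ := h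
      · obtain ⟨w, u, m, hw, hu, h⟩ := run_two_iff.1 h'
        simp only [encode, Prod.mk.injEq] at h
        obtain ⟨rfl, rfl⟩ := h
        exact ⟨i :: w, u, m, by simp, sourceWord_cons.2 ⟨hi, hw⟩, hu, rfl⟩
      · omega
  · rintro ⟨w, u, m, hw₀, hw, hu, h⟩
    simp only [encode, Prod.mk.injEq] at h
    obtain ⟨rfl, rfl⟩ := h
    cases w with
    | nil => exact absurd rfl hw₀
    | cons i w =>
      rw [sourceWord_cons] at hw
      simp only [List.map_cons, List.cons_append]
      rw [run_cons_iff (not_eps_of_ne (by omega))]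
      refine ⟨[src i], _, 2, rfl, ?_, run_two_iff.2 ⟨w, u, m, hw.2, hu, rfl⟩⟩
      exact letter_mem_encodingTransducer.2 (.inl ⟨i, hw.1, rfl, .inl rfl, rfl, rfl⟩)

theorem badEncodings_eq_encodings (h : ¬ τ.HasSolution) : τ.badEncodings = τ.encodings := by
  refine Set.Subset.antisymm (fun p hp => hp.1) fun p hp => ?_
  obtain ⟨w, u, m, hw₀, hw, hu, rfl⟩ := hp
  exact encode_mem_badEncodings_iff.2 ⟨⟨hw₀, hw, hu⟩,
    fun ⟨_, h₁, h₂⟩ => h ⟨w, hw₀, hw, h₁.symm.trans h₂⟩⟩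

end PCPInstance

-- A run for `n < m` is cut at the completion of the input prefix `P n` or of the output prefix `P
-- n`, whichever comes first. The colour records overshoot, state, whether nothing has been read,
-- and whether the output prefix is complete. For `k < n < m` with equal colours, the first half of
-- the run for `(n, m)` followed by the second half of the run for `(k, n)` has an input ending in
-- `U n` and an output ending in `H n`. The prefixes agree by `h₂`, and one of them is `P n`.
open TwoWayTransducer in
theorem OneWayTransducer.not_rel_of_ne (T : OneWayTransducer) (α : ℕ → Prop) (P U H : ℕ → List ℕ)
    (hP : ∀ n, ∀ a ∈ P n, α a)
    (h₁ : ∀ n m, n < m → (P n ++ U m, P n ++ H m) ∈ T.rel)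
    (h₂ : ∀ n p p', (∀ a ∈ p, α a) → (∀ a ∈ p', α a) → (p ++ U n, p' ++ H n) ∈ T.rel → p = p')
    (h₃ : ∀ n, (P n ++ U n, P n ++ H n) ∉ T.rel) : False := by
  classical
  have hcut : ∀ n m, n < m → ∃ C : List ℕ × ℕ × Prop × Prop, C.1 ∈ T.pending ∧ C.2.1 ∈ T.targets ∧
      ∃ i ∈ T.initial, ∃ f ∈ T.final, ∃ x₁ x₂ v c v',
        openTape (P n) = x₁ ++ x₂ ∧ T.Run i x₁ (v ++ C.1) C.2.1 ∧
        T.Run C.2.1 (x₂ ++ ((U m).map .letter ++ [.rightEnd])) v' f ∧ v ++ c = P n ∧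
        C.1 ++ v' = c ++ H m ∧ (x₁ = [] ↔ C.2.2.1) ∧ (c = [] ↔ C.2.2.2) ∧ (c = [] ∨ x₂ = []) := by
    intro n m hnm
    obtain ⟨i, hi, f, hf, h⟩ := h₁ n m hnm
    obtain ⟨v₁, v₂, q₁, hv, hr₁, hr₂⟩ := h.split_input (openTape (P n))
      ((U m).map .letter ++ [.rightEnd]) (by simp [tape])
    simp only at hv
    rcases List.append_eq_append_iff.1 hv with ⟨c, rfl, hc⟩ | ⟨c, hc, rfl⟩
    · obtain ⟨x₁, x₂, b, v₃, q, hx, rfl, hb, h₁, h₂⟩ := hr₁.split_output (P n) c rfl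
      exact ⟨(b, q, _, _), hb, h₁.mem_targets (List.mem_append_left _ hi), i, hi, f, hf, x₁, x₂, P n,
        [], v₃ ++ v₂, hx, h₁, h₂.append hr₂, by simp, by simp [hc], Iff.rfl, Iff.rfl, .inl rfl⟩
    · exact ⟨([], q₁, _, _), by simp [pending], hr₁.mem_targets (List.mem_append_left _ hi), i, hi, f,
        hf, openTape (P n), [], v₁, c, _, by simp, by simpa using hr₁, hr₂, hc.symm, by simp, Iff.rfl, Iff.rfl,
        .inr rfl⟩
  choose! C hC₁ hC₂ hC using hcut
  let S : Set (List ℕ × ℕ × Prop × Prop) :=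
    {b | b ∈ T.pending} ×ˢ ({q | q ∈ T.targets} ×ˢ Set.univ)
  have hS : S.Finite := (List.finite_toSet _).prod ((List.finite_toSet _).prod Set.finite_univ)
  obtain ⟨k, n, m, hkn, hnm, hc⟩ := exists_lt_lt_color_eq hS C
    fun i j hij => ⟨hC₁ i j hij, hC₂ i j hij, trivial⟩
  obtain ⟨i, hi, -, -, x₁, x₂, v, c, -, hx, hr, -, hv, -, hn, hd, he⟩ := hC n m hnm
  obtain ⟨-, -, f, hf, x₁', x₂', v', c', v'', hx', -, hr', hv', hw', hn', hd', he'⟩ := hC k n hkn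
  rw [hc] at hr' hw' hn' hd'
  -- Since the halves agree on whether `x₁` is empty, the spliced tape word contains the left
  -- delimiter exactly once.
  obtain ⟨p, hp, hpx, hpn⟩ : ∃ p, (∀ a ∈ p, α a) ∧ x₁ ++ x₂' = openTape p ∧
      (x₂ = [] → x₂' = [] → p = P n) := by
    by_cases h : x₁ = []
    · have h' := hn'.2 (hn.1 h)
      subst h h'
      refine ⟨P k, hP k, hx'.symm, fun h h' => ?_⟩
      simp [h] at hx
    · have h' : x₁' ≠ [] := fun h' => h (hn.2 (hn'.1 h'))
      obtain ⟨a, y₁, rfl⟩ := List.exists_cons_of_ne_nil h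
      obtain ⟨a', y₁', rfl⟩ := List.exists_cons_of_ne_nil h'
      simp only [openTape, List.cons_append, List.cons.injEq] at hx hx'
      obtain ⟨rfl, hx⟩ := hx
      obtain ⟨rfl, hx'⟩ := hx'
      obtain ⟨s, t, hst, rfl, rfl⟩ := List.map_eq_append_iff.1 hx
      obtain ⟨s', t', hst', rfl, rfl⟩ := List.map_eq_append_iff.1 hx'
      refine ⟨s ++ t', fun a ha => ?_, by simp, fun h h' => ?_⟩
      · rcases List.mem_append.1 ha with ha | ha
        · exact hP n a (by simp [hst, ha])
        · exact hP k a (by simp [hst', ha])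
      · rw [List.map_eq_nil_iff] at h h'
        simp [hst, h, h']
  have hrun := hr.append hr'
  have hpair : (p ++ U n, (v ++ c') ++ H n) ∈ T.rel := by
    refine ⟨i, hi, f, hf, ?_⟩
    have e₁ : tape (p ++ U n) = x₁ ++ (x₂' ++ ((U n).map .letter ++ [.rightEnd])) := by
      rw [← List.append_assoc, hpx]
      simp [tape]
    simp only [e₁, List.append_assoc, ← hw']
    simpa using hrun
  have hvc : ∀ a ∈ v ++ c', α a := fun a ha => by
    rcases List.mem_append.1 ha with ha | ha
    · exact hP n a (by simp [← hv, ha])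
    · exact hP k a (by simp [← hv', ha])
  have heq := h₂ n _ _ hp hvc hpair
  -- If the output prefix was complete at both cuts, the output prefix of the spliced run is `P n`;
  -- otherwise the input prefix had been read completely in both runs, and `p` is the one read in
  -- the first half.
  have hPn : p = P n := by
    by_cases h : c = []
    · have h' := hd'.2 (hd.1 h)
      rw [heq, h', ← hv, h]
    · have h' : c' ≠ [] := fun h' => h (hd.2 (hd'.1 h'))
      exact hpn (he.resolve_left h) (he'.resolve_left h')
  rw [← heq, hPn] at hpair
  exact h₃ n hpair

/-! ### Powers of a solution, and the reduction from the correspondence problem -/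

namespace PCPInstance

open TwoWayTransducer

variable {τ : PCPInstance}

/-- The `n`-th power of a word. -/
def power (w : List ℕ) (n : ℕ) : List ℕ := (List.replicate n w).flatten

theorem power_succ (w : List ℕ) (n : ℕ) : power w (n + 1) = w ++ power w n := by
  simp [power, List.replicate_succ]

theorem length_power (w : List ℕ) (n : ℕ) : (power w n).length = n * w.length := by
  simp [power]

theorem mem_of_mem_power {w : List ℕ} {n a : ℕ} (h : a ∈ power w n) : a ∈ w := by
  obtain ⟨l, hl, h⟩ := List.mem_flatten.1 h
  rwa [List.eq_of_mem_replicate hl] at h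

theorem flatMap_power (h : ℕ → List ℕ) (w : List ℕ) (n : ℕ) :
    (power w n).flatMap h = power (w.flatMap h) n := by
  induction n with
  | zero => simp [power]
  | succ n ih => rw [power_succ, power_succ, List.flatMap_append, ih]

/-- Distinct powers of `τ.f w` then have distinct lengths, which is where the hypothesis on erased
letters enters. -/
theorem f_ne_nil (hτ : τ.NoLetterErased) {w : List ℕ} (hw₀ : w ≠ []) (hw : τ.SourceWord w)
    (h : τ.f w = τ.g w) : τ.f w ≠ [] := by
  intro hf
  have hg := h.symm.trans hf
  obtain ⟨i, w, rfl⟩ := List.exists_cons_of_ne_nil hw₀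
  have hi := (sourceWord_cons.1 hw).1
  simp only [f, g, List.flatMap_cons, List.append_eq_nil_iff] at hf hg
  apply hτ
  have : τ.images.getD i ([], []) = ([], []) := Prod.ext hf.1 hg.1
  rw [← this, List.getD_eq_getElem _ _ hi]
  exact List.getElem_mem hi

theorem targetWord_f (hτ : τ.Valid) {w : List ℕ} (hw : τ.SourceWord w) :
    τ.TargetWord (τ.f w) := by
  intro a ha
  obtain ⟨i, hi, h⟩ := List.mem_flatMap.1 ha
  rw [List.getD_eq_getElem _ _ (hw i hi)] at h
  exact (hτ _ (List.getElem_mem _)).1 a h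

theorem not_badEncodings_of_hasSolution (hτ : τ.Valid) (hτ' : τ.NoLetterErased)
    (h : τ.HasSolution) (T : OneWayTransducer) : T.rel ≠ τ.badEncodings := by
  intro hT
  obtain ⟨w, hw₀, hw, hfg⟩ := h
  have hu₀ := f_ne_nil hτ' hw₀ hw hfg
  have hw' : ∀ n, power w (n + 1) ≠ [] ∧ τ.SourceWord (power w (n + 1)) := fun n =>
    ⟨by simp [power_succ, hw₀], fun i hi => hw i (mem_of_mem_power hi)⟩
  have hu' : ∀ n, τ.TargetWord (power (τ.f w) n) := fun n j hj =>
    targetWord_f hτ hw j (mem_of_mem_power hj)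
  have hf : ∀ n, τ.f (power w n) = power (τ.f w) n := fun n => flatMap_power _ w n
  have hg : ∀ n, τ.g (power w n) = power (τ.f w) n := fun n => by
    rw [hfg]; exact flatMap_power _ w n
  have hbad : ∀ n m, (((power w (n + 1)).map src ++ (power (τ.f w) (m + 1)).map tgt,
      (power w (n + 1)).map src ++ List.replicate ((m + 1) * (τ.f w).length) sharp) ∈ T.rel ↔
      n ≠ m) := by
    intro n m
    rw [hT]
    change encode _ _ _ ∈ _ ↔ _
    rw [encode_mem_badEncodings_iff, hf, hg, length_power]
    constructor
    · rintro ⟨-, h⟩ rfl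
      exact h ⟨rfl, rfl, rfl⟩
    · intro hnm
      refine ⟨⟨(hw' n).1, (hw' n).2, hu' _⟩, fun h => hnm ?_⟩
      have := congrArg List.length h.2.1
      rw [length_power, length_power] at this
      have := Nat.eq_of_mul_eq_mul_right (List.length_pos_iff.2 hu₀) this
      omega
  refine T.not_rel_of_ne (Odd ·) (fun n => (power w (n + 1)).map src)
    (fun n => (power (τ.f w) (n + 1)).map tgt)
    (fun n => List.replicate ((n + 1) * (τ.f w).length) sharp) (fun _ => odd_of_mem_src)
    (fun n m hnm => (hbad n m).2 hnm.ne) ?_ fun n h => (hbad n n).1 h rfl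
  intro n p p' hp hp' h
  rw [hT] at h
  obtain ⟨x, u, m, -, -, -, h⟩ := h.1
  simp only [encode, Prod.mk.injEq] at h
  have e₁ := List.append_inj_of_forall h.1 hp odd_of_mem_src not_odd_of_mem_tgt not_odd_of_mem_tgt
  have e₂ := List.append_inj_of_forall h.2 hp' odd_of_mem_src not_odd_of_mem_sharp
    not_odd_of_mem_sharp
  exact e₁.1.trans e₂.1.symm

theorem exists_computable_reduction : ∃ S : PCPInstance → TwoWayTransducer, Computable S ∧
    ∀ τ : PCPInstance, τ.Valid →
      (S τ).WellFormed ∧ (S τ).IsSweeping ∧ (S τ).rel = τ.badEncodings ∧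
      (τ.NoLetterErased → ((S τ).OneWayDefinable ↔ ¬ τ.HasSolution)) := by
  refine ⟨transducer, computable_transducer, fun τ hτ => ⟨(structured_transducer τ).wellFormed,
    (structured_transducer τ).isSweeping, rel_transducer hτ, fun hτ' => ⟨?_, fun h => ?_⟩⟩⟩
  · rintro ⟨T, hT⟩ h
    exact not_badEncodings_of_hasSolution hτ hτ' h T (hT.trans (rel_transducer hτ))
  · exact ⟨encodingTransducer τ, by
      rw [rel_encodingTransducer, rel_transducer hτ, badEncodings_eq_encodings h]⟩

end PCPInstance

/-! ### Word equations `x · f w = g w · y` -/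

/-- Two morphisms `f` and `g` on the alphabet `{0, …, tiles.length - 1}`, the `i`-th entry of `tiles`
being `(g i, f i)`, and a word `y`, all over the alphabet `{1, …, size}`. -/
structure TileSystem : Type where
  tiles : List (List ℕ × List ℕ)
  last : List ℕ
  size : ℕ
  /-- A bound on the lengths of all words. -/
  bound : ℕ
  mem_tiles : ∀ t ∈ tiles, (∀ a ∈ t.1, 1 ≤ a ∧ a ≤ size) ∧ ∀ a ∈ t.2, 1 ≤ a ∧ a ≤ size
  length_tiles : ∀ t ∈ tiles, t.1.length ≤ bound ∧ t.2.length ≤ bound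
  mem_last : ∀ a ∈ last, 1 ≤ a ∧ a ≤ size
  length_last : last.length ≤ bound
  -- This makes the empty word shorter than `g w · y` for every `w`, so that the transducer has
  -- several outputs on some input.
  last_ne_nil : last ≠ []

namespace TileSystem

variable {A : TileSystem} {q q' p : ℕ} {a : TapeSym} {d : Dir} {u v w x y z s : List ℕ} {i : ℕ}

/-- Words over the alphabet of the images. -/
abbrev IsWord (A : TileSystem) (u : List ℕ) : Prop := ∀ a ∈ u, 1 ≤ a ∧ a ≤ A.size

def f (A : TileSystem) (w : List ℕ) : List ℕ := w.flatMap fun i => (A.tiles.getD i ([], [])).2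

def g (A : TileSystem) (w : List ℕ) : List ℕ := w.flatMap fun i => (A.tiles.getD i ([], [])).1

/-- Words over the alphabet of tiles. -/
abbrev IsTileWord (A : TileSystem) (w : List ℕ) : Prop := ∀ i ∈ w, i < A.tiles.length

/-- In the states `0`, `1` a word shorter than the word `g` is produced, in the states `2`, `3` a longer
one, in the states `4`, `5` a different one of the same length. The first state of each pair is for
the part where the two words agree in length, and agree in the case of `4`. -/
def Produces (C : ℕ) (q : ℕ) (g z : List ℕ) (q' : ℕ) : Prop :=
  (q = 0 ∧ q' = 0 ∧ z.length = g.length) ∨ (q = 0 ∧ q' = 1 ∧ z.length < g.length) ∨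
  (q = 1 ∧ q' = 1 ∧ z.length ≤ g.length) ∨
  (q = 2 ∧ q' = 2 ∧ z.length = g.length) ∨
  (q = 2 ∧ q' = 3 ∧ g.length < z.length ∧ z.length ≤ C) ∨
  (q = 3 ∧ q' = 3 ∧ g.length ≤ z.length ∧ z.length ≤ C) ∨
  (q = 4 ∧ q' = 4 ∧ z = g) ∨ (q = 4 ∧ q' = 5 ∧ z.length = g.length ∧ z ≠ g) ∨
  (q = 5 ∧ q' = 5 ∧ z.length = g.length)

/-- The rules that do not depend on the word `x`. -/
inductive BaseRule (A : TileSystem) : ℕ → TapeSym → List ℕ → ℕ → Dir → Prop where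
  -- The states: `13` is initial and `12` final; `0`, …, `5` produce a word different from `g w ·
  -- y`; `6` guesses two output letters for each letter of `z`; `7` and `8` write `f w` and the
  -- first copy of `z`; `9` returns; `10` and `11` skip `w` and write the second copy.
  | startShort : BaseRule A 13 .leftEnd [] 0 .right
  | startLong : BaseRule A 13 .leftEnd [] 2 .right
  | startDifferent : BaseRule A 13 .leftEnd [] 4 .right
  | produce {i : ℕ} {g f z : List ℕ} {q q' : ℕ} (h : A.tiles[i]? = some (g, f)) (hz : A.IsWord z)
      (hq : Produces A.bound q g z q') : BaseRule A q (.letter (i + 1)) z q' .right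
  -- The difference must be established by the time the separator `0` is read, where the word
  -- `A.last` is accounted for.
  | produceLast {z : List ℕ} {q q' : ℕ} (hz : A.IsWord z)
      (hq : Produces A.bound q A.last z q') (hq' : q' = 1 ∨ q' = 3 ∨ q' = 5) :
      BaseRule A q (.letter 0) (z ++ [0]) 6 .right
  | guess {a b c : ℕ} (ha : a < 2) (hb : b < 2) (hc : c < 2) :
      BaseRule A 6 (.letter a) [b, c] 6 .right
  | guessEnd : BaseRule A 6 .rightEnd [] 12 .right
  | image {i : ℕ} {g f : List ℕ} (h : A.tiles[i]? = some (g, f)) :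
      BaseRule A 7 (.letter (i + 1)) f 7 .right
  | imageEnd : BaseRule A 7 (.letter 0) [0] 8 .right
  | copy {a : ℕ} (ha : a < 2) : BaseRule A 8 (.letter a) [a] 8 .right
  | turn : BaseRule A 8 .rightEnd [] 9 .left
  | back {a : ℕ} (ha : a < A.tiles.length + 2) : BaseRule A 9 (.letter a) [] 9 .left
  | restart : BaseRule A 9 .leftEnd [] 10 .right
  | skip {i : ℕ} (h : i < A.tiles.length) : BaseRule A 10 (.letter (i + 1)) [] 10 .right
  | skipEnd : BaseRule A 10 (.letter 0) [] 11 .right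
  | copyAgain {a : ℕ} (ha : a < 2) : BaseRule A 11 (.letter a) [a] 11 .right
  | copyEnd : BaseRule A 11 .rightEnd [] 12 .right

theorem isWord_of_getElem? {g f : List ℕ} (h : A.tiles[i]? = some (g, f)) :
    A.IsWord g ∧ A.IsWord f := A.mem_tiles _ (List.mem_of_getElem? h)

theorem length_of_getElem? {g f : List ℕ} (h : A.tiles[i]? = some (g, f)) :
    g.length ≤ A.bound ∧ f.length ≤ A.bound := A.length_tiles _ (List.mem_of_getElem? h)

theorem Produces.bounds {C : ℕ} {g : List ℕ} (h : Produces C q g z q') (hg : g.length ≤ C) :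
    q < 6 ∧ q' < 6 ∧ z.length ≤ C := by
  rcases h with h | h | h | h | h | h | h | h | h
  case inr.inr.inr.inr.inr.inr.inl => obtain ⟨rfl, rfl, rfl⟩ := h; omega
  all_goals omega

theorem finite_words (K n : ℕ) : {v : List ℕ | v.length ≤ n ∧ ∀ a ∈ v, a ≤ K}.Finite := by
  refine ((List.finite_length_le (Fin (K + 1)) n).image (List.map Fin.val)).subset ?_
  rintro v ⟨hv, h⟩
  refine ⟨v.pmap (fun a ha => ⟨a, Nat.lt_succ_of_le ha⟩) h, by simpa using hv, ?_⟩
  rw [List.map_pmap]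
  simp

/-- Finiteness is enough here, although it yields no computable list: the reduction uses one fixed
system, and only `x` varies. -/
theorem finite_baseRule (A : TileSystem) :
    {r : Rule | A.BaseRule r.1 r.2.1 r.2.2.1 r.2.2.2.1 r.2.2.2.2}.Finite := by
  let S : Set TapeSym := {.leftEnd, .rightEnd} ∪ TapeSym.letter '' Set.Iio (A.tiles.length + 2)
  have hS : S.Finite := (Set.toFinite _).union ((Set.finite_Iio _).image _)
  have hD : (Set.univ : Set Dir).Finite := by
    refine (Set.toFinite {Dir.left, Dir.right}).subset fun d _ => ?_
    cases d <;> simp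
  -- The slack of `2` covers the separator after a produced word and the pairs of guessed letters;
  -- `A.size + 1` covers the letters `0` and `1` even for an empty alphabet.
  refine ((Set.finite_Iio 14).prod (hS.prod ((finite_words (A.size + 1) (A.bound + 2)).prod
    ((Set.finite_Iio 14).prod hD)))).subset ?_
  rintro ⟨q, a, v, q', d⟩ h
  replace h : A.BaseRule q a v q' d := h
  have hl : ∀ {a : ℕ}, a < A.tiles.length + 2 → TapeSym.letter a ∈ S :=
    fun ha => .inr ⟨_, ha, rfl⟩
  have hl2 : ∀ {a : ℕ}, a < 2 → TapeSym.letter a ∈ S := fun ha => hl (by omega)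
  have h1 : TapeSym.leftEnd ∈ S := by simp [S]
  have h2 : TapeSym.rightEnd ∈ S := by simp [S]
  have hw : ∀ {v : List ℕ}, A.IsWord v → v.length ≤ A.bound →
      v.length ≤ A.bound + 2 ∧ ∀ a ∈ v, a ≤ A.size + 1 := fun hv h =>
    ⟨by omega, fun a ha => (hv a ha).2.trans (by omega)⟩
  have hw0 : ∀ {v : List ℕ}, v.length ≤ 2 → (∀ a ∈ v, a < 2) →
      v.length ≤ A.bound + 2 ∧ ∀ a ∈ v, a ≤ A.size + 1 := fun h hv =>
    ⟨by omega, fun a ha => by have := hv a ha; omega⟩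
  suffices H : q < 14 ∧ a ∈ S ∧ (v.length ≤ A.bound + 2 ∧ ∀ a ∈ v, a ≤ A.size + 1) ∧ q' < 14 by
    exact ⟨H.1, H.2.1, H.2.2.1, H.2.2.2, trivial⟩
  cases h with
  | produce h hz hq =>
    have := hq.bounds (length_of_getElem? h).1
    have hi := (List.getElem?_eq_some_iff.1 h).1
    exact ⟨by omega, hl (by omega), hw hz this.2.2, by omega⟩
  | produceLast hz hq hq' =>
    have := hq.bounds A.length_last
    refine ⟨by omega, hl2 (by omega), ⟨by simp; omega, ?_⟩, by omega⟩
    intro a ha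
    rcases List.mem_append.1 ha with ha | ha
    · exact (hz a ha).2.trans (by omega)
    · simp at ha; omega
  | image h =>
    have hi := (List.getElem?_eq_some_iff.1 h).1
    exact ⟨by omega, hl (by omega), hw (isWord_of_getElem? h).2 (length_of_getElem? h).2, by omega⟩
  | guess ha hb hc => exact ⟨by omega, hl2 ha, hw0 (by simp) (by simp; omega), by omega⟩
  | copy ha => exact ⟨by omega, hl2 ha, hw0 (by simp) (by simp; omega), by omega⟩
  | copyAgain ha => exact ⟨by omega, hl2 ha, hw0 (by simp) (by simp; omega), by omega⟩
  | imageEnd => exact ⟨by omega, hl2 (by omega), hw0 (by simp) (by simp), by omega⟩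
  | skipEnd => exact ⟨by omega, hl2 (by omega), hw0 (by simp) (by simp), by omega⟩
  | back ha => exact ⟨by omega, hl ha, hw0 (by simp) (by simp), by omega⟩
  | skip h => exact ⟨by omega, hl (by omega), hw0 (by simp) (by simp), by omega⟩
  | startShort | startLong | startDifferent | guessEnd | turn | restart | copyEnd =>
    exact ⟨by omega, by assumption, hw0 (by simp) (by simp), by omega⟩

/-- The transducer that reads words `w · 0 · z` and outputs either `u · 0 · v` with `u ≠ g w · y` and
`|v| = 2 |z|`, or `x · f w · 0 · z · z`. -/
noncomputable def transducer (A : TileSystem) (x : List ℕ) : TwoWayTransducer where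
  rules := (13, .leftEnd, x, 7, .right) ::
    ((List.range x.length).map (fun t => ((13, .leftEnd, x.take (t + 1), 3, .right) : Rule)) ++
      A.finite_baseRule.toFinset.toList)
  initial := [13]
  final := [12]

theorem mem_rules : (q, a, v, q', d) ∈ (A.transducer x).rules ↔
    (q = 13 ∧ a = .leftEnd ∧ v = x ∧ q' = 7 ∧ d = .right) ∨
    (∃ t < x.length, q = 13 ∧ a = .leftEnd ∧ v = x.take (t + 1) ∧ q' = 3 ∧ d = .right) ∨
    A.BaseRule q a v q' d := by
  simp only [transducer, List.mem_cons, List.mem_append, List.mem_map, List.mem_range, Prod.mk.injEq,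
    Finset.mem_toList, Set.Finite.mem_toFinset, Set.mem_ofPred_eq, eq_comm]

theorem mem_rules_leftEnd : (q, .leftEnd, v, q', d) ∈ (A.transducer x).rules ↔ d = .right ∧
    ((q = 13 ∧ ((v = x ∧ q' = 7) ∨ (∃ t < x.length, v = x.take (t + 1) ∧ q' = 3) ∨
      (v = [] ∧ (q' = 0 ∨ q' = 2 ∨ q' = 4)))) ∨ (q = 9 ∧ v = [] ∧ q' = 10)) := by
  rw [mem_rules]
  constructor
  · rintro (⟨rfl, -, rfl, rfl, rfl⟩ | ⟨t, ht, rfl, -, rfl, rfl, rfl⟩ | h)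
    · exact ⟨rfl, .inl ⟨rfl, .inl ⟨rfl, rfl⟩⟩⟩
    · exact ⟨rfl, .inl ⟨rfl, .inr (.inl ⟨t, ht, rfl, rfl⟩)⟩⟩
    · cases h <;> simp
  · rintro ⟨rfl, ⟨rfl, ⟨rfl, rfl⟩ | ⟨t, ht, rfl, rfl⟩ | ⟨rfl, rfl | rfl | rfl⟩⟩ | ⟨rfl, rfl, rfl⟩⟩
    · simp
    · exact .inr (.inl ⟨t, ht, by simp⟩)
    · exact .inr (.inr .startShort)
    · exact .inr (.inr .startLong)
    · exact .inr (.inr .startDifferent)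
    · exact .inr (.inr .restart)

theorem mem_rules_letter {i : ℕ} : (q, .letter i, v, q', d) ∈ (A.transducer x).rules ↔
    A.BaseRule q (.letter i) v q' d := by
  simp [mem_rules]

theorem mem_rules_rightEnd : (q, .rightEnd, v, q', d) ∈ (A.transducer x).rules ↔
    ((q = 6 ∨ q = 11) ∧ v = [] ∧ q' = 12 ∧ d = .right) ∨
      (q = 8 ∧ v = [] ∧ q' = 9 ∧ d = .left) := by
  have : (q, .rightEnd, v, q', d) ∈ (A.transducer x).rules ↔ A.BaseRule q .rightEnd v q' d := by
    simp [mem_rules]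
  rw [this]
  constructor
  · intro h
    cases h <;> simp
  · rintro (⟨rfl | rfl, rfl, rfl, rfl⟩ | ⟨rfl, rfl, rfl, rfl⟩)
    · exact .guessEnd
    · exact .copyEnd
    · exact .turn

theorem structured_transducer : (A.transducer x).Structured fun q => q = 9 where
  leftEnd {q v q' d} h := by
    obtain ⟨rfl, h⟩ := mem_rules_leftEnd.1 h
    refine ⟨rfl, ?_⟩
    rintro rfl
    exact absurd h (by omega)
  letter {q a v q' d} h := by
    rw [mem_rules_letter] at h
    cases h with
    | produce h _ hq => have := hq.bounds (length_of_getElem? h).1; exact .inl ⟨rfl, by omega, by omega⟩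
    | produceLast _ hq => have := hq.bounds A.length_last; exact .inl ⟨rfl, by omega, by omega⟩
    | _ => simp
  rightEnd {q v q'} h := by
    rw [mem_rules_rightEnd] at h
    simpa using h.imp (·.2.2.2) (·.2.2.1)

/-- The word `x` occurs only in rules on the left delimiter; all others form a constant list. -/
theorem primrec_transducer (A : TileSystem) : Primrec A.transducer := by
  have : Primrec fun x : List ℕ => (A.transducer x).rules := by
    refine Primrec.list_cons.comp ?_ (Primrec.list_append.comp
      (Primrec.list_map (Primrec.list_range.comp Primrec.list_length) ?_) (Primrec.const _))
    · exact (Primrec.const _).pair ((Primrec.const _).pair (Primrec.id.pair (Primrec.const _)))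
    · exact (Primrec.const _).pair ((Primrec.const _).pair
        ((Primrec.list_take.comp (Primrec.succ.comp Primrec.snd) Primrec.fst).pair
          (Primrec.const _)))
  exact (Primrec.of_equiv_symm (e := TwoWayTransducer.equiv)).comp
    (g := fun x : List ℕ => ((A.transducer x).rules, [13], [12]))
    (Primrec.pair this (Primrec.const _))

end TileSystem

namespace TileSystem

open TwoWayTransducer

variable {A : TileSystem} {q q' p : ℕ} {a : TapeSym} {d : Dir} {o u v w x y z s : List ℕ} {i : ℕ}

theorem isTileWord_cons : A.IsTileWord (i :: w) ↔ i < A.tiles.length ∧ A.IsTileWord w := by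
  simp [IsTileWord]

theorem f_cons {g f : List ℕ} (h : A.tiles[i]? = some (g, f)) : A.f (i :: w) = f ++ A.f w := by
  simp [TileSystem.f, h]

theorem g_cons {g f : List ℕ} (h : A.tiles[i]? = some (g, f)) : A.g (i :: w) = g ++ A.g w := by
  simp [TileSystem.g, h]

theorem exists_getElem? (h : i < A.tiles.length) : ∃ g f, A.tiles[i]? = some (g, f) :=
  ⟨_, _, List.getElem?_eq_getElem h⟩

/-- The input word `w · 0 · z`. -/
def code (w z : List ℕ) : List ℕ := w.map (· + 1) ++ 0 :: z

theorem code_cons : code (i :: w) z = (i + 1) :: code w z := rfl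

theorem append_zero_inj {u u' v v' : List ℕ} (h : u ++ 0 :: v = u' ++ 0 :: v') (hu : 0 ∉ u)
    (hu' : 0 ∉ u') : u = u' ∧ v = v' := by
  induction u generalizing u' with
  | nil =>
    cases u' with
    | nil => simpa using h
    | cons b u' =>
      simp only [List.nil_append, List.cons_append, List.cons.injEq] at h
      simp [← h.1] at hu'
  | cons b u ih =>
    cases u' with
    | nil =>
      simp only [List.nil_append, List.cons_append, List.cons.injEq] at h
      simp [h.1] at hu
    | cons c u' =>
      simp only [List.cons_append, List.cons.injEq] at h
      rw [List.mem_cons, not_or] at hu hu'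
      obtain ⟨rfl, rfl⟩ := ih h.2 hu.2 hu'.2
      exact ⟨by rw [h.1], rfl⟩

theorem code_injective {w w' z z' : List ℕ} (h : code w z = code w' z') : w = w' ∧ z = z' := by
  obtain ⟨h₁, h₂⟩ := append_zero_inj h (by simp) (by simp)
  exact ⟨List.map_injective_iff.2 (add_left_injective 1) h₁, h₂⟩

/-! #### The outputs of the one-way runs -/

/-- The words that are to be produced from a state when the rest of the other word is `z`. -/
def Differs (q : ℕ) (z u : List ℕ) : Prop :=
  (q = 0 ∧ u.length < z.length) ∨ (q = 1 ∧ u.length ≤ z.length) ∨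
  (q = 2 ∧ z.length < u.length) ∨ (q = 3 ∧ z.length ≤ u.length) ∨
  (q = 4 ∧ u.length = z.length ∧ u ≠ z) ∨ (q = 5 ∧ u.length = z.length)

namespace Produces

variable {C : ℕ} {g z : List ℕ}

theorem zero_zero (h : z.length = g.length) : Produces C 0 g z 0 := .inl ⟨rfl, rfl, h⟩

theorem zero_one (h : z.length < g.length) : Produces C 0 g z 1 := .inr (.inl ⟨rfl, rfl, h⟩)

theorem one_one (h : z.length ≤ g.length) : Produces C 1 g z 1 :=
  .inr (.inr (.inl ⟨rfl, rfl, h⟩))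

theorem two_two (h : z.length = g.length) : Produces C 2 g z 2 :=
  .inr (.inr (.inr (.inl ⟨rfl, rfl, h⟩)))

theorem two_three (h : g.length < z.length) (h' : z.length ≤ C) : Produces C 2 g z 3 :=
  .inr (.inr (.inr (.inr (.inl ⟨rfl, rfl, h, h'⟩))))

theorem three_three (h : g.length ≤ z.length) (h' : z.length ≤ C) : Produces C 3 g z 3 :=
  .inr (.inr (.inr (.inr (.inr (.inl ⟨rfl, rfl, h, h'⟩)))))

end Produces

theorem Produces.differs_append {C : ℕ} {g : List ℕ} (h : Produces C q g z q')
    (h' : Differs q' s u) : Differs q (g ++ s) (z ++ u) := by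
  unfold Differs at *
  simp only [List.length_append]
  rcases h with h | h | h | h | h | h | ⟨rfl, rfl, rfl⟩ | ⟨rfl, rfl, h, hne⟩ | h
  case inr.inr.inr.inr.inr.inr.inl => simpa using h'
  case inr.inr.inr.inr.inr.inr.inr.inl =>
    have h' : u.length = s.length := by omega
    have : z ++ u ≠ g ++ s := fun e => hne (List.append_inj e h).1
    simp [h, h', this]
  all_goals omega

theorem Produces.differs {C : ℕ} {g : List ℕ} (h : Produces C q g z q')
    (hq : q' = 1 ∨ q' = 3 ∨ q' = 5) : Differs q g z := by
  have := h.differs_append (s := []) (u := []) (by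
    simp only [Differs, List.length_nil, le_refl, and_true]
    omega)
  simpa using this

theorem differs_of_pass {x' : List TapeSym} (hq : q < 6)
    (h : (A.transducer x).Pass q ((code w z).map .letter ++ x') o p) :
    ∃ u v, o = u ++ 0 :: v ∧ A.IsWord u ∧ Differs q (A.g w ++ A.last) u := by
  induction w generalizing q o with
  | nil =>
    simp only [code, List.map_nil, List.nil_append, List.map_cons, List.cons_append, pass_cons_iff,
      mem_rules_letter] at h
    obtain ⟨v₁, v₂, q', rfl, h, -⟩ := h
    cases h with
    | produceLast hz h hq' => 
      exact ⟨_, v₂, by simp, hz, by simpa [g] using h.differs hq'⟩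
    | _ => omega
  | cons i w ih =>
    simp only [code_cons, List.map_cons, List.cons_append, pass_cons_iff, mem_rules_letter] at h
    obtain ⟨v₁, v₂, q', rfl, h, h'⟩ := h
    cases h with
    | produce ht hz h =>
      obtain ⟨u, v, rfl, hu, hd⟩ := ih (h.bounds (length_of_getElem? ht).1).2.1 h'
      refine ⟨v₁ ++ u, v, by simp, ?_, ?_⟩
      · intro a ha
        exact (List.mem_append.1 ha).elim (hz a) (hu a)
      · rw [g_cons ht, List.append_assoc]
        exact h.differs_append hd
    | _ => omega

theorem mem_of_pass {R : ℕ → Prop} {x' : List TapeSym} (hR : ∀ q a v q', R q → a ∈ x' →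
    (q, a, v, q', .right) ∈ (A.transducer x).rules → R q') (hq : R q)
    (h : (A.transducer x).Pass q x' v p) : R p := by
  induction h with
  | nil => exact hq
  | cons hr _ ih =>
    exact ih (fun q a v q' h ha => hR q a v q' h (by simp [ha])) (hR _ _ _ _ hq (by simp) hr)

theorem zero_not_mem (hu : A.IsWord u) : 0 ∉ u := fun h => by simpa using (hu 0 h).1

/-- The outputs of one-way runs do not start with `g w · y`. -/
theorem ne_of_pass (hx : A.IsWord x) (hu : A.IsWord u)
    (h : (A.transducer x).Pass 13 (tape (code w z)) (u ++ 0 :: v) 12) : u ≠ A.g w ++ A.last := by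
  rintro rfl
  rw [tape, pass_cons_iff] at h
  simp only [mem_rules_leftEnd] at h
  obtain ⟨v₁, v₂, q', ho, ⟨-, h⟩, hp⟩ := h
  have hdiff : q' < 6 → ∃ u' v', v₂ = u' ++ 0 :: v' ∧ A.IsWord u' ∧
      Differs q' (A.g w ++ A.last) u' := fun hq => differs_of_pass hq hp
  obtain ⟨rfl, rfl⟩ | ⟨t, ht, rfl, rfl⟩ | ⟨rfl, hq⟩ : (v₁ = x ∧ q' = 7) ∨
      (∃ t < x.length, v₁ = x.take (t + 1) ∧ q' = 3) ∨
      (v₁ = [] ∧ (q' = 0 ∨ q' = 2 ∨ q' = 4)) := by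
    rcases h with ⟨-, h⟩ | ⟨h, -⟩
    · exact h
    · omega
  -- Right moves never leave the states `7` and `8`, so a run through them cannot be a single pass.
  · have : 12 = 7 ∨ 12 = 8 := by
      refine mem_of_pass (R := fun q => q = 7 ∨ q = 8) ?_ (.inl rfl) hp
      intro q a v q' hq ha hr
      cases a with
      | leftEnd => simp at ha
      | rightEnd => rw [mem_rules_rightEnd] at hr; simp at hr; omega
      | letter a =>
        rw [mem_rules_letter] at hr
        cases hr with
        | produce ht _ h => have := h.bounds (length_of_getElem? ht).1; omega
        | produceLast _ h => have := h.bounds A.length_last; omega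
        | _ => omega
    omega
  -- State `3` only ensures a word at least as long as `g w · y`; the non-empty prefix of `x`
  -- written before makes the output strictly longer.
  · obtain ⟨u', v', rfl, hu', hd⟩ := hdiff (by omega)
    rw [← List.append_assoc] at ho
    obtain ⟨h₁, -⟩ := append_zero_inj ho (zero_not_mem hu) (by
      rw [List.mem_append, not_or]
      exact ⟨fun h => zero_not_mem hx (List.mem_of_mem_take h), zero_not_mem hu'⟩)
    have h₁ := congrArg List.length h₁
    simp only [List.length_append, List.length_take] at h₁
    simp only [Differs, List.length_append] at hd
    omega
  · obtain ⟨u', v', rfl, hu', hd⟩ := hdiff (by omega)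
    obtain ⟨rfl, -⟩ := append_zero_inj ho (zero_not_mem hu) (zero_not_mem hu')
    rcases hq with rfl | rfl | rfl <;> simp [Differs] at hd

/-! #### The one-way runs produce all words that differ from `g w · y` -/

theorem pass_letter_cons {x' : List TapeSym} (h : A.BaseRule q (.letter i) z q' .right)
    (h' : (A.transducer x).Pass q' x' u p) :
    (A.transducer x).Pass q (.letter i :: x') (z ++ u) p :=
  .cons (mem_rules_letter.2 h) h'

theorem pass_guess (hz : ∀ a ∈ z, a < 2) (hv : ∀ a ∈ v, a < 2) (h : v.length = 2 * z.length) :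
    (A.transducer x).Pass 6 (z.map .letter ++ [.rightEnd]) v 12 := by
  induction z generalizing v with
  | nil =>
    obtain rfl : v = [] := List.length_eq_zero_iff.1 (by simpa using h)
    exact Pass.cons (v := []) (mem_rules_rightEnd.2 (by simp)) (.nil 12)
  | cons a z ih =>
    match v, h, hv with
    | b :: c :: v, h, hv =>
      simp only [List.length_cons] at h
      simp only [List.mem_cons, forall_eq_or_imp] at hz hv
      exact pass_letter_cons (.guess hz.1 hv.1 hv.2.1) (ih hz.2 hv.2.2 (by omega))

/-- The runs that read a tile word and the separator. -/
abbrev Produced (A : TileSystem) (x : List ℕ) (q : ℕ) (w u : List ℕ) : Prop :=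
  ∀ x' v p, (A.transducer x).Pass 6 x' v p →
    (A.transducer x).Pass q ((w.map (· + 1) ++ [0]).map .letter ++ x') (u ++ 0 :: v) p

theorem produced_nil (hu : A.IsWord u) (h : Produces A.bound q A.last u q')
    (hq : q' = 1 ∨ q' = 3 ∨ q' = 5) : A.Produced x q [] u := by
  intro x' v p hp
  have := pass_letter_cons (.produceLast hu h hq) hp
  simpa using this

theorem produced_cons {g f : List ℕ} (ht : A.tiles[i]? = some (g, f)) (hu : A.IsWord u)
    (h : Produces A.bound q g u q') (h' : A.Produced x q' w v) : A.Produced x q (i :: w) (u ++ v) := by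
  intro x' v' p hp
  have := pass_letter_cons (.produce ht hu h) (h' x' v' p hp)
  simpa using this

theorem IsWord.split (hu : A.IsWord u) {n : ℕ} (h : n ≤ u.length) : ∃ u₁ u₂, u = u₁ ++ u₂ ∧
    A.IsWord u₁ ∧ A.IsWord u₂ ∧ u₁.length = n := by
  refine ⟨u.take n, u.drop n, (List.take_append_drop n u).symm,
    fun a ha => hu a (List.mem_of_mem_take ha), fun a ha => hu a (List.mem_of_mem_drop ha), ?_⟩
  simpa using h

/-- The word is distributed greedily: each tile takes as many letters as its `g`-image has, as long
as there are any left. -/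
theorem produced_short (hw : A.IsTileWord w) (hu : A.IsWord u) :
    (u.length < (A.g w ++ A.last).length → A.Produced x 0 w u) ∧
    (u.length ≤ (A.g w ++ A.last).length → A.Produced x 1 w u) := by
  induction w generalizing u with
  | nil =>
    simp only [TileSystem.g, List.flatMap_nil, List.nil_append]
    exact ⟨fun h => produced_nil hu (.zero_one h) (by omega),
      fun h => produced_nil hu (.one_one h) (by omega)⟩
  | cons i w ih =>
    rw [isTileWord_cons] at hw
    obtain ⟨g, f, ht⟩ := exists_getElem? hw.1
    have ih := fun {u} hu => ih (u := u) hw.2 hu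
    simp only [g_cons ht, List.length_append] at ih ⊢
    obtain ⟨u₁, u₂, rfl, hu₁, hu₂, h₁⟩ := IsWord.split hu (n := min g.length u.length) (by omega)
    simp only [List.length_append] at h₁ ⊢
    refine ⟨fun h => ?_, fun h => ?_⟩
    · by_cases hlt : u₁.length < g.length
      · exact produced_cons ht hu₁ (.zero_one hlt) ((ih hu₂).2 (by omega))
      · exact produced_cons ht hu₁ (.zero_zero (by omega)) ((ih hu₂).1 (by omega))
    · exact produced_cons ht hu₁ (.one_one (by omega)) ((ih hu₂).2 (by omega))

theorem length_g_le (hw : A.IsTileWord w) : (A.g w ++ A.last).length ≤ A.bound * (w.length + 1) := by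
  induction w with
  | nil => simpa [TileSystem.g] using A.length_last
  | cons i w ih =>
    rw [isTileWord_cons] at hw
    obtain ⟨g, f, ht⟩ := exists_getElem? hw.1
    have := ih hw.2
    have := (length_of_getElem? ht).1
    simp only [g_cons ht, List.length_append, List.length_cons, mul_add] at *
    omega

theorem length_f_le (hw : A.IsTileWord w) : (A.f w).length ≤ A.bound * w.length := by
  induction w with
  | nil => simp [TileSystem.f]
  | cons i w ih =>
    rw [isTileWord_cons] at hw
    obtain ⟨g, f, ht⟩ := exists_getElem? hw.1
    have := ih hw.2
    have := (length_of_getElem? ht).2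
    simp only [f_cons ht, List.length_append, List.length_cons, mul_add] at *
    omega

theorem produced_long (hw : A.IsTileWord w) (hu : A.IsWord u)
    (h : u.length ≤ A.bound * (w.length + 1)) :
    ((A.g w ++ A.last).length < u.length → A.Produced x 2 w u) ∧
    ((A.g w ++ A.last).length ≤ u.length → A.Produced x 3 w u) := by
  induction w generalizing u with
  | nil =>
    simp only [TileSystem.g, List.flatMap_nil, List.nil_append]
    simp only [List.length_nil, zero_add, mul_one] at h
    exact ⟨fun hl => produced_nil hu (.two_three hl h) (by omega),
      fun hl => produced_nil hu (.three_three hl h) (by omega)⟩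
  | cons i w ih =>
    rw [isTileWord_cons] at hw
    obtain ⟨g, f, ht⟩ := exists_getElem? hw.1
    have ih := fun {u} hu h => ih (u := u) hw.2 hu h
    have hC := (length_of_getElem? ht).1
    have hl := length_g_le hw.2
    simp only [g_cons ht, List.length_append, List.length_cons, mul_add] at h hl ih ⊢
    generalize A.bound * w.length = B at *
    by_cases hgu : g.length + ((A.g w).length + A.last.length) ≤ u.length
    · obtain ⟨u₁, u₂, rfl, hu₁, hu₂, h₁⟩ := IsWord.split hu
        (n := max g.length (u.length - (B + A.bound))) (by omega)
      simp only [List.length_append] at h h₁ hgu ⊢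
      refine ⟨fun h => ?_, fun h => ?_⟩
      · by_cases hlt : g.length < u₁.length
        · exact produced_cons ht hu₁ (.two_three hlt (by omega))
            ((ih hu₂ (by omega)).2 (by omega))
        · exact produced_cons ht hu₁ (.two_two (by omega))
            ((ih hu₂ (by omega)).1 (by omega))
      · exact produced_cons ht hu₁ (.three_three (by omega) (by omega))
            ((ih hu₂ (by omega)).2 (by omega))
    · exact ⟨fun h => by omega, fun h => by omega⟩

theorem produced_different (hw : A.IsTileWord w) (hu : A.IsWord u)
    (h : u.length = (A.g w ++ A.last).length) :
    (u ≠ A.g w ++ A.last → A.Produced x 4 w u) ∧ A.Produced x 5 w u := by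
  induction w generalizing u with
  | nil =>
    simp only [TileSystem.g, List.flatMap_nil, List.nil_append] at h ⊢
    refine ⟨fun hne => produced_nil hu (q' := 5) ?_ (by omega),
      produced_nil hu (q' := 5) ?_ (by omega)⟩
    · unfold Produces; simp [h, hne]
    · unfold Produces; simp [h]
  | cons i w ih =>
    rw [isTileWord_cons] at hw
    obtain ⟨g, f, ht⟩ := exists_getElem? hw.1
    have ih := fun {u} hu h => ih (u := u) hw.2 hu h
    simp only [g_cons ht, List.append_assoc] at h ih ⊢
    rw [List.length_append] at h
    obtain ⟨u₁, u₂, rfl, hu₁, hu₂, h₁⟩ := IsWord.split hu (n := g.length) (by omega)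
    rw [List.length_append] at h
    refine ⟨fun hne => ?_, ?_⟩
    · by_cases he : u₁ = g
      · subst he
        exact produced_cons ht hu₁ (q' := 4) (by unfold Produces; simp)
          ((ih hu₂ (by omega)).1 (by simpa using hne))
      · exact produced_cons ht hu₁ (q' := 5) (by unfold Produces; simp [he, h₁])
          (ih hu₂ (by omega)).2
    · exact produced_cons ht hu₁ (q' := 5) (by unfold Produces; simp [h₁]) (ih hu₂ (by omega)).2

theorem isWord_f : A.IsWord (A.f w) := by
  intro a ha
  obtain ⟨i, -, h⟩ := List.mem_flatMap.1 ha
  by_cases hi : i < A.tiles.length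
  · obtain ⟨g, f, ht⟩ := exists_getElem? hi
    simp only [List.getD_eq_getElem?_getD, ht, Option.getD_some] at h
    exact (isWord_of_getElem? ht).2 a h
  · simp [List.getElem?_eq_none (Nat.le_of_not_lt hi)] at h

/-- If `x · f w ≠ g w · y` then the one-way runs output all words `x · f w · 0 · v`. -/
theorem pass_of_ne (hx : A.IsWord x) (hw : A.IsTileWord w) (hne : x ++ A.f w ≠ A.g w ++ A.last)
    (hz : ∀ a ∈ z, a < 2) (hv : ∀ a ∈ v, a < 2) (h : v.length = 2 * z.length) :
    (A.transducer x).Pass 13 (tape (code w z)) ((x ++ A.f w) ++ 0 :: v) 12 := by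
  have hF : A.IsWord (x ++ A.f w) := fun a ha =>
    (List.mem_append.1 ha).elim (hx a) (isWord_f a)
  have key : ∀ {q u₁ u₂}, x ++ A.f w = u₁ ++ u₂ → A.Produced x q w u₂ →
      (13, .leftEnd, u₁, q, .right) ∈ (A.transducer x).rules →
      (A.transducer x).Pass 13 (tape (code w z)) ((x ++ A.f w) ++ 0 :: v) 12 := by
    intro q u₁ u₂ he hp hr
    have := Pass.cons hr (hp _ _ _ (pass_guess hz hv h))
    simpa [he, tape, code] using this
  rcases lt_trichotomy (x ++ A.f w).length (A.g w ++ A.last).length with hlt | heq | hgt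
  · exact key rfl ((produced_short hw hF).1 hlt) (mem_rules_leftEnd.2 (by simp))
      (u₁ := [])
  · exact key rfl ((produced_different hw hF heq).1 hne) (mem_rules_leftEnd.2 (by simp))
      (u₁ := [])
  · by_cases hl : (x ++ A.f w).length ≤ A.bound * (w.length + 1)
    · exact key rfl ((produced_long hw hF hl).1 hgt) (mem_rules_leftEnd.2 (by simp))
        (u₁ := [])
    -- The word is too long to be written letter by letter along `w · 0`. As `f w` alone would fit,
    -- the excess is at most `|x|` and is written on the left delimiter as a non-empty prefix of
    -- `x`. What remains has exactly the maximal length, so it is at least as long as `g w · y`, and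
    -- state `3` applies.
    · have hg := length_g_le hw
      have hf := length_f_le hw
      simp only [List.length_append, mul_add, mul_one] at hl hg
      obtain ⟨t, ht⟩ : ∃ t, x.length + (A.f w).length = A.bound * w.length + A.bound + (t + 1) :=
        ⟨x.length + (A.f w).length - (A.bound * w.length + A.bound) - 1, by omega⟩
      have ht' : t < x.length := by omega
      have hd : (x.drop (t + 1) ++ A.f w).length = A.bound * (w.length + 1) := by
        simp only [List.length_append, List.length_drop, mul_add]
        omega
      have hF' : A.IsWord (x.drop (t + 1) ++ A.f w) := fun a ha =>
        (List.mem_append.1 ha).elim (fun h => hx a (List.mem_of_mem_drop h)) (isWord_f a)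
      refine key (u₁ := x.take (t + 1)) ?_ ((produced_long hw hF' hd.le).2 ?_)
        (mem_rules_leftEnd.2 ⟨rfl, .inl ⟨rfl, .inr (.inl ⟨t, ht', rfl, rfl⟩)⟩⟩)
      · rw [← List.append_assoc, List.take_append_drop]
      · rw [hd]
        exact length_g_le hw

end TileSystem

theorem TwoWayTransducer.Pass.rel {T : TwoWayTransducer} {L : ℕ → Prop} (hT : T.Structured L) {q p : ℕ}
    (hq : q ∈ T.initial) (hp : p ∈ T.final) {y v : List ℕ} (h : T.Pass q (tape y) v p) :
    (y, v) ∈ T.rel := by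
  rw [hT.mem_rel_iff]
  refine ⟨q, hq, p, hp, ?_⟩
  have : ∀ {x q v}, T.Pass q (x ++ [.rightEnd]) v p → T.Sweeps y q x v p := by
    intro x
    induction x with
    | nil =>
      intro q v h
      obtain ⟨v₁, v₂, q', rfl, hr, h⟩ := pass_cons_iff.1 h
      obtain ⟨rfl, rfl⟩ := pass_nil_iff.1 h
      rw [List.append_nil]
      exact .exit hr
    | cons a x ih =>
      intro q v h
      obtain ⟨v₁, v₂, q', rfl, hr, h⟩ := pass_cons_iff.1 h
      exact .read hr (ih h)
  exact this h

/-! ### Runs with two sweeps, and one-way definability in terms of word equations -/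

namespace TileSystem

open TwoWayTransducer

variable {A : TileSystem} {q q' p : ℕ} {a : TapeSym} {d : Dir} {o u v w x y z s : List ℕ} {i : ℕ}

/-- The states below `7` are closed under the rules for letters and have no left rule on the right
delimiter. -/
theorem pass_of_sweeps {x' : List TapeSym} (h : (A.transducer x).Sweeps y q x' v p) (hq : q < 7)
    (hx : ∀ b ∈ x', ∃ i, .letter i = b) : (A.transducer x).Pass q (x' ++ [.rightEnd]) v p := by
  induction h with
  | @exit q _ v hr => simpa using Pass.cons hr (.nil _)
  | @read q q' _ a x' _ _ hr _ ih =>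
    refine .cons hr (ih ?_ fun b hb => hx b (by simp [hb]))
    obtain ⟨i, rfl⟩ := hx a (by simp)
    clear ih hx
    rw [mem_rules_letter] at hr
    cases hr with
    | produce ht _ h => have := h.bounds (length_of_getElem? ht).1; omega
    | produceLast _ h => have := h.bounds A.length_last; omega
    | _ => omega
  | bounce hr =>
    rw [mem_rules_rightEnd] at hr
    simp at hr
    omega

theorem sweeps_copy (h : (A.transducer x).Sweeps y 8 (z.map .letter) v p) :
    (∀ a ∈ z, a < 2) ∧ ∃ v', v = z ++ v' ∧ (A.transducer x).Sweeps y 9 (openTape y) v' p := by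
  induction z generalizing v with
  | nil =>
    rw [List.map_nil, sweeps_nil_iff] at h
    simp only [mem_rules_rightEnd] at h
    rcases h with h | ⟨v₁, v₂, l, rfl, h, -, h'⟩
    · simp at h
    · obtain ⟨rfl, rfl⟩ : v₁ = [] ∧ l = 9 := by simpa using h
      exact ⟨by simp, v₂, rfl, h'⟩
  | cons a z ih =>
    rw [List.map_cons, sweeps_cons_iff] at h
    simp only [mem_rules_letter] at h
    obtain ⟨v₁, v₂, q', rfl, h, h'⟩ := h
    cases h with
    | copy ha =>
      obtain ⟨h₁, v', rfl, h₂⟩ := ih h'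
      exact ⟨by simp only [List.mem_cons, forall_eq_or_imp]; exact ⟨ha, h₁⟩, v', by simp, h₂⟩
    | produce ht _ h => have := h.bounds (length_of_getElem? ht).1; omega
    | produceLast _ h => have := h.bounds A.length_last; omega

theorem sweeps_image (h : (A.transducer x).Sweeps y 7 (s.map .letter) v p) :
    ∃ w z v', s = code w z ∧ A.IsTileWord w ∧ v = A.f w ++ 0 :: (z ++ v') ∧ (∀ a ∈ z, a < 2) ∧
      (A.transducer x).Sweeps y 9 (openTape y) v' p := by
  induction s generalizing v with
  | nil =>
    rw [List.map_nil, sweeps_nil_iff] at h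
    simp only [mem_rules_rightEnd] at h
    rcases h with h | ⟨v₁, v₂, l, rfl, h, -, h'⟩ <;> simp at h
  | cons a s ih =>
    rw [List.map_cons, sweeps_cons_iff] at h
    simp only [mem_rules_letter] at h
    obtain ⟨v₁, v₂, q', rfl, h, h'⟩ := h
    cases h with
    | image ht =>
      obtain ⟨w, z, v', rfl, hw, rfl, hz, h⟩ := ih h'
      refine ⟨_ :: w, z, v', rfl, isTileWord_cons.2 ⟨(List.getElem?_eq_some_iff.1 ht).1, hw⟩, ?_, hz, h⟩
      simp [f_cons ht]
    | imageEnd =>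
      obtain ⟨hz, v', rfl, h⟩ := sweeps_copy h'
      exact ⟨[], s, v', rfl, by simp [IsTileWord], by simp [TileSystem.f], hz, h⟩
    | produce ht _ h => have := h.bounds (length_of_getElem? ht).1; omega
    | produceLast _ h => have := h.bounds A.length_last; omega

theorem sweeps_copyAgain_iff (hz : ∀ a ∈ z, a < 2) :
    (A.transducer x).Sweeps y 11 (z.map .letter) v p ↔ p = 12 ∧ v = z := by
  induction z generalizing v with
  | nil =>
    rw [List.map_nil, sweeps_nil_iff]
    simp [mem_rules_rightEnd, and_comm]
  | cons a z ih =>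
    simp only [List.mem_cons, forall_eq_or_imp] at hz
    rw [List.map_cons, sweeps_cons_iff]
    simp only [mem_rules_letter]
    constructor
    · rintro ⟨v₁, v₂, q', rfl, h, h'⟩
      cases h with
      | copyAgain ha =>
        obtain ⟨rfl, rfl⟩ := (ih hz.2).1 h'
        simp
      | produce ht _ h => have := h.bounds (length_of_getElem? ht).1; omega
      | produceLast _ h => have := h.bounds A.length_last; omega
    · rintro ⟨rfl, rfl⟩
      exact ⟨[a], z, 11, rfl, .copyAgain hz.1, (ih hz.2).2 ⟨rfl, rfl⟩⟩

theorem sweeps_skip_iff (hw : A.IsTileWord w) (hz : ∀ a ∈ z, a < 2) :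
    (A.transducer x).Sweeps y 10 ((code w z).map .letter) v p ↔ p = 12 ∧ v = z := by
  induction w generalizing v with
  | nil =>
    simp only [code, List.map_nil, List.nil_append, List.map_cons, sweeps_cons_iff, mem_rules_letter]
    constructor
    · rintro ⟨v₁, v₂, q', rfl, h, h'⟩
      cases h with
      | skipEnd => exact (sweeps_copyAgain_iff hz).1 h'
      | produceLast _ h => have := h.bounds A.length_last; omega
    · intro h
      exact ⟨[], v, 11, rfl, .skipEnd, (sweeps_copyAgain_iff hz).2 h⟩
  | cons i w ih =>
    rw [isTileWord_cons] at hw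
    simp only [code_cons, List.map_cons, sweeps_cons_iff, mem_rules_letter]
    constructor
    · rintro ⟨v₁, v₂, q', rfl, h, h'⟩
      cases h with
      | skip => exact (ih hw.2).1 h'
      | produce ht _ h => have := h.bounds (length_of_getElem? ht).1; omega
    · intro h
      exact ⟨[], v, 10, rfl, .skip hw.1, (ih hw.2).2 h⟩

theorem sweeps_restart_iff (hw : A.IsTileWord w) (hz : ∀ a ∈ z, a < 2) :
    (A.transducer x).Sweeps y 9 (openTape (code w z)) v p ↔ p = 12 ∧ v = z := by
  simp only [openTape, sweeps_cons_iff, mem_rules_leftEnd]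
  constructor
  · rintro ⟨v₁, v₂, q', rfl, ⟨-, ⟨h, -⟩ | ⟨-, rfl, rfl⟩⟩, h'⟩
    · omega
    · exact (sweeps_skip_iff hw hz).1 h'
  · intro h
    exact ⟨[], v, 10, rfl, by simp, (sweeps_skip_iff hw hz).2 h⟩

theorem pass_copy (hz : ∀ a ∈ z, a < 2) :
    (A.transducer x).Pass 8 (z.map .letter) z 8 := by
  induction z with
  | nil => exact .nil _
  | cons a z ih =>
    simp only [List.mem_cons, forall_eq_or_imp] at hz
    exact pass_letter_cons (.copy hz.1) (ih hz.2)

theorem pass_image (hw : A.IsTileWord w) (hz : ∀ a ∈ z, a < 2) :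
    (A.transducer x).Pass 7 ((code w z).map .letter) (A.f w ++ 0 :: z) 8 := by
  induction w with
  | nil =>
    exact pass_letter_cons (z := [0]) .imageEnd (pass_copy hz)
  | cons i w ih =>
    rw [isTileWord_cons] at hw
    obtain ⟨g, f, ht⟩ := exists_getElem? hw.1
    rw [f_cons ht, List.append_assoc]
    exact pass_letter_cons (.image ht) (ih hw.2)

theorem mem_rel_of_eq (hw : A.IsTileWord w) (hz : ∀ a ∈ z, a < 2) :
    (code w z, (x ++ A.f w) ++ 0 :: (z ++ z)) ∈ (A.transducer x).rel := by
  rw [structured_transducer.mem_rel_iff]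
  refine ⟨13, by simp [transducer], 12, by simp [transducer], ?_⟩
  rw [List.append_assoc]
  refine .read (q' := 7) (mem_rules_leftEnd.2 (by simp)) ?_
  rw [← List.append_nil (List.map _ _), sweeps_append_iff]
  refine ⟨A.f w ++ 0 :: z, z, 8, by simp, pass_image hw hz, ?_⟩
  refine .bounce (v := []) (mem_rules_rightEnd.2 (.inr ⟨rfl, rfl, rfl, rfl⟩)) ?_
    ((sweeps_restart_iff hw hz).2 ⟨rfl, rfl⟩)
  intro a ha
  refine mem_rules_letter.2 (.back ?_)
  simp only [code, List.mem_append, List.mem_map, List.mem_cons] at ha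
  rcases ha with ⟨i, hi, rfl⟩ | rfl | ha
  · have := hw i hi; omega
  · omega
  · have := hz a ha; omega

/-- The first rule decides: either the run never turns, or it enters state `7`, and then its two
sweeps and its output are forced. -/
theorem pass_or_eq_of_mem_rel (h : (y, v) ∈ (A.transducer x).rel) :
    (A.transducer x).Pass 13 (tape y) v 12 ∨ ∃ w z, A.IsTileWord w ∧ (∀ a ∈ z, a < 2) ∧
      y = code w z ∧ v = (x ++ A.f w) ++ 0 :: (z ++ z) := by
  obtain ⟨q, hq, p, hp, h⟩ := structured_transducer.mem_rel_iff.1 h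
  obtain rfl : q = 13 := by simpa [transducer] using hq
  obtain rfl : p = 12 := by simpa [transducer] using hp
  rw [openTape, sweeps_cons_iff] at h
  obtain ⟨v₁, v₂, q', rfl, hr, h⟩ := h
  by_cases hq : q' < 7
  · exact .inl (.cons hr (pass_of_sweeps h hq (by simp)))
  · simp only [mem_rules_leftEnd] at hr
    obtain ⟨rfl, rfl⟩ : v₁ = x ∧ q' = 7 := by
      rcases hr with ⟨-, ⟨-, h | ⟨t, -, -, h⟩ | ⟨-, h⟩⟩ | ⟨h, -⟩⟩
      · exact h
      all_goals omega
    obtain ⟨w, z, v', rfl, hw, rfl, hz, h⟩ := sweeps_image h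
    obtain ⟨-, h⟩ := (sweeps_restart_iff hw hz).1 h
    subst h
    exact .inr ⟨w, _, hw, hz, rfl, by simp⟩

/-- The right rules of the transducer. -/
noncomputable def oneWayPart (A : TileSystem) (x : List ℕ) : TwoWayTransducer where
  rules := (A.transducer x).rules.filter fun r => match r.2.2.2.2 with
    | .left => false
    | .right => true
  initial := [13]
  final := [12]

theorem mem_rules_oneWayPart : (q, a, v, q', d) ∈ (A.oneWayPart x).rules ↔
    (q, a, v, q', d) ∈ (A.transducer x).rules ∧ d = .right := by
  rw [oneWayPart, List.mem_filter]
  cases d <;> simp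

theorem isOneWay_oneWayPart : (A.oneWayPart x).IsOneWay :=
  fun _ _ _ _ _ h => (mem_rules_oneWayPart.1 h).2

theorem pass_oneWayPart {x' : List TapeSym} :
    (A.oneWayPart x).Pass q x' v p ↔ (A.transducer x).Pass q x' v p := by
  induction x' generalizing q v with
  | nil => simp only [pass_nil_iff]
  | cons a x' ih => simp only [pass_cons_iff, ih, mem_rules_oneWayPart, and_true]

theorem mem_rel_oneWayPart : (y, v) ∈ (A.oneWayPart x).rel ↔
    (A.transducer x).Pass 13 (tape y) v 12 := by
  constructor
  · intro h
    obtain ⟨q, hq, p, hp, h⟩ := isOneWay_oneWayPart.structured.mem_rel_iff.1 h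
    obtain rfl : q = 13 := by simpa [oneWayPart] using hq
    obtain rfl : p = 12 := by simpa [oneWayPart] using hp
    rw [← pass_oneWayPart]
    have : ∀ {q x' v}, (A.oneWayPart x).Sweeps y q x' v 12 →
        (A.oneWayPart x).Pass q (x' ++ [.rightEnd]) v 12 := by
      intro q x' v h
      generalize 12 = p at h
      induction h with
      | exit hr => simpa using Pass.cons hr (.nil _)
      | read hr _ ih => exact .cons hr ih
      | bounce hr => cases isOneWay_oneWayPart _ _ _ _ _ hr
    exact this h
  · intro h
    exact (pass_oneWayPart.2 h).rel isOneWay_oneWayPart.structured (by simp [oneWayPart])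
      (by simp [oneWayPart])

/-- The equation `x · f w = g w · y` has a solution. -/
def Solvable (A : TileSystem) (x : List ℕ) : Prop :=
  ∃ w, A.IsTileWord w ∧ x ++ A.f w = A.g w ++ A.last

/-- An output `x · f w · 0 · z · z` has a first part different from `g w · y` and a second part of
length `2|z|`, so a pass to the right produces it as well. -/
theorem epsFreeOneWayDefinable_of_not_solvable (hx : A.IsWord x) (h : ¬ A.Solvable x) :
    (A.transducer x).EpsFreeOneWayDefinable := by
  refine ⟨A.oneWayPart x, isOneWay_oneWayPart, ?_⟩
  ext ⟨y, v⟩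
  rw [mem_rel_oneWayPart]
  constructor
  · exact fun h => h.rel structured_transducer (by simp [transducer]) (by simp [transducer])
  · intro hr
    rcases pass_or_eq_of_mem_rel hr with hr | ⟨w, z, hw, hz, rfl, rfl⟩
    · exact hr
    · refine pass_of_ne hx hw (fun he => h ⟨w, hw, he⟩) hz (fun a ha => ?_) (by simp; omega)
      exact (List.mem_append.1 ha).elim (hz a) (hz a)

/-- With a solution `w` fixed, one-way runs on `w · 0 · z` cannot write `x · f w · 0` first, since
this is `g w · y · 0`. What remains under these prefixes is the squaring relation. -/
theorem not_oneWayDefinable_of_solvable (hx : A.IsWord x) (h : A.Solvable x) :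
    ¬ (A.transducer x).OneWayDefinable := by
  obtain ⟨w, hw, he⟩ := h
  rintro ⟨T, hT⟩
  have hF : A.IsWord (x ++ A.f w) := fun a ha =>
    (List.mem_append.1 ha).elim (hx a) (isWord_f a)
  refine T.not_squaring (w.map (· + 1) ++ [0]) ((x ++ A.f w) ++ [0]) (fun y hy => ?_)
    fun y v hr => ?_
  · rw [hT]
    simpa [code] using mem_rel_of_eq (x := x) hw hy
  · rw [hT] at hr
    replace hr : (code w y, (x ++ A.f w) ++ 0 :: v) ∈ (A.transducer x).rel := by
      simpa [code] using hr
    rcases pass_or_eq_of_mem_rel hr with hr | ⟨w', z, -, -, h₁, h₂⟩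
    · exact absurd he (ne_of_pass hx hF hr)
    · obtain ⟨rfl, rfl⟩ := code_injective h₁
      exact (append_zero_inj h₂ (zero_not_mem hF) (zero_not_mem hF)).2

/-- On the input `0 · 0` the empty word is too short, and the two letters after the separator are
guessed freely. -/
theorem not_isFunctional : ¬ (A.transducer x).IsFunctional := by
  intro h
  have key : ∀ v : List ℕ, (∀ a ∈ v, a < 2) → v.length = 2 →
      (code [] [0], 0 :: v) ∈ (A.transducer x).rel := by
    intro v hv hl
    have hl' : 0 < A.last.length := List.length_pos_iff.2 A.last_ne_nil
    have := Pass.cons (T := A.transducer x) (q := 13) (q' := 0) (v := []) (mem_rules_leftEnd.2 (by simp))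
      ((produced_short (A := A) (x := x) (w := []) (u := []) (by simp [IsTileWord])
        (by simp [IsWord])).1 (by simpa [TileSystem.g] using hl') _ _ _
        (pass_guess (z := [0]) (by simp) hv (by simpa using hl)))
    exact this.rel structured_transducer (by simp [transducer]) (by simp [transducer])
  have := h _ _ _ (key [0, 0] (by simp) rfl) (key [1, 1] (by simp) rfl)
  simp at this

end TileSystem

/-! ### String rewriting -/

/-- One application of a rule of `R`. -/
def Rewrites {α : Type*} (R : List α → List α → Prop) (u v : List α) : Prop :=
  ∃ a l r b, R l r ∧ u = a ++ l ++ b ∧ v = a ++ r ++ b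

namespace Rewrites

open Relation

variable {α : Type*} {R : List α → List α → Prop} {u v x y : List α}

theorem of_rule (a b : List α) {l r : List α} (h : R l r) : Rewrites R (a ++ l ++ b) (a ++ r ++ b) :=
  ⟨a, l, r, b, h, rfl, rfl⟩

theorem append (h : ReflTransGen (Rewrites R) u v) (a b : List α) :
    ReflTransGen (Rewrites R) (a ++ u ++ b) (a ++ v ++ b) := by
  induction h with
  | refl => exact .refl
  | tail _ h ih =>
    obtain ⟨c, l, r, d, hr, rfl, rfl⟩ := h
    refine ih.tail ?_
    have := of_rule (a ++ c) (d ++ b) hr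
    simpa using this

/-- The pairs of words that can be put side by side in a derivation, `none` being the separator of its
words. -/
inductive IsTile (R : List α → List α → Prop) : List (Option α) × List (Option α) → Prop where
  | separator : IsTile R ([none], [none])
  | copy (a : α) : IsTile R ([some a], [some a])
  | rule {l r : List α} (h : R l r) : IsTile R (l.map some, r.map some)

/-- Without separators, the tiles rewrite disjoint factors of one word, so they can be applied one
after the other. -/
theorem exists_of_tiles {ts : List (List (Option α) × List (Option α))} (h : ∀ t ∈ ts, IsTile R t)
    (h' : ([none], [none]) ∉ ts) : ∃ u v, ts.flatMap Prod.fst = u.map some ∧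
      ts.flatMap Prod.snd = v.map some ∧ ReflTransGen (Rewrites R) u v := by
  induction ts with
  | nil => exact ⟨[], [], rfl, rfl, .refl⟩
  | cons t ts ih =>
    simp only [List.mem_cons, forall_eq_or_imp, not_or] at h h'
    obtain ⟨u, v, hu, hv, huv⟩ := ih h.2 h'.2
    cases h.1 with
    | separator => exact absurd rfl h'.1
    | copy a => exact ⟨a :: u, a :: v, by simp [hu], by simp [hv], by simpa using append huv [a] []⟩
    | @rule l r hr =>
      refine ⟨l ++ u, r ++ v, by simp [hu], by simp [hv], ?_⟩
      have := append huv l []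
      simp only [List.append_nil] at this
      exact this.tail (of_rule [] v hr)

theorem map_some_append_inj {x u : List α} {A B : List (Option α)}
    (h : x.map some ++ none :: A = u.map some ++ none :: B) : x = u ∧ A = B := by
  obtain ⟨h₁, h₂⟩ : x.map some = u.map some ∧ A = B := by
    rcases List.append_eq_append_iff.1 h with ⟨c, hc, hA⟩ | ⟨c, hc, hA⟩ <;> cases c with
    | nil => simp at hc hA; simp [hc, hA]
    | cons b c =>
      injection hA with h₁ h₂
      subst h₁
      have : none ∈ List.map some _ := hc ▸ List.mem_append_right _ (by simp)
      simp at this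
  exact ⟨List.map_injective_iff.2 (Option.some_injective α) h₁, h₂⟩

/-- The equation forces the upper row of tiles to lag one word behind the lower row. Between
consecutive separators, the tiles rewrite one word of a derivation into the next. -/
theorem exists_tiles_iff : (∃ ts : List (List (Option α) × List (Option α)), (∀ t ∈ ts, IsTile R t) ∧
    (x.map some ++ [none]) ++ ts.flatMap Prod.snd = ts.flatMap Prod.fst ++ (y.map some ++ [none])) ↔
      ReflTransGen (Rewrites R) x y := by
  constructor
  · rintro ⟨ts, h, he⟩
    obtain ⟨n, hn⟩ : ∃ n, ts.length = n := ⟨_, rfl⟩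
    induction n using Nat.strong_induction_on generalizing ts x with
    | _ n ih =>
    -- The tiles before the first separator rewrite `x` into some `v`, and the remaining tiles
    -- satisfy the same equation with `v` in place of `x`.
    by_cases hs : ([none], [none]) ∈ ts
    · obtain ⟨t₁, t₂, rfl, ht⟩ := List.eq_append_cons_of_mem hs
      obtain ⟨u, v, hu, hv, huv⟩ := exists_of_tiles (ts := t₁) (fun t ht => h t (by simp [ht])) ht
      simp only [List.flatMap_append, List.flatMap_cons, hu, hv] at he
      obtain ⟨rfl, he⟩ := map_some_append_inj (by simpa using he)
      refine huv.trans (ih t₂.length ?_ t₂ (fun t ht => h t (by simp [ht])) ?_ rfl)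
      · rw [← hn]
        simp
        omega
      · simpa using he
    -- Here `x = u · y` and `v` is empty: the factor `u` is rewritten to the empty word.
    · obtain ⟨u, v, hu, hv, huv⟩ := exists_of_tiles h hs
      simp only [hu, hv] at he
      obtain ⟨rfl, hv⟩ := map_some_append_inj (x := x) (A := v.map some) (u := u ++ y) (B := [])
        (by simpa using he)
      rw [List.map_eq_nil_iff] at hv
      subst hv
      simpa using append huv [] y
  · intro h
    induction h using ReflTransGen.head_induction_on with
    | refl => exact ⟨[], by simp, by simp⟩
    | head h _ ih =>
      obtain ⟨a, l, r, b, hr, rfl, rfl⟩ := h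
      obtain ⟨ts, hts, he⟩ := ih
      let copies : List α → List (List (Option α) × List (Option α)) :=
        List.map fun a => ([some a], [some a])
      have h₁ : ∀ u, (copies u).flatMap Prod.fst = u.map some := fun u => by
        induction u <;> simp_all [copies]
      have h₂ : ∀ u, (copies u).flatMap Prod.snd = u.map some := fun u => by
        induction u <;> simp_all [copies]
      have h₃ : ∀ u, ∀ t ∈ copies u, IsTile R t := by
        intro u t ht
        obtain ⟨a, -, rfl⟩ := List.mem_map.1 ht
        exact .copy a
      refine ⟨copies a ++ (l.map some, r.map some) :: (copies b ++ ([none], [none]) :: ts), ?_, ?_⟩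
      · simp only [List.mem_append, List.mem_cons]
        rintro t (ht | rfl | ht | rfl | ht)
        exacts [h₃ _ t ht, .rule hr, h₃ _ t ht, .separator, hts t ht]
      · simp only [List.flatMap_append, List.flatMap_cons, h₁, h₂]
        simpa using he

/-- The system and the numbering of the letters depend on the rules and on the target word, but not
on `x`; so one system serves a whole family of words. -/
theorem exists_tileSystem [Finite α] (hR : {p : List α × List α | R p.1 p.2}.Finite) (y : List α) :
    ∃ (A : TileSystem) (e : α → ℕ) (s : ℕ), ∀ x, A.IsWord (x.map e ++ [s]) ∧
      (A.Solvable (x.map e ++ [s]) ↔ ReflTransGen (Rewrites R) x y) := by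
  classical
  have := Fintype.ofFinite α
  let n := Fintype.card (Option α)
  -- The letter `0` is kept free as the separator of the transducer.
  let e : Option α → ℕ := fun a => Fintype.equivFin (Option α) a + 1
  have he : Function.Injective e := fun a b h =>
    (Fintype.equivFin (Option α)).injective (Fin.ext (Nat.succ_injective h))
  have heb : ∀ l : List (Option α), ∀ b ∈ l.map e, 1 ≤ b ∧ b ≤ n := by
    intro l b hb
    obtain ⟨a, -, rfl⟩ := List.mem_map.1 hb
    have := (Fintype.equivFin (Option α) a).isLt
    simp only [e, n]
    omega
  have hfin : {t | IsTile R t}.Finite := by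
    refine ((Set.finite_singleton ([none], [none])).union
      ((Set.finite_range fun a : α => ([some a], [some a])).union
        (hR.image fun p => (p.1.map some, p.2.map some)))).subset ?_
    intro t ht
    cases ht with
    | separator => exact .inl rfl
    | copy a => exact .inr (.inl ⟨a, rfl⟩)
    | rule h => exact .inr (.inr ⟨(_, _), h, rfl⟩)
  obtain ⟨L, hL⟩ : ∃ L : List (List (Option α) × List (Option α)), ∀ t, t ∈ L ↔ IsTile R t :=
    ⟨hfin.toFinset.toList, by simp⟩
  let last := y.map some ++ [none]
  obtain ⟨C, hC⟩ : ∃ C, ∀ t ∈ (last, []) :: L, t.1.length ≤ C ∧ t.2.length ≤ C := by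
    refine ⟨(((last, []) :: L).map fun t => t.1.length + t.2.length).sum, fun t ht => ?_⟩
    have := List.le_sum_of_mem (List.mem_map_of_mem (f := fun t => t.1.length + t.2.length) ht)
    omega
  let A : TileSystem :=
    { tiles := L.map fun t => (t.1.map e, t.2.map e)
      last := last.map e
      size := n
      bound := C
      mem_tiles := by
        intro t ht
        obtain ⟨t, -, rfl⟩ := List.mem_map.1 ht
        exact ⟨heb _, heb _⟩
      length_tiles := by
        intro t ht
        obtain ⟨t, ht', rfl⟩ := List.mem_map.1 ht
        simpa using hC t (List.mem_cons_of_mem _ ht')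
      mem_last := heb _
      length_last := by simpa using (hC (last, []) (by simp)).1
      last_ne_nil := by simp [last] }
  refine ⟨A, fun a => e (some a), e none, fun x => ?_⟩
  have hx : x.map (fun a => e (some a)) ++ [e none] = (x.map some ++ [none]).map e := by simp
  rw [hx, ← exists_tiles_iff]
  refine ⟨heb _, ?_⟩
  have hget : ∀ i (hi : i < L.length), A.tiles.getD i ([], []) = (L[i].1.map e, L[i].2.map e) := by
    intro i hi
    simp [A, hi]
  have hlen : A.tiles.length = L.length := by simp [A]
  have hfg : ∀ (w : List ℕ) (hw : ∀ i ∈ w, i < L.length),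
      A.f w = ((w.pmap (fun i hi => L[i]) hw).flatMap Prod.snd).map e ∧
      A.g w = ((w.pmap (fun i hi => L[i]) hw).flatMap Prod.fst).map e := by
    intro w hw
    induction w with
    | nil => exact ⟨rfl, rfl⟩
    | cons i w ih =>
      simp only [List.mem_cons, forall_eq_or_imp] at hw
      obtain ⟨h₁, h₂⟩ := ih hw.2
      simp only [TileSystem.f, TileSystem.g] at h₁ h₂
      simp only [TileSystem.f, TileSystem.g, List.flatMap_cons, List.pmap_cons, List.map_append,
        hget i hw.1, h₁, h₂, and_self]
  constructor
  · rintro ⟨w, hw, h⟩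
    have hw : ∀ i ∈ w, i < L.length := fun i hi => hlen ▸ hw i hi
    refine ⟨w.pmap (fun i hi => L[i]) hw, ?_, ?_⟩
    · intro t ht
      obtain ⟨i, -, hi, rfl⟩ := List.mem_pmap.1 ht
      exact (hL _).1 (List.getElem_mem _)
    · rw [(hfg w hw).1, (hfg w hw).2] at h
      refine List.map_injective_iff.2 he ?_
      simpa [A, last] using h
  · rintro ⟨ts, hts, h⟩
    obtain ⟨w, hw, rfl⟩ : ∃ (w : List ℕ) (hw : ∀ i ∈ w, i < L.length),
        ts = w.pmap (fun i hi => L[i]) hw := by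
      clear h
      induction ts with
      | nil => exact ⟨[], by simp, rfl⟩
      | cons t ts ih =>
        simp only [List.mem_cons, forall_eq_or_imp] at hts
        obtain ⟨w, hw, rfl⟩ := ih hts.2
        obtain ⟨i, hi, rfl⟩ := List.getElem_of_mem ((hL t).2 hts.1)
        exact ⟨i :: w, by simp only [List.mem_cons, forall_eq_or_imp]; exact ⟨hi, hw⟩, rfl⟩
    refine ⟨w, fun i hi => hlen ▸ hw i hi, ?_⟩
    rw [(hfg w hw).1, (hfg w hw).2]
    have := congrArg (List.map e) h
    simpa [A, last] using this

end Rewrites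

/-! ### Turing machines as string rewriting systems -/

namespace TM0Rewriting

open Relation Turing

variable {Γ Λ : Type*} [Inhabited Γ] [Inhabited Λ] (M : TM0.Machine Γ Λ) (S : Set Λ)

/-- The symbols of the words that stand for configurations: tape symbols, states, the symbol `none` of
halting and the two ends of the tape. -/
abbrev Sym (Γ : Type*) {Λ : Type*} (S : Set Λ) : Type _ := Γ ⊕ Option S ⊕ Bool

variable {S}

abbrev cell (a : Γ) : Sym Γ S := .inl a

abbrev state (q : S) : Sym Γ S := .inr (.inl (some q))

abbrev halted : Sym Γ S := .inr (.inl none)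

abbrev leftEnd : Sym Γ S := .inr (.inr false)

abbrev rightEnd : Sym Γ S := .inr (.inr true)

/-- The rules that simulate `M` and erase the tape when it has halted. -/
inductive Rule : List (Sym Γ S) → List (Sym Γ S) → Prop where
  | write {q q' : S} {a b : Γ} (h : M q a = some (q'.1, .write b)) :
      Rule [state q, cell a] [state q', cell b]
  | moveRight {q q' : S} {a : Γ} (h : M q a = some (q'.1, .move Turing.Dir.right)) :
      Rule [state q, cell a] [cell a, state q']
  | moveLeft {q q' : S} {a : Γ} (c : Γ) (h : M q a = some (q'.1, .move Turing.Dir.left)) :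
      Rule [cell c, state q, cell a] [state q', cell c, cell a]
  | moveLeftEnd {q q' : S} {a : Γ} (h : M q a = some (q'.1, .move Turing.Dir.left)) :
      Rule [leftEnd, state q, cell a] [leftEnd, state q', cell default, cell a]
  | extend (q : S) : Rule [state q, rightEnd] [state q, cell default, rightEnd]
  | halt {q : S} {a : Γ} (h : M q a = none) : Rule [state q, cell a] [halted]
  | eraseLeft (a : Γ) : Rule [cell a, halted] [halted]
  | eraseRight (a : Γ) : Rule [halted, cell a] [halted]
  | eraseEnds : Rule [leftEnd, halted, rightEnd] [halted]

theorem finite_rule [Finite Γ] (hS : S.Finite) :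
    {p : List (Sym Γ S) × List (Sym Γ S) | Rule M p.1 p.2}.Finite := by
  have := hS.to_subtype
  refine ((List.finite_length_le (Sym Γ S) 4).prod (List.finite_length_le (Sym Γ S) 4)).subset ?_
  rintro ⟨l, r⟩ h
  change l.length ≤ 4 ∧ r.length ≤ 4
  replace h : Rule M l r := h
  cases h <;> simp

/-- The word for a configuration, `l` being the tape to the left of the head, in reverse. -/
def word (l : List Γ) (q : S) (r : List Γ) : List (Sym Γ S) :=
  leftEnd :: (l.reverse.map cell ++ state q :: (r.map cell ++ [rightEnd]))

/-- The machine halts when started in a given configuration. -/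
def Halts (q : Λ) (T : Turing.Tape Γ) : Prop :=
  (StateTransition.eval (TM0.step M) ⟨q, T⟩).Dom

variable {M}

theorem halts_of_eq_none {q : Λ} {T : Turing.Tape Γ} (h : M q T.1 = none) : Halts M q T :=
  Part.dom_iff_mem.2 ⟨_, StateTransition.mem_eval.2 ⟨.refl, by simp [TM0.step, h]⟩⟩

theorem step_eq {q q' : Λ} {T : Turing.Tape Γ} {s : TM0.Stmt Γ} (h : M q T.1 = some (q', s)) :
    TM0.step M ⟨q, T⟩ = some ⟨q', match s with
      | .move d => T.move d
      | .write a => T.write a⟩ := by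
  cases s <;> simp [TM0.step, h]

theorem halts_iff_of_step {c c' : TM0.Cfg Γ Λ} (h : TM0.step M c = some c') :
    Halts M c.q c.Tape ↔ Halts M c'.q c'.Tape := by
  have : StateTransition.Reaches (TM0.step M) c c' := ReflTransGen.single h
  rw [Halts, Halts, StateTransition.reaches_eval this]

variable {l r : List Γ} {q q' : S}

/-- The word of a configuration contains a single state symbol, which fixes the place where a rule
can apply. -/
theorem word_inj {a b : List (Sym Γ S)} {q₀ : S} (h : word l q r = a ++ state q₀ :: b) :
    a = leftEnd :: l.reverse.map cell ∧ q₀ = q ∧ b = r.map cell ++ [rightEnd] := by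
  change (leftEnd :: l.reverse.map cell) ++ state q :: (r.map cell ++ [rightEnd]) = _ at h
  rcases List.append_eq_append_iff.1 h with ⟨c, rfl, hb⟩ | ⟨c, ha, hb⟩
  · cases c with
    | nil => simp at hb ⊢; simp_all
    | cons d c =>
      injection hb with h₁ h₂
      have : state q₀ ∈ (r.map cell ++ [rightEnd] : List (Sym Γ S)) := by simp [h₂]
      simp at this
  · cases c with
    | nil => simp at hb ha ⊢; simp_all
    | cons d c =>
      injection hb with h₁ h₂
      have : state q₀ ∈ (leftEnd :: l.reverse.map cell : List (Sym Γ S)) := by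
        rw [ha, h₁]
        exact List.mem_append_right _ List.mem_cons_self
      simp at this

theorem exists_cons_of_word {a b : List (Sym Γ S)} {q₀ : S} {c : Γ}
    (h : word l q r = a ++ [state q₀, cell c] ++ b) : ∃ r', r = c :: r' ∧ q₀ = q ∧
      a = leftEnd :: l.reverse.map cell ∧ b = r'.map cell ++ [rightEnd] := by
  rw [List.append_assoc] at h
  obtain ⟨h₁, h₂, h₃⟩ := word_inj h
  cases r with
  | nil => simp at h₃
  | cons d r =>
    replace h₃ : cell c :: b = cell d :: (r.map cell ++ [rightEnd]) := h₃
    simp only [List.cons.injEq, Sum.inl.injEq] at h₃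
    exact ⟨r, by rw [h₃.1], h₂, h₁, h₃.2⟩

theorem mk₂_default : Turing.Tape.mk₂ l [default] = Turing.Tape.mk₂ l [] := by
  have : ListBlank.mk [(default : Γ)] = ListBlank.mk [] := by
    have := (ListBlank.mk ([] : List Γ)).cons_head_tail
    simpa using this
  rw [Turing.Tape.mk₂, this, Turing.Tape.mk₂]

/-- Until the machine halts, erasing rules are inapplicable because `halted` does not occur, and
every other rule applies only around the state symbol. Such a rewriting step performs a machine step
or appends a blank, which does not change the tape. -/
theorem halts_of_reaches (h : ReflTransGen (Rewrites (Rule M)) (word l q r) [halted]) :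
    Halts M q (.mk₂ l r) := by
  generalize hu : word l q r = u at h
  induction h using ReflTransGen.head_induction_on generalizing l q r with
  | refl => simp [word] at hu
  | head h _ ih =>
    subst hu
    obtain ⟨a, x, y, b, hr, he, rfl⟩ := h
    have hno : halted ∉ word l q r := by simp [word]
    cases hr with
    | eraseLeft => simp [he] at hno
    | eraseRight => simp [he] at hno
    | eraseEnds => simp [he] at hno
    | halt h =>
      obtain ⟨r, rfl, rfl, -, -⟩ := exists_cons_of_word he
      exact halts_of_eq_none (by simpa [Turing.Tape.mk₂] using h)
    | write h =>
      obtain ⟨r, rfl, rfl, rfl, rfl⟩ := exists_cons_of_word he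
      rw [halts_iff_of_step (step_eq (by simpa [Turing.Tape.mk₂] using h))]
      simpa [Turing.Tape.mk₂] using ih (l := l) (r := _ :: r) (by simp [word])
    | moveRight h =>
      obtain ⟨r, rfl, rfl, rfl, rfl⟩ := exists_cons_of_word he
      rw [halts_iff_of_step (step_eq (by simpa [Turing.Tape.mk₂] using h))]
      simpa [Turing.Tape.mk₂] using ih (l := _ :: l) (r := r) (by simp [word])
    | @moveLeft q₀ q' a₀ c h =>
      rw [show a ++ [cell c, state q₀, cell a₀] ++ b = (a ++ [cell c]) ++ [state q₀, cell a₀] ++ b by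
        simp] at he
      obtain ⟨r, rfl, rfl, hl, rfl⟩ := exists_cons_of_word he
      obtain ⟨l, rfl, rfl⟩ : ∃ l', l = c :: l' ∧ a = leftEnd :: l'.reverse.map cell := by
        cases l with
        | nil =>
          have := (List.append_inj' (s₁ := a) (s₂ := []) (t₁ := [cell c]) (t₂ := [leftEnd])
            (by simpa using hl) rfl).2
          simp at this
        | cons d l =>
          obtain ⟨h₁, h₂⟩ := List.append_inj' (s₁ := a) (s₂ := leftEnd :: l.reverse.map cell)
            (t₁ := [cell c]) (t₂ := [cell d]) (by simpa using hl) rfl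
          simp only [List.cons.injEq, Sum.inl.injEq, and_true] at h₂
          exact ⟨l, by rw [h₂], h₁⟩
      rw [halts_iff_of_step (step_eq (by simpa [Turing.Tape.mk₂] using h))]
      simpa [Turing.Tape.mk₂] using ih (l := l) (r := c :: a₀ :: r) (by simp [word])
    | @moveLeftEnd q₀ q' a₀ h =>
      rw [show a ++ [leftEnd, state q₀, cell a₀] ++ b = (a ++ [leftEnd]) ++ [state q₀, cell a₀] ++ b by
        simp] at he
      obtain ⟨r, rfl, rfl, hl, rfl⟩ := exists_cons_of_word he
      obtain ⟨rfl, rfl⟩ : l = [] ∧ a = [] := by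
        cases l with
        | nil => exact ⟨rfl, by simpa using hl⟩
        | cons d l =>
          obtain ⟨-, h₂⟩ := List.append_inj' (s₁ := a) (s₂ := leftEnd :: l.reverse.map cell)
            (t₁ := [leftEnd]) (t₂ := [cell d]) (by simpa using hl) rfl
          simp at h₂
      rw [halts_iff_of_step (step_eq (by simpa [Turing.Tape.mk₂] using h))]
      simpa [Turing.Tape.mk₂] using ih (l := []) (r := default :: a₀ :: r) (by simp [word])
    | extend q₀ =>
      rw [List.append_assoc] at he
      obtain ⟨rfl, rfl, hb⟩ := word_inj he
      obtain ⟨rfl, rfl⟩ : r = [] ∧ b = [] := by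
        cases r with
        | nil => simpa using hb
        | cons d r => simp at hb
      have := ih (l := l) (r := [default]) (q := q₀) (by simp [word])
      rwa [mk₂_default] at this

theorem erase_reaches (l r : List Γ) : ReflTransGen (Rewrites (Rule M))
    (leftEnd :: (l.reverse.map cell ++ halted :: (r.map cell ++ [rightEnd])) : List (Sym Γ S))
    [halted] := by
  induction r with
  | nil =>
    induction l with
    | nil => exact .single (Rewrites.of_rule [] [] Rule.eraseEnds)
    | cons a l ih =>
      refine .head ?_ ih
      have := Rewrites.of_rule (R := Rule M (S := S)) (leftEnd :: l.reverse.map cell) [rightEnd]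
        (.eraseLeft a)
      simpa using this
  | cons a r ih =>
    refine .head ?_ ih
    have := Rewrites.of_rule (R := Rule M (S := S)) (leftEnd :: l.reverse.map cell)
      (r.map cell ++ [rightEnd]) (.eraseRight a)
    simpa using this

/-- A blank is appended when the head stands beyond the written cells, because the simulating rules
need a cell after the state. -/
theorem exists_cons_reaches (l r : List Γ) (q : S) : ∃ a r',
    Turing.Tape.mk₂ l r = Turing.Tape.mk₂ l (a :: r') ∧
      ReflTransGen (Rewrites (Rule M)) (word l q r) (word l q (a :: r')) := by
  cases r with
  | nil =>
    refine ⟨default, [], mk₂_default.symm, .single ?_⟩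
    have := Rewrites.of_rule (R := Rule M) (leftEnd :: l.reverse.map cell) [] (.extend q)
    simpa [word] using this
  | cons a r => exact ⟨a, r, rfl, .refl⟩

/-- The computation is followed step by step, supportedness keeping its states in `S`; after the
halting rule the whole tape is erased. -/
theorem reaches_of_halts (hS : TM0.Supports M S) (h : Halts M q (.mk₂ l r)) :
    ReflTransGen (Rewrites (Rule M)) (word l q r) [halted] := by
  obtain ⟨c', hc⟩ := Part.dom_iff_mem.1 h
  obtain ⟨hr, hn⟩ := StateTransition.mem_eval.1 hc
  clear h hc
  generalize hcfg : (⟨q, .mk₂ l r⟩ : TM0.Cfg Γ Λ) = c at hr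
  induction hr using ReflTransGen.head_induction_on generalizing l q r with
  | refl =>
    subst hcfg
    obtain ⟨a, r, he, hw⟩ := exists_cons_reaches (M := M) l r q
    rw [he] at hn
    have hM : M q a = none := by simpa [TM0.step, Turing.Tape.mk₂] using hn
    refine (hw.tail ?_).trans (erase_reaches l r)
    have := Rewrites.of_rule (R := Rule M) (leftEnd :: l.reverse.map cell)
      (r.map cell ++ [rightEnd]) (.halt hM)
    simpa [word] using this
  | head h _ ih =>
    subst hcfg
    obtain ⟨a, r, he, hw⟩ := exists_cons_reaches (M := M) l r q
    rw [he] at h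
    refine hw.trans ?_
    obtain ⟨q', s, hM⟩ : ∃ q' s, M q a = some (q', s) := by
      cases hM : M q a with
      | none => simp [TM0.step, Turing.Tape.mk₂, hM] at h
      | some p => exact ⟨p.1, p.2, rfl⟩
    obtain ⟨q', rfl⟩ : ∃ p : S, p.1 = q' := ⟨⟨q', hS.2 hM q.2⟩, rfl⟩
    rw [Option.mem_def, step_eq (T := .mk₂ l (a :: r)) (by simpa [Turing.Tape.mk₂] using hM),
      Option.some.injEq] at h
    match s with
    | .write b =>
      refine .head ?_ (ih (l := l) (q := q') (r := b :: r) ?_)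
      · have := Rewrites.of_rule (R := Rule M) (leftEnd :: l.reverse.map cell)
          (r.map cell ++ [rightEnd]) (.write hM)
        simpa [word] using this
      · rw [← h]
        simp [Turing.Tape.mk₂]
    | .move .right =>
      refine .head ?_ (ih (l := a :: l) (q := q') (r := r) ?_)
      · have := Rewrites.of_rule (R := Rule M) (leftEnd :: l.reverse.map cell)
          (r.map cell ++ [rightEnd]) (.moveRight hM)
        simpa [word] using this
      · rw [← h]
        simp [Turing.Tape.mk₂]
    | .move .left =>
      cases l with
      | nil =>
        refine .head ?_ (ih (l := []) (q := q') (r := default :: a :: r) ?_)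
        · have := Rewrites.of_rule (R := Rule M) [] (r.map cell ++ [rightEnd]) (.moveLeftEnd hM)
          simpa [word] using this
        · rw [← h]
          simp [Turing.Tape.mk₂]
      | cons c l =>
        refine .head ?_ (ih (l := l) (q := q') (r := c :: a :: r) ?_)
        · have := Rewrites.of_rule (R := Rule M) (leftEnd :: l.reverse.map cell)
            (r.map cell ++ [rightEnd]) (.moveLeft c hM)
          simpa [word] using this
        · rw [← h]
          simp [Turing.Tape.mk₂]

theorem reaches_iff_halts (hS : TM0.Supports M S) :
    ReflTransGen (Rewrites (Rule M)) (word l q r) [halted] ↔ Halts M q (.mk₂ l r) :=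
  ⟨halts_of_reaches, reaches_of_halts hS⟩

end TM0Rewriting

/-! ### The halting problem for word equations -/

namespace HaltingProblem

open Turing PartrecToTM2

theorem trPosNum_iterate (k : ℕ) : trPosNum (PosNum.bit0^[k] 1) = List.replicate k Γ'.bit0 ++ [Γ'.bit1] := by
  induction k with
  | zero => rfl
  | succ k ih =>
    rw [Function.iterate_succ_apply', trPosNum, ih]
    rfl

/-- Powers of two are used as inputs because their binary numerals, lowest digit first, have such a
simple form that the initial tape is evidently computable from `k`. -/
theorem trNat_two_pow (k : ℕ) : trNat (2 ^ k) = List.replicate k Γ'.bit0 ++ [Γ'.bit1] := by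
  have h : ((2 ^ k : ℕ) : Num) = Num.pos (PosNum.bit0^[k] 1) := by
    rw [← Num.of_to_nat (Num.pos (PosNum.bit0^[k] 1))]
    congr 1
    induction k with
    | zero => rfl
    | succ k ih =>
      rw [Function.iterate_succ_apply', pow_succ, ih]
      simp [PosNum.cast_bit0, mul_two]
  rw [trNat, h, trNum, trPosNum_iterate]

/-- The code with a given number, run on the input `0`, as a function of powers of two. -/
noncomputable def evalLog (N : ℕ) : Part ℕ :=
  (Nat.rfind fun k => Part.some (decide (N = 2 ^ k))).bind fun k =>
    (Denumerable.ofNat Nat.Partrec.Code k).eval 0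

theorem partrec_evalLog : Partrec evalLog := by
  refine Partrec.bind (Partrec.rfind ?_) ?_
  · have : Primrec₂ fun (N k : ℕ) => decide (N = 2 ^ k) := by
      have hp : Primrec fun k : ℕ => 2 ^ k := by
        have : Primrec (Nat.rec 1 fun _ m => m + m : ℕ → ℕ) :=
          Primrec.nat_rec₁ 1 (Primrec.nat_add.comp Primrec.snd Primrec.snd).to₂
        refine this.of_eq fun k => ?_
        induction k with
        | zero => rfl
        | succ k ih => rw [pow_succ, mul_two, ← ih]
      exact (Primrec.eq.comp Primrec.fst (hp.comp Primrec.snd)).decide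
    exact this.to_comp
  · exact Nat.Partrec.Code.eval_part.comp ((Computable.ofNat _).comp Computable.snd)
      (Computable.const 0)

theorem evalLog_two_pow (k : ℕ) :
    evalLog (2 ^ k) = (Denumerable.ofNat Nat.Partrec.Code k).eval 0 := by
  have : (Nat.rfind fun m => Part.some (decide (2 ^ k = 2 ^ m))) = Part.some k := by
    refine Part.eq_some_iff.2 (Nat.mem_rfind.2 ⟨by simp, fun {m} hm => ?_⟩)
    have : ¬ 2 ^ k = 2 ^ m := fun h => hm.ne' (Nat.pow_right_injective (le_refl 2) h)
    simp [this]
  rw [evalLog, this, Part.bind_some]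

theorem eval_tr_dom {K : Type*} {Γ : K → Type*} {Λ σ : Type*} [DecidableEq K] [Inhabited Λ] [Inhabited σ]
    (M : Λ → TM2.Stmt Γ Λ σ) (k : K) (L : List (Γ k)) :
    (TM0.eval (TM1to0.tr (TM2to1.tr M)) (TM2to1.trInit k L)).Dom ↔ (TM2.eval M k L).Dom := by
  rw [TM1to0.tr_eval, TM2to1.tr_eval_dom]

/-- A Turing machine for which the halting problem on the inputs `a · b · cᵏ` is undecidable. -/
theorem exists_tm0 : ∃ (Γ Λ : Type) (_ : Inhabited Γ) (_ : Inhabited Λ) (M : TM0.Machine Γ Λ)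
    (S : Set Λ) (a b c : Γ), Finite Γ ∧ S.Finite ∧ TM0.Supports M S ∧
    ∀ k, TM0Rewriting.Halts M default (.mk₂ [] (a :: b :: List.replicate k c)) ↔
      ((Denumerable.ofNat Nat.Partrec.Code k).eval 0).Dom := by
  obtain ⟨C, hC⟩ := ToPartrec.Code.exists_code (Nat.Partrec'.part_iff₁.2 partrec_evalLog)
  let _ : Inhabited PartrecToTM2.Λ' := ⟨trNormal C Cont'.halt⟩
  have : Finite K' := Finite.of_injective (fun k : K' => (K'.casesOn k 0 1 2 3 : Fin 4)) (by
    rintro (_ | _ | _ | _) (_ | _ | _ | _) h <;> first | rfl | cases h)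
  let sym : PartrecToTM2.Γ' → K' → Option PartrecToTM2.Γ' := fun g =>
    Function.update (fun _ => none) K'.main (some g)
  refine ⟨TM2to1.Γ' K' fun _ => PartrecToTM2.Γ', _, inferInstance, inferInstance,
    TM1to0.tr (TM2to1.tr PartrecToTM2.tr), _, (true, sym .cons), (false, sym .bit1), (false, sym .bit0),
    inferInstanceAs (Finite (Bool × (K' → Option PartrecToTM2.Γ'))), Finset.finite_toSet _, TM1to0.tr_supports _ (TM2to1.tr_supports _
      (PartrecToTM2.tr_supports C Cont'.halt)), fun k => ?_⟩
  -- The stack is laid out on the tape in reverse, with its bottom cell marked by `true`.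
  have h₁ : TM2to1.trInit K'.main (trList [2 ^ k]) =
      (true, sym .cons) :: (false, sym .bit1) :: List.replicate k (false, sym .bit0) := by
    have : (trList [2 ^ k]).reverse = .cons :: .bit1 :: List.replicate k .bit0 := by
      simp [trList, trNat_two_pow]
    rw [TM2to1.trInit, this]
    exact congrArg (fun l => (true, sym .cons) :: (false, sym .bit1) :: l) List.map_replicate
  have h₂ : (TM0.eval (TM1to0.tr (TM2to1.tr PartrecToTM2.tr))
      (TM2to1.trInit K'.main (trList [2 ^ k]))).Dom ↔
      (TM2.eval PartrecToTM2.tr K'.main (trList [2 ^ k])).Dom := eval_tr_dom _ _ _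
  have h₃ : TM2.init K'.main (trList [2 ^ k]) = PartrecToTM2.init C [2 ^ k] := by
    rw [TM2.init, PartrecToTM2.init]
    congr 1
    funext s
    cases s <;> rfl
  rw [h₁] at h₂
  refine Iff.trans h₂ ?_
  change (StateTransition.eval (TM2.step PartrecToTM2.tr) (TM2.init K'.main (trList [2 ^ k]))).Dom ↔ _
  rw [h₃, PartrecToTM2.tr_eval]
  have h₄ := hC ⟨[2 ^ k], rfl⟩
  change C.eval [2 ^ k] = pure <$> evalLog (2 ^ k) at h₄
  rw [h₄, evalLog_two_pow]
  rfl

open TM0Rewriting in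
/-- A family of word equations whose solvability is the halting problem. -/
theorem exists_tileSystem : ∃ (A : TileSystem) (x : ℕ → List ℕ), Primrec x ∧ (∀ k, A.IsWord (x k)) ∧
    ∀ k, A.Solvable (x k) ↔ ((Denumerable.ofNat Nat.Partrec.Code k).eval 0).Dom := by
  obtain ⟨Γ, Λ, _, _, M, S, a, b, c, _, hS, hM, h⟩ := exists_tm0
  have := hS.to_subtype
  obtain ⟨A, e, s, hA⟩ := Rewrites.exists_tileSystem (TM0Rewriting.finite_rule M hS)
    [TM0Rewriting.halted]
  let q : S := ⟨default, hM.1⟩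
  let w : ℕ → List (TM0Rewriting.Sym Γ S) := fun k =>
    TM0Rewriting.word [] q (a :: b :: List.replicate k c)
  refine ⟨A, fun k => (w k).map e ++ [s], ?_, fun k => (hA _).1, fun k => ?_⟩
  · have : Primrec fun k => [e leftEnd, e (state q), e (cell a), e (cell b)] ++
        List.replicate k (e (cell c)) ++ [e rightEnd, s] :=
      Primrec.list_append.comp (Primrec.list_append.comp (Primrec.const _)
        (PCPInstance.primrec_replicate Primrec.id _)) (Primrec.const _)
    exact this.of_eq fun k => by simp [w, TM0Rewriting.word]
  · rw [(hA _).2, TM0Rewriting.reaches_iff_halts hM, h]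

/-- No computable predicate decides a property that holds exactly for the unsolvable equations. -/
theorem not_computable {P : TwoWayTransducer → Prop}
    (h₁ : ∀ (A : TileSystem) x, A.IsWord x → ¬ A.Solvable x → P (A.transducer x))
    (h₂ : ∀ (A : TileSystem) x, A.IsWord x → A.Solvable x → ¬ P (A.transducer x)) :
    ¬ ∃ D : TwoWayTransducer → Prop, ComputablePred D ∧ ∀ T : TwoWayTransducer, T.WellFormed →
      T.IsSweeping → ¬ T.IsFunctional → (D T ↔ P T) := by
  rintro ⟨D, hD, h⟩
  obtain ⟨d, hd, rfl⟩ := ComputablePred.computable_iff.1 hD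
  obtain ⟨A, x, hx, hw, hA⟩ := exists_tileSystem
  have hcomp : Computable fun c : Nat.Partrec.Code => A.transducer (x (Encodable.encode c)) :=
    (A.primrec_transducer.comp (hx.comp Primrec.encode)).to_comp
  refine ComputablePred.halting_problem 0 ?_
  -- Composing the alleged decision procedure with the reduction and negating it would decide
  -- whether a code halts on `0`.
  have : ComputablePred fun c : Nat.Partrec.Code =>
      ¬ (d (A.transducer (x (Encodable.encode c))) = true) :=
    (ComputablePred.computable_iff.2 ⟨_, hd.comp hcomp, rfl⟩).not
  refine this.of_eq fun c => ?_
  refine (not_congr (h _ TileSystem.structured_transducer.wellFormed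
    TileSystem.structured_transducer.isSweeping TileSystem.not_isFunctional)).trans ?_
  have hc : A.Solvable (x (Encodable.encode c)) ↔ (c.eval 0).Dom := by
    rw [hA, Denumerable.ofNat_encode]
  rw [← hc]
  exact ⟨fun h => by_contra fun h' => h (h₁ A _ (hw _) h'), h₂ A _ (hw _)⟩

end HaltingProblem

/-- The first part is the reduction from the Post Correspondence Problem; the second and third parts
say that no algorithm decides one-way definability on all non-functional sweeping transducers,
where the one-way transducers may, respectively may not, use `ε`-transitions. -/
theorem proposition9p3 :
    (∃ S : PCPInstance → TwoWayTransducer, Computable S ∧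
      ∀ τ : PCPInstance, τ.Valid →
        (S τ).WellFormed ∧ (S τ).IsSweeping ∧ (S τ).rel = τ.badEncodings ∧
        (τ.NoLetterErased → ((S τ).OneWayDefinable ↔ ¬ τ.HasSolution))) ∧
    (¬ ∃ D : TwoWayTransducer → Prop, ComputablePred D ∧
      ∀ T : TwoWayTransducer, T.WellFormed → T.IsSweeping → ¬ T.IsFunctional →
        (D T ↔ T.OneWayDefinable)) ∧
    (¬ ∃ D : TwoWayTransducer → Prop, ComputablePred D ∧
      ∀ T : TwoWayTransducer, T.WellFormed → T.IsSweeping → ¬ T.IsFunctional →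
        (D T ↔ T.EpsFreeOneWayDefinable)) :=
  ⟨PCPInstance.exists_computable_reduction,
    HaltingProblem.not_computable
      (fun _ _ hx h => (TileSystem.epsFreeOneWayDefinable_of_not_solvable hx h).oneWayDefinable)
      (fun _ _ hx h => TileSystem.not_oneWayDefinable_of_solvable hx h),
    HaltingProblem.not_computable
      (fun _ _ hx h => TileSystem.epsFreeOneWayDefinable_of_not_solvable hx h)
      (fun _ _ hx h h' => TileSystem.not_oneWayDefinable_of_solvable hx h h'.oneWayDefinable)⟩
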